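/- **Theorem 6 (Asymptotics for short maturity barrier option).** Let $\mu\in\mathbb R$, $\sigma>0$ and $B>0$ be constants. There are constants $C>0$ and $T_0>0$, depending only on $\mu,\sigma,B$, such that the following holds. Let $0<S<B$, and let $X$ be a geometric Brownian motion, i.e. a continuous adapted solution of the stochastic differential equation $$dX_t=\mu X_t\,dt+\sigma X_t\,dW_t,\qquad X_0=S\ \text{a.s.},$$ on a filtered probability space with a standard one-dimensional Brownian motion $W$. Let $0<T\le T_0$ and let $\Psi:C[0,T]\to\mathbb R$ be Lipschitz continuous with respect to the supremum norm, with Lipschitz constant $L$. Put $$P(B,T):=\mathbb P\Big(\max_{0\le t\le T}X_t\ge B\Big).$$ Then the payoff $\Psi(\{X_t\}_{0\le t\le T})\,\mathbf 1_{\{\max_{0\le t\le T}X_t\ge B\}}$ is integrable, and its expectation, the fair price of the up-and-in barrier option, satisfies $$\mathbb E\Big[\Psi(\{X_t\}_{0\le t\le T})\,\mathbf 1_{\{\max_{0\le t\le T}X_t\ge B\}}\Big]=P(B,T)\Big[\Psi\big(\{S(B/S)^{t/T}\}_{0\le t\le T}\big)+r\Big]\quad\text{for some } r\in\mathbb R \text{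 with } |r|\le C\,L\,\sqrt T .$$ In particular, for payoffs $\Psi=\Psi_T$ with a common Lipschitz constant, $r=O(\sqrt T)$ as $T\to0^+$. -/

import Mathlib

open MeasureTheory ProbabilityTheory
open scoped NNReal ENNReal

/-- `W` is a standard one-dimensional Brownian motion with respect to the filtration `F`:
it is a Brownian motion (Gaussian finite-dimensional laws with covariance `min s t`, almost surely
continuous paths, started at `0`), it is adapted to `F`, and its increments after time `s` are
independent of `F s`. -/
structure IsBrownianWithFiltration {Ω : Type*} {mΩ : MeasurableSpace Ω}
    (F : Filtration ℝ≥0 mΩ) (W : ℝ≥0 → Ω → ℝ) (P : Measure Ω) : Prop where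
  isBrownian : IsBrownianReal W P
  adapted : ∀ t, Measurable[F t] (W t)
  indep_increments : ∀ s t, s ≤ t →
    Indep (MeasurableSpace.comap (fun ω => W t ω - W s ω) inferInstance) (F s) P

/-- The left-endpoint sum `∑_{i < n} H_{p i} (W_{p (i+1)} - W_{p i})`. -/
def itoSum {Ω : Type*} (H W : ℝ≥0 → Ω → ℝ) (n : ℕ) (p : ℕ → ℝ≥0) (ω : Ω) : ℝ :=
  ∑ i ∈ Finset.range n, H (p i) ω * (W (p (i + 1)) ω - W (p i) ω)

/-- `Z` is (a version of) the Itô integral `∫₀ᵗ H dW` of an adapted integrand `H` with continuous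
paths: the left-endpoint sums over the partitions `0 = p 0 ≤ p 1 ≤ ⋯ ≤ p n = t` converge to `Z` in
probability as the mesh tends to zero. -/
def IsItoIntegral {Ω : Type*} {mΩ : MeasurableSpace Ω} (P : Measure Ω)
    (H W : ℝ≥0 → Ω → ℝ) (t : ℝ≥0) (Z : Ω → ℝ) : Prop :=
  ∀ ε : ℝ, 0 < ε → ∃ δ : ℝ, 0 < δ ∧
    ∀ (n : ℕ) (p : ℕ → ℝ≥0), Monotone p → p 0 = 0 → p n = t →
      (∀ i < n, (p (i + 1) : ℝ) - (p i : ℝ) < δ) →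
      P {ω | ε ≤ |itoSum H W n p ω - Z ω|} ≤ ENNReal.ofReal ε

/-- `X` is a solution, on the filtered probability space `(Ω, F, P)` with `F`-Brownian motion `W`,
of the stochastic differential equation `dX = μ X dt + σ X dW`, `X₀ = S` almost surely:
`X` is adapted with almost surely continuous paths, and for each `t`, almost surely,
`X t = X 0 + ∫₀ᵗ μ X_s ds + ∫₀ᵗ σ X_s dW_s`. -/
structure IsGBMSolution {Ω : Type*} {mΩ : MeasurableSpace Ω} (P : Measure Ω)
    (F : Filtration ℝ≥0 mΩ) (W : ℝ≥0 → Ω → ℝ) (μ σ S : ℝ) (X : ℝ≥0 → Ω → ℝ) : Prop where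
  brownian : IsBrownianWithFiltration F W P
  adapted : ∀ t, Measurable[F t] (X t)
  cont : ∀ᵐ ω ∂P, Continuous (fun t => X t ω)
  init : ∀ᵐ ω ∂P, X 0 ω = S
  sde : ∃ I : ℝ≥0 → Ω → ℝ,
    (∀ t, IsItoIntegral P (fun s ω => σ * X s ω) W t (I t)) ∧
    ∀ t : ℝ≥0, ∀ᵐ ω ∂P,
      X t ω = X 0 ω + (∫ s in (0 : ℝ)..(t : ℝ), μ * X s.toNNReal ω) + I t ω

/-- The path `{x_t}_{0 ≤ t ≤ T}` as an element of `C[0,T]`; the value `0` is used only for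
functions that are not continuous on `[0,T]`. -/
noncomputable def pathOn (T : ℝ≥0) (x : ℝ≥0 → ℝ) : C(Set.Icc (0 : ℝ≥0) T, ℝ) :=
  open Classical in
  if h : Continuous (fun t : Set.Icc (0 : ℝ≥0) T => x t) then ⟨fun t => x t, h⟩ else 0

/-- The exponential curve `t ↦ S (B/S)^{t/T}` in `C[0,T]`. -/
noncomputable def exponentialCurve (S B : ℝ) (hS : 0 < S) (hB : 0 < B) (T : ℝ≥0) :
    C(Set.Icc (0 : ℝ≥0) T, ℝ) where
  toFun t := S * (B / S) ^ (((t : ℝ≥0) : ℝ) / (T : ℝ))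
  continuous_toFun := by
    have h := Real.continuous_const_rpow (div_pos hB hS).ne'
    fun_prop

/-- The event `{max_{0 ≤ t ≤ T} X_t ≥ B}`. -/
def barrierEvent {Ω : Type*} (X : ℝ≥0 → Ω → ℝ) (B : ℝ) (T : ℝ≥0) : Set Ω :=
  {ω | B ≤ ⨆ t : Set.Icc (0 : ℝ≥0) T, X t ω}

/-- The payoff `Ψ({X_t}_{0 ≤ t ≤ T}) · 1{max_{0 ≤ t ≤ T} X_t ≥ B}` of the up-and-in option. -/
noncomputable def barrierPayoff {Ω : Type*} (X : ℝ≥0 → Ω → ℝ) (B : ℝ) (T : ℝ≥0)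
    (Ψ : C(Set.Icc (0 : ℝ≥0) T, ℝ) → ℝ) : Ω → ℝ :=
  (barrierEvent X B T).indicator (fun ω => Ψ (pathOn T (fun t => X t ω)))

/-!
The solution is `X t = S * exp (σ W t + (μ - σ² / 2) t)`: the Itô integral being given as a limit
of left-endpoint sums, this is read off the Euler scheme of `X`, which telescopes against the
inverse of the exponential up to errors that vanish with the mesh.

By Brownian scaling, `X (T s) = S * exp (σ √T Y s)` on `[0, 1]`, where `Y` is a Brownian motion
with a drift bounded uniformly in `T ≤ 1`. Reaching `B` means that `Y` reaches a level `y`, and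
the curve `S (B / S) ^ (t / T)` corresponds to the line of slope `y`. At the first passage of a
walk on a grid, the future goes up with probability bounded below and independently of the past,
so exponential moments of the deviation from the line on the passage event are controlled by those
on the event that the walk ends above `y`. There the deviation is a bridge, independent of the
endpoint, plus a multiple of the overshoot, whose Gaussian exponential moments are bounded
uniformly in `y`. Fatou's lemma passes to continuous time. Hence, conditionally on reaching `B`,
the expected sup-distance of `X` from the curve is `O(√T)`, and the Lipschitz bound concludes.
-/

theorem measureReal_le_abs_le {Ω : Type*} {mΩ : MeasurableSpace Ω} {P : Measure Ω} {f : Ω → ℝ}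
    (hf : MemLp f 2 P) {a : ℝ} (ha : 0 < a) :
    P.real {ω | a ≤ |f ω|} ≤ (∫ ω, f ω ^ 2 ∂P) / a ^ 2 := by
  have hset : {ω | a ≤ |f ω|} = {ω | a ^ 2 ≤ f ω ^ 2} := by
    ext ω
    rw [Set.mem_ofPred_eq, Set.mem_ofPred_eq, ← sq_abs (f ω), sq_le_sq₀ ha.le (abs_nonneg _)]
  rw [hset, le_div_iff₀ (by positivity), mul_comm]
  exact mul_meas_ge_le_integral_of_nonneg (ae_of_all _ fun ω => sq_nonneg _) hf.integrable_sq _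

/-- The step data of a discrete stochastic integral `∑ i, G i * ξ i`: the coefficient `G i` is
known at time `i`, and the noise `ξ i` is known at time `i + 1` and independent of the past; both
are square integrable. The noise need not be centred. -/
structure IsMartingaleTransform {Ω : Type*} {mΩ : MeasurableSpace Ω} (P : Measure Ω)
    (𝓖 : Filtration ℕ mΩ) (G ξ : ℕ → Ω → ℝ) : Prop where
  measurable_coeff : ∀ i, Measurable[𝓖 i] (G i)
  memLp_coeff : ∀ i, MemLp (G i) 2 P
  measurable_noise : ∀ i, Measurable[𝓖 (i + 1)] (ξ i)
  memLp_noise : ∀ i, MemLp (ξ i) 2 P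
  indep_noise : ∀ i, Indep (MeasurableSpace.comap (ξ i) inferInstance) (𝓖 i) P

namespace IsMartingaleTransform

variable {Ω : Type*} {mΩ : MeasurableSpace Ω} {P : Measure Ω}
  {𝓖 : Filtration ℕ mΩ} {G ξ : ℕ → Ω → ℝ}

theorem measurable_sum (h : IsMartingaleTransform P 𝓖 G ξ) (n : ℕ) :
    Measurable[𝓖 n] fun ω => ∑ i ∈ Finset.range n, G i ω * ξ i ω := by
  refine Finset.measurable_fun_sum _ fun i hi => ?_
  have hin : i < n := Finset.mem_range.1 hi
  exact Measurable.mul ((h.measurable_coeff i).mono (𝓖.mono hin.le) le_rfl)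
    ((h.measurable_noise i).mono (𝓖.mono hin) le_rfl)

theorem indepFun_noise (h : IsMartingaleTransform P 𝓖 G ξ) {i : ℕ} {f : Ω → ℝ}
    (hf : Measurable[𝓖 i] f) : IndepFun f (ξ i) P := by
  rw [IndepFun_iff_Indep]
  exact indep_of_indep_of_le_left (h.indep_noise i).symm hf.comap_le

theorem integral_mul_comp_noise (h : IsMartingaleTransform P 𝓖 G ξ) {i : ℕ} {f : Ω → ℝ}
    (hf : Measurable[𝓖 i] f) {φ : ℝ → ℝ} (hφ : Measurable φ) :
    ∫ ω, f ω * φ (ξ i ω) ∂P = (∫ ω, f ω ∂P) * ∫ ω, φ (ξ i ω) ∂P :=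
  ((h.indepFun_noise hf).comp measurable_id hφ).integral_mul_eq_mul_integral
    (hf.mono (𝓖.le i) le_rfl).aestronglyMeasurable
    (hφ.comp ((h.measurable_noise i).mono (𝓖.le _) le_rfl)).aestronglyMeasurable

theorem memLp_mul (h : IsMartingaleTransform P 𝓖 G ξ) (i : ℕ) :
    MemLp (fun ω => G i ω * ξ i ω) 2 P := by
  have hmeas : AEStronglyMeasurable (fun ω => G i ω * ξ i ω) P :=
    (h.memLp_coeff i).aestronglyMeasurable.mul (h.memLp_noise i).aestronglyMeasurable
  rw [memLp_two_iff_integrable_sq hmeas]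
  simp_rw [mul_pow]
  exact ((h.indepFun_noise (h.measurable_coeff i)).comp (measurable_id.pow_const 2)
    (measurable_id.pow_const 2)).integrable_mul (h.memLp_coeff i).integrable_sq
    (h.memLp_noise i).integrable_sq

theorem memLp_sum (h : IsMartingaleTransform P 𝓖 G ξ) (n : ℕ) :
    MemLp (fun ω => ∑ i ∈ Finset.range n, G i ω * ξ i ω) 2 P :=
  memLp_finsetSum _ fun i _ => h.memLp_mul i

theorem integral_sum_mul_step (h : IsMartingaleTransform P 𝓖 G ξ) (h0 : ∀ i, ∫ ω, ξ i ω ∂P = 0)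
    (n : ℕ) :
    ∫ ω, (∑ i ∈ Finset.range n, G i ω * ξ i ω) * (G n ω * ξ n ω) ∂P = 0 := by
  have hfactor := h.integral_mul_comp_noise
    ((h.measurable_sum n).mul (h.measurable_coeff n)) measurable_id
  simpa only [Pi.mul_apply, id, h0, mul_zero, mul_assoc] using hfactor

theorem integral_sum_sq (h : IsMartingaleTransform P 𝓖 G ξ) (h0 : ∀ i, ∫ ω, ξ i ω ∂P = 0)
    (n : ℕ) :
    ∫ ω, (∑ i ∈ Finset.range n, G i ω * ξ i ω) ^ 2 ∂P =
      ∑ i ∈ Finset.range n, (∫ ω, G i ω ^ 2 ∂P) * ∫ ω, ξ i ω ^ 2 ∂P := by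
  induction n with
  | zero => simp
  | succ n ih =>
    have hcross : Integrable (fun ω => 2 * ((∑ i ∈ Finset.range n, G i ω * ξ i ω) *
        (G n ω * ξ n ω))) P := ((h.memLp_sum n).integrable_mul (h.memLp_mul n)).const_mul 2
    have hsq := (h.memLp_sum n).integrable_sq
    have hstep : ∫ ω, (G n ω * ξ n ω) ^ 2 ∂P = (∫ ω, G n ω ^ 2 ∂P) * ∫ ω, ξ n ω ^ 2 ∂P := by
      simp_rw [mul_pow]
      exact h.integral_mul_comp_noise ((h.measurable_coeff n).pow_const 2)
        (measurable_id.pow_const 2)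
    simp_rw [Finset.sum_range_succ, add_sq, mul_assoc (2 : ℝ)]
    rw [integral_add (by exact hsq.add hcross) (h.memLp_mul n).integrable_sq,
      integral_add hsq hcross, integral_const_mul, h.integral_sum_mul_step h0, ih, hstep]
    ring

theorem integral_drift_sum_sq_le (h : IsMartingaleTransform P 𝓖 G ξ) {e : ℕ → ℝ} {γ m : ℝ} {n : ℕ}
    (hγ : ∀ i < n, ∫ ω, G i ω ^ 2 ∂P ≤ γ) (he : ∀ i < n, |e i| ≤ m) :
    ∫ ω, (∑ i ∈ Finset.range n, G i ω * e i) ^ 2 ∂P ≤ n ^ 2 * m ^ 2 * γ := by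
  have he2 : ∑ i ∈ Finset.range n, e i ^ 2 ≤ n * m ^ 2 := by
    calc _ ≤ ∑ _i ∈ Finset.range n, m ^ 2 := Finset.sum_le_sum fun i hi =>
          sq_le_sq.2 ((he i (Finset.mem_range.1 hi)).trans (le_abs_self m))
      _ = n * m ^ 2 := by simp
  have hG2 (i : ℕ) := (h.memLp_coeff i).integrable_sq
  calc _ ≤ ∫ ω, (∑ i ∈ Finset.range n, G i ω ^ 2) * (n * m ^ 2) ∂P := by
        refine integral_mono_of_nonneg (ae_of_all _ fun ω => sq_nonneg _)
          ((integrable_finsetSum _ fun i _ => hG2 i).mul_const _) (ae_of_all _ fun ω => ?_)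
        exact (Finset.sum_mul_sq_le_sq_mul_sq _ _ _).trans <|
          mul_le_mul_of_nonneg_left he2 (Finset.sum_nonneg fun i _ => sq_nonneg _)
    _ = (∑ i ∈ Finset.range n, ∫ ω, G i ω ^ 2 ∂P) * (n * m ^ 2) := by
        rw [integral_mul_const, integral_finsetSum _ fun i _ => hG2 i]
    _ ≤ (∑ _i ∈ Finset.range n, γ) * (n * m ^ 2) := by
        gcongr with i hi
        exact hγ i (Finset.mem_range.1 hi)
    _ = n ^ 2 * m ^ 2 * γ := by
        rw [Finset.sum_const, Finset.card_range, nsmul_eq_mul]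
        ring

/-- The event that the partial sums up to step `j` have not left `[-K, K]`. Cutting the
coefficients off outside it stops the discrete stochastic integral at its exit from `[-K, K]`. -/
def stayEvent (G ξ : ℕ → Ω → ℝ) (K : ℝ) (j : ℕ) : Set Ω :=
  {ω | ∀ i ≤ j, |∑ k ∈ Finset.range i, G k ω * ξ k ω| ≤ K}

theorem measurableSet_stayEvent (h : IsMartingaleTransform P 𝓖 G ξ) (K : ℝ) (j : ℕ) :
    MeasurableSet[𝓖 j] (stayEvent G ξ K j) := by
  simp only [stayEvent, Set.ofPred_forall]
  refine MeasurableSet.iInter fun i => MeasurableSet.iInter fun hi => ?_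
  exact measurable_norm.comp ((h.measurable_sum i).mono (𝓖.mono hi) le_rfl) measurableSet_Iic

theorem stopped (h : IsMartingaleTransform P 𝓖 G ξ) (K : ℝ) :
    IsMartingaleTransform P 𝓖 (fun j => (stayEvent G ξ K j).indicator (G j)) ξ where
  __ := h
  measurable_coeff j := (h.measurable_coeff j).indicator (h.measurableSet_stayEvent K j)
  memLp_coeff j := (h.memLp_coeff j).indicator (𝓖.le j _ (h.measurableSet_stayEvent K j))

/-- Once the partial sums leave `[-K, K]` the stopped sum is frozen at the exit value. -/
theorem lt_abs_stopped_sum {K : ℝ} {n : ℕ} {ω : Ω}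
    (hω : ∃ i ≤ n, K < |∑ j ∈ Finset.range i, G j ω * ξ j ω|) :
    K < |∑ j ∈ Finset.range n, (stayEvent G ξ K j).indicator (G j) ω * ξ j ω| := by
  classical
  obtain ⟨hle, hexit⟩ := Nat.find_spec hω
  have hstay (j : ℕ) (hj : j < Nat.find hω) : ω ∈ stayEvent G ξ K j := fun i hij =>
    le_of_not_gt fun hlt => Nat.find_min hω (hij.trans_lt hj) ⟨(hij.trans_lt hj).le.trans hle, hlt⟩
  have hgone (j : ℕ) (hj : Nat.find hω ≤ j) : ω ∉ stayEvent G ξ K j := fun h =>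
    hexit.not_ge (h _ hj)
  rw [← Finset.sum_range_add_sum_Ico _ hle, Finset.sum_eq_zero (s := Finset.Ico _ _) fun j hj => by
    rw [Set.indicator_of_notMem (hgone j (Finset.mem_Ico.1 hj).1), zero_mul], add_zero]
  refine hexit.trans_eq (congrArg abs (Finset.sum_congr rfl fun j hj => ?_))
  rw [Set.indicator_of_mem (hstay j (Finset.mem_range.1 hj))]

variable [IsProbabilityMeasure P]

theorem center (h : IsMartingaleTransform P 𝓖 G ξ) :
    IsMartingaleTransform P 𝓖 G fun i ω => ξ i ω - ∫ ω, ξ i ω ∂P where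
  __ := h
  measurable_noise i := (h.measurable_noise i).sub_const _
  memLp_noise i := (h.memLp_noise i).sub (memLp_const _)
  indep_noise i := indep_of_indep_of_le_left (h.indep_noise i) <|
    Measurable.comap_le <| (comap_measurable (ξ i)).sub_const _

theorem integral_centered_sum_sq_le (h : IsMartingaleTransform P 𝓖 G ξ) {γ v : ℝ} {n : ℕ}
    (hγ : ∀ i < n, ∫ ω, G i ω ^ 2 ∂P ≤ γ) (hv : ∀ i < n, ∫ ω, ξ i ω ^ 2 ∂P ≤ v) :
    ∫ ω, (∑ i ∈ Finset.range n, G i ω * (ξ i ω - ∫ ω, ξ i ω ∂P)) ^ 2 ∂P ≤ n * (γ * v) := by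
  have hmean (i : ℕ) : ∫ ω, (ξ i ω - ∫ ω, ξ i ω ∂P) ∂P = 0 := by
    rw [integral_sub ((h.memLp_noise i).integrable one_le_two) (integrable_const _)]
    simp
  have hvar (i : ℕ) (hi : i < n) : ∫ ω, (ξ i ω - ∫ ω, ξ i ω ∂P) ^ 2 ∂P ≤ v := by
    rw [← variance_eq_integral (h.memLp_noise i).aemeasurable]
    exact (variance_le_expectation_sq (h.memLp_noise i).aestronglyMeasurable).trans (hv i hi)
  rw [h.center.integral_sum_sq hmean]
  calc _ ≤ ∑ _i ∈ Finset.range n, γ * v := Finset.sum_le_sum fun i hi =>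
        have hin := Finset.mem_range.1 hi
        mul_le_mul (hγ i hin) (hvar i hin) (integral_nonneg fun ω => sq_nonneg _)
          ((integral_nonneg fun ω => sq_nonneg _).trans (hγ i hin))
    _ = n * (γ * v) := by simp

theorem integral_sum_sq_le (h : IsMartingaleTransform P 𝓖 G ξ) {γ m v : ℝ} {n : ℕ}
    (hγ : ∀ i < n, ∫ ω, G i ω ^ 2 ∂P ≤ γ) (hm : ∀ i < n, |∫ ω, ξ i ω ∂P| ≤ m)
    (hv : ∀ i < n, ∫ ω, ξ i ω ^ 2 ∂P ≤ v) :
    ∫ ω, (∑ i ∈ Finset.range n, G i ω * ξ i ω) ^ 2 ∂P ≤ 2 * γ * (n * v + n ^ 2 * m ^ 2) := by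
  have hcentered := (h.center.memLp_sum n).integrable_sq.const_mul 2
  have hdrift : Integrable (fun ω => 2 * (∑ i ∈ Finset.range n, G i ω * ∫ ω, ξ i ω ∂P) ^ 2) P :=
    (memLp_finsetSum _ fun i _ => (h.memLp_coeff i).mul_const _).integrable_sq.const_mul 2
  have hsplit (ω : Ω) : (∑ i ∈ Finset.range n, G i ω * ξ i ω) ^ 2 ≤
      2 * (∑ i ∈ Finset.range n, G i ω * (ξ i ω - ∫ ω, ξ i ω ∂P)) ^ 2 +
        2 * (∑ i ∈ Finset.range n, G i ω * ∫ ω, ξ i ω ∂P) ^ 2 := by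
    rw [← mul_add]
    refine le_of_eq_of_le ?_ add_sq_le
    simp_rw [← Finset.sum_add_distrib, ← mul_add, sub_add_cancel]
  calc _ ≤ _ := integral_mono (h.memLp_sum n).integrable_sq (hcentered.add hdrift) hsplit
    _ ≤ 2 * (n * (γ * v)) + 2 * (n ^ 2 * m ^ 2 * γ) := by
        rw [integral_add' hcentered hdrift, integral_const_mul, integral_const_mul]
        have := h.integral_centered_sum_sq_le hγ hv
        have := h.integral_drift_sum_sq_le hγ hm
        linarith
    _ = _ := by ring

/-- Kolmogorov's maximal inequality, from Markov's inequality for the stopped sum. -/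
theorem measureReal_exists_lt_abs_sum_le (h : IsMartingaleTransform P 𝓖 G ξ)
    (h0 : ∀ i, ∫ ω, ξ i ω ∂P = 0) {K : ℝ} (hK : 0 < K) (n : ℕ) :
    P.real {ω | ∃ i ≤ n, K < |∑ j ∈ Finset.range i, G j ω * ξ j ω|} ≤
      (∑ i ∈ Finset.range n, (∫ ω, G i ω ^ 2 ∂P) * ∫ ω, ξ i ω ^ 2 ∂P) / K ^ 2 := by
  set Z : Ω → ℝ := fun ω => ∑ j ∈ Finset.range n, (stayEvent G ξ K j).indicator (G j) ω * ξ j ω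
  have hcoeff (i : ℕ) : ∫ ω, (stayEvent G ξ K i).indicator (G i) ω ^ 2 ∂P ≤ ∫ ω, G i ω ^ 2 ∂P :=
    integral_mono ((h.stopped K).memLp_coeff i).integrable_sq (h.memLp_coeff i).integrable_sq
      fun ω => sq_le_sq.2 (norm_indicator_le_norm_self (G i) ω)
  calc _ ≤ P.real {ω | K ≤ |Z ω|} := measureReal_mono fun ω hω => (lt_abs_stopped_sum hω).le
    _ ≤ (∫ ω, Z ω ^ 2 ∂P) / K ^ 2 := measureReal_le_abs_le ((h.stopped K).memLp_sum n) hK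
    _ ≤ _ := by
        rw [(h.stopped K).integral_sum_sq h0 n]
        exact div_le_div_of_nonneg_right (Finset.sum_le_sum fun i _ =>
          mul_le_mul_of_nonneg_right (hcoeff i) (integral_nonneg fun ω => sq_nonneg _))
          (sq_nonneg K)

end IsMartingaleTransform

section GaussianStep

theorem abs_exp_sub_one_le_abs_mul_exp_abs (v : ℝ) : |Real.exp v - 1| ≤ |v| * Real.exp |v| := by
  have h := Complex.norm_exp_sub_sum_le_norm_mul_exp v 1
  simp only [Finset.sum_range_one, pow_zero, Nat.factorial_zero, Nat.cast_one, div_one, pow_one,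
    Complex.norm_real, Real.norm_eq_abs] at h
  exact_mod_cast h

theorem abs_exp_sub_one_sub_le_sq_mul_exp_abs (v : ℝ) :
    |Real.exp v - 1 - v| ≤ v ^ 2 * Real.exp |v| := by
  have h := Complex.norm_exp_sub_sum_le_norm_mul_exp v 2
  simp only [Finset.sum_range_succ, Finset.sum_range_zero, zero_add, pow_zero, pow_one,
    Nat.factorial, Nat.cast_one, div_one, Nat.mul_one, ← sub_sub, Complex.norm_real,
    Real.norm_eq_abs, sq_abs] at h
  exact_mod_cast h

theorem integrable_exp_mul_abs_gaussianReal (a m : ℝ) (v : ℝ≥0) :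
    Integrable (fun x => Real.exp (a * |x|)) (gaussianReal m v) :=
  integrable_exp_mul_abs (X := fun x => x) (integrable_exp_mul_gaussianReal a)
    (integrable_exp_mul_gaussianReal (-a))

theorem gaussianReal_zero_eq_map_sqrt (v : ℝ≥0) :
    gaussianReal 0 v = (gaussianReal 0 1).map (√(v : ℝ) * ·) := by
  rw [gaussianReal_map_const_mul]
  congr 1
  · simp
  · ext; simp

theorem memLp_and_integral_sq_le_of_abs_le_exp {f : ℝ → ℝ} (hf : Measurable f) {v : ℝ≥0}
    {A b : ℝ} (h : ∀ z, |f (√(v : ℝ) * z)| ≤ A * Real.exp (b * |z|)) :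
    MemLp f 2 (gaussianReal 0 v) ∧
      ∫ x, f x ^ 2 ∂gaussianReal 0 v ≤ A ^ 2 * ∫ z, Real.exp (2 * b * |z|) ∂gaussianReal 0 1 := by
  have hscale : Measurable fun z : ℝ => √(v : ℝ) * z := measurable_const_mul _
  have hsq (z : ℝ) : f (√(v : ℝ) * z) ^ 2 ≤ A ^ 2 * Real.exp (2 * b * |z|) := by
    have := pow_le_pow_left₀ (abs_nonneg _) (h z) 2
    rwa [sq_abs, mul_pow, ← Real.exp_nat_mul, Nat.cast_ofNat, ← mul_assoc] at this
  have hdom := (integrable_exp_mul_abs_gaussianReal (2 * b) 0 1).const_mul (A ^ 2)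
  have hinteg : Integrable (fun z => f (√(v : ℝ) * z) ^ 2) (gaussianReal 0 1) :=
    hdom.mono' ((hf.comp hscale).pow_const 2).aestronglyMeasurable
      (ae_of_all _ fun z => (Real.norm_of_nonneg (sq_nonneg _)).trans_le (hsq z))
  rw [memLp_two_iff_integrable_sq hf.aestronglyMeasurable, gaussianReal_zero_eq_map_sqrt v,
    integrable_map_measure (hf.pow_const 2).aestronglyMeasurable hscale.aemeasurable,
    integral_map hscale.aemeasurable (hf.pow_const 2).aestronglyMeasurable, ← integral_const_mul]
  exact ⟨hinteg, integral_mono hinteg hdom hsq⟩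

theorem integral_exp_mul_gaussianReal (a : ℝ) (v : ℝ≥0) :
    ∫ x, Real.exp (a * x) ∂gaussianReal 0 v = Real.exp (v * a ^ 2 / 2) := by
  have := congrFun (mgf_fun_id_gaussianReal (μ := 0) (v := v)) a
  simpa [mgf] using this

theorem integrable_mul_exp_gaussianReal (a : ℝ) (v : ℝ≥0) :
    Integrable (fun x => x * Real.exp (a * x)) (gaussianReal 0 v) := by
  have := integrable_pow_mul_exp_of_mem_interior_integrableExpSet
    (X := id) (μ := gaussianReal 0 v) (v := a) (by simp) 1
  simpa using this

theorem integral_mul_exp_gaussianReal (a : ℝ) (v : ℝ≥0) :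
    ∫ x, x * Real.exp (a * x) ∂gaussianReal 0 v = v * a * Real.exp (v * a ^ 2 / 2) := by
  have hmgf := hasDerivAt_mgf (X := id) (μ := gaussianReal 0 v) (t := a) (by simp)
  have hexp : HasDerivAt (fun t : ℝ => Real.exp (0 * t + v * t ^ 2 / 2))
      (Real.exp (0 * a + v * a ^ 2 / 2) * (0 * 1 + v * a)) a := by
    refine HasDerivAt.exp (HasDerivAt.add ((hasDerivAt_id' a).const_mul 0) ?_)
    · simpa [mul_div_assoc] using ((hasDerivAt_pow 2 a).const_mul (v : ℝ)).div_const 2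
  rw [mgf_id_gaussianReal] at hmgf
  simpa [mul_comm] using hmgf.unique hexp

/-- The increment of `log X` over a step of length `v` in which the Brownian motion moves
by `x`, where `dX = μ X dt + σ X dW`. -/
noncomputable def logReturn (μ σ v x : ℝ) : ℝ := σ * x + (μ - σ ^ 2 / 2) * v

/-- The relative change of `1 / X` over a step of length `v` in which the Brownian motion moves
by `x`, where `dX = μ X dt + σ X dW`. -/
noncomputable def invStep (μ σ v x : ℝ) : ℝ := Real.exp (-logReturn μ σ v x) - 1

/-- The relative change of `x̂ / X` over a step of length `v` in which the Brownian motion moves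
by `x`, where `dX = μ X dt + σ X dW` and `x̂` follows the Euler scheme. -/
noncomputable def eulerInvStep (μ σ v x : ℝ) : ℝ :=
  (1 + μ * v + σ * x) * Real.exp (-logReturn μ σ v x) - 1

variable (μ σ : ℝ)

theorem measurable_logReturn (v : ℝ) : Measurable (logReturn μ σ v) := by
  unfold logReturn; fun_prop

theorem measurable_invStep (v : ℝ) : Measurable (invStep μ σ v) :=
  (measurable_logReturn μ σ v).neg.exp.sub_const 1

theorem measurable_eulerInvStep (v : ℝ) : Measurable (eulerInvStep μ σ v) :=
  (((measurable_id.const_mul σ).const_add _).mul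
    (measurable_logReturn μ σ v).neg.exp).sub_const 1

section PointwiseBounds

variable {v : ℝ} (hv0 : 0 ≤ v) (hv1 : v ≤ 1) (z : ℝ)
include hv0 hv1

theorem abs_logReturn_sqrt_mul_le :
    |logReturn μ σ v (√v * z)| ≤ √v * (|σ| * |z| + |μ - σ ^ 2 / 2|) := by
  have hv : v ≤ √v := Real.le_sqrt_of_sq_le (by nlinarith)
  calc _ ≤ |σ * (√v * z)| + |(μ - σ ^ 2 / 2) * v| := abs_add_le _ _
    _ = √v * (|σ| * |z|) + |μ - σ ^ 2 / 2| * v := by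
        rw [abs_mul, abs_mul, abs_mul, abs_of_nonneg (Real.sqrt_nonneg v), abs_of_nonneg hv0]
        ring
    _ ≤ √v * (|σ| * |z|) + |μ - σ ^ 2 / 2| * √v := by gcongr
    _ = _ := by ring

theorem abs_logReturn_sqrt_mul_le' :
    |logReturn μ σ v (√v * z)| ≤ |σ| * |z| + |μ - σ ^ 2 / 2| :=
  (abs_logReturn_sqrt_mul_le μ σ hv0 hv1 z).trans <|
    mul_le_of_le_one_left (by positivity) (Real.sqrt_le_one.2 hv1)

theorem abs_invStep_sqrt_mul_le :
    |invStep μ σ v (√v * z)| ≤ √v * Real.exp (2 * (|σ| * |z| + |μ - σ ^ 2 / 2|)) := by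
  have hy := abs_logReturn_sqrt_mul_le μ σ hv0 hv1 z
  have hy' := abs_logReturn_sqrt_mul_le' μ σ hv0 hv1 z
  set q := |σ| * |z| + |μ - σ ^ 2 / 2|
  set y := logReturn μ σ v (√v * z)
  calc _ ≤ |y| * Real.exp |y| := by
        rw [invStep, ← abs_neg y]
        exact abs_exp_sub_one_le_abs_mul_exp_abs _
    _ ≤ √v * q * Real.exp q := by gcongr
    _ ≤ √v * Real.exp q * Real.exp q := by
        gcongr
        linarith [Real.add_one_le_exp q]
    _ = √v * Real.exp (2 * q) := by rw [mul_assoc, ← Real.exp_add, two_mul]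

/-- The Euler factor `1 + μ v + σ x` agrees with `exp y`, `y = logReturn μ σ v x`, up to
`σ² v / 2` and the second-order remainder of the exponential, both of order `v`. -/
theorem abs_eulerInvStep_sqrt_mul_le :
    |eulerInvStep μ σ v (√v * z)| ≤
      v * (σ ^ 2 / 2 + 2) * Real.exp (3 * (|σ| * |z| + |μ - σ ^ 2 / 2|)) := by
  have hy := abs_logReturn_sqrt_mul_le μ σ hv0 hv1 z
  have hy' := abs_logReturn_sqrt_mul_le' μ σ hv0 hv1 z
  have hreturn : logReturn μ σ v (√v * z) = σ * (√v * z) + (μ - σ ^ 2 / 2) * v := rfl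
  set q := |σ| * |z| + |μ - σ ^ 2 / 2|
  have hq0 : 0 ≤ q := by positivity
  set y := logReturn μ σ v (√v * z) with hy_def
  have hfactor : eulerInvStep μ σ v (√v * z) =
      Real.exp (-y) * (σ ^ 2 / 2 * v - (Real.exp y - 1 - y)) := by
    have hinv : Real.exp (-y) * Real.exp y = 1 := by
      rw [← Real.exp_add, neg_add_cancel, Real.exp_zero]
    rw [eulerInvStep, ← hy_def]
    linear_combination hinv - Real.exp (-y) * hreturn
  have hremainder : |Real.exp y - 1 - y| ≤ v * (q ^ 2 * Real.exp q) := by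
    calc _ ≤ |y| ^ 2 * Real.exp |y| := by
          rw [sq_abs]
          exact abs_exp_sub_one_sub_le_sq_mul_exp_abs y
      _ ≤ (√v * q) ^ 2 * Real.exp q := by gcongr
      _ = v * (q ^ 2 * Real.exp q) := by rw [mul_pow, Real.sq_sqrt hv0, mul_assoc]
  have hmain : |σ ^ 2 / 2 * v| = v * (σ ^ 2 / 2) := by
    rw [abs_of_nonneg (by positivity), mul_comm]
  have hsq : q ^ 2 ≤ 2 * Real.exp q := by linarith [Real.quadratic_le_exp_of_nonneg hq0]
  calc _ = Real.exp (-y) * |σ ^ 2 / 2 * v - (Real.exp y - 1 - y)| := by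
        rw [hfactor, abs_mul, Real.abs_exp]
    _ ≤ Real.exp q * (v * (σ ^ 2 / 2) + v * (q ^ 2 * Real.exp q)) := by
        gcongr
        · exact (neg_le_abs y).trans hy'
        · exact (abs_sub _ _).trans (add_le_add hmain.le hremainder)
    _ ≤ Real.exp q * (v * (σ ^ 2 / 2 * (Real.exp q * Real.exp q)) +
          v * (2 * Real.exp q * Real.exp q)) := by
        gcongr
        exact le_mul_of_one_le_right (by positivity)
          (one_le_mul_of_one_le_of_one_le (Real.one_le_exp hq0) (Real.one_le_exp hq0))
    _ = v * (σ ^ 2 / 2 + 2) * (Real.exp q * Real.exp q * Real.exp q) := by ring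
    _ = _ := by rw [← Real.exp_add, ← Real.exp_add]; ring_nf

end PointwiseBounds

theorem exp_neg_logReturn (v x : ℝ) :
    Real.exp (-logReturn μ σ v x) =
      Real.exp (-(μ - σ ^ 2 / 2) * v) * Real.exp (-σ * x) := by
  rw [← Real.exp_add, logReturn]
  ring_nf

theorem exp_drift_mul_exp_variance (v : ℝ) :
    Real.exp (-(μ - σ ^ 2 / 2) * v) * Real.exp (v * (-σ) ^ 2 / 2) =
      Real.exp ((σ ^ 2 - μ) * v) := by
  rw [← Real.exp_add]
  ring_nf

theorem integral_invStep (v : ℝ≥0) :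
    ∫ x, invStep μ σ v x ∂gaussianReal 0 v = Real.exp ((σ ^ 2 - μ) * v) - 1 := by
  simp_rw [invStep, exp_neg_logReturn]
  rw [integral_sub ((integrable_exp_mul_gaussianReal (-σ)).const_mul _) (integrable_const _),
    integral_const_mul, integral_exp_mul_gaussianReal, exp_drift_mul_exp_variance]
  simp

theorem integral_eulerInvStep (v : ℝ≥0) :
    ∫ x, eulerInvStep μ σ v x ∂gaussianReal 0 v =
      Real.exp ((σ ^ 2 - μ) * v) * (1 - (σ ^ 2 - μ) * v) - 1 := by
  have hexpand (x : ℝ) : eulerInvStep μ σ v x =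
      (1 + μ * v) * Real.exp (-(μ - σ ^ 2 / 2) * v) * Real.exp (-σ * x) +
        σ * Real.exp (-(μ - σ ^ 2 / 2) * v) * (x * Real.exp (-σ * x)) - 1 := by
    rw [eulerInvStep, exp_neg_logReturn]
    ring
  have hexp := (integrable_exp_mul_gaussianReal (μ := 0) (v := v) (-σ)).const_mul
    ((1 + μ * v) * Real.exp (-(μ - σ ^ 2 / 2) * v))
  have hmul := (integrable_mul_exp_gaussianReal (-σ) v).const_mul
    (σ * Real.exp (-(μ - σ ^ 2 / 2) * v))
  simp_rw [hexpand]
  rw [integral_sub (by exact hexp.add hmul) (integrable_const _), integral_add hexp hmul,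
    integral_const_mul, integral_const_mul, integral_exp_mul_gaussianReal,
    integral_mul_exp_gaussianReal, ← exp_drift_mul_exp_variance]
  simp only [integral_const, probReal_univ, smul_eq_mul, one_mul]
  ring

/-- `φ` is square integrable for `ρ`, with mean and second moment at most `b`: the size of one
step of a random walk, `b` being of the order of the power of the step length that matters. -/
structure HasMomentsLE (ρ : Measure ℝ) (φ : ℝ → ℝ) (b : ℝ) : Prop where
  memLp : MemLp φ 2 ρ
  abs_integral_le : |∫ x, φ x ∂ρ| ≤ b
  integral_sq_le : ∫ x, φ x ^ 2 ∂ρ ≤ b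

theorem exists_invStep_hasMomentsLE :
    ∃ c : ℝ, 0 ≤ c ∧ ∀ v : ℝ≥0, v ≤ 1 →
      HasMomentsLE (gaussianReal 0 v) (invStep μ σ v) (c * v) := by
  set w := |σ ^ 2 - μ|
  set A := Real.exp (2 * |μ - σ ^ 2 / 2|)
  set J := ∫ z, Real.exp (2 * (2 * |σ|) * |z|) ∂gaussianReal 0 1
  have : 0 ≤ J := integral_nonneg fun z => (Real.exp_pos _).le
  refine ⟨A ^ 2 * J + w * Real.exp w, by positivity, fun v hv => ?_⟩
  have hv1 : (v : ℝ) ≤ 1 := by exact_mod_cast hv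
  have hbound (z : ℝ) : |invStep μ σ v (√(v : ℝ) * z)| ≤ √v * A * Real.exp (2 * |σ| * |z|) := by
    refine (abs_invStep_sqrt_mul_le μ σ v.coe_nonneg hv1 z).trans_eq ?_
    rw [mul_assoc, ← Real.exp_add]
    ring_nf
  obtain ⟨hmem, hsq⟩ := memLp_and_integral_sq_le_of_abs_le_exp (measurable_invStep μ σ v) hbound
  have hw : |(σ ^ 2 - μ) * v| = w * v := by rw [abs_mul, abs_of_nonneg v.coe_nonneg]
  refine ⟨hmem, ?_, hsq.trans ?_⟩
  · rw [integral_invStep]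
    calc _ ≤ w * v * Real.exp (w * v) := hw ▸ abs_exp_sub_one_le_abs_mul_exp_abs _
      _ ≤ w * v * Real.exp w := by
          gcongr
          exact mul_le_of_le_one_right (abs_nonneg _) hv1
      _ = w * Real.exp w * v := by ring
      _ ≤ _ := by
          gcongr
          exact le_add_of_nonneg_left (by positivity)
  · rw [mul_pow, Real.sq_sqrt v.coe_nonneg]
    calc _ = A ^ 2 * J * v := by ring
      _ ≤ _ := by
          gcongr
          exact le_add_of_nonneg_right (by positivity)

theorem exists_eulerInvStep_hasMomentsLE :
    ∃ c : ℝ, 0 ≤ c ∧ ∀ v : ℝ≥0, v ≤ 1 →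
      HasMomentsLE (gaussianReal 0 v) (eulerInvStep μ σ v) (c * (v : ℝ) ^ 2) := by
  set w := |σ ^ 2 - μ|
  set A := (σ ^ 2 / 2 + 2) * Real.exp (3 * |μ - σ ^ 2 / 2|)
  set J := ∫ z, Real.exp (2 * (3 * |σ|) * |z|) ∂gaussianReal 0 1
  have : 0 ≤ J := integral_nonneg fun z => (Real.exp_pos _).le
  refine ⟨A ^ 2 * J + Real.exp w * (w ^ 2 * Real.exp w), by positivity, fun v hv => ?_⟩
  have hv1 : (v : ℝ) ≤ 1 := by exact_mod_cast hv
  have hbound (z : ℝ) : |eulerInvStep μ σ v (√(v : ℝ) * z)| ≤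
      v * A * Real.exp (3 * |σ| * |z|) := by
    refine (abs_eulerInvStep_sqrt_mul_le μ σ v.coe_nonneg hv1 z).trans_eq ?_
    rw [mul_add 3, Real.exp_add, mul_assoc 3]
    ring
  obtain ⟨hmem, hsq⟩ :=
    memLp_and_integral_sq_le_of_abs_le_exp (measurable_eulerInvStep μ σ v) hbound
  have hw : |(σ ^ 2 - μ) * v| ≤ w := by
    rw [abs_mul, abs_of_nonneg v.coe_nonneg]
    exact mul_le_of_le_one_right (abs_nonneg _) hv1
  refine ⟨hmem, ?_, hsq.trans ?_⟩
  · have hfactor : Real.exp ((σ ^ 2 - μ) * v) * (1 - (σ ^ 2 - μ) * v) - 1 =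
        -(Real.exp ((σ ^ 2 - μ) * v) *
          (Real.exp (-((σ ^ 2 - μ) * v)) - 1 - -((σ ^ 2 - μ) * v))) := by
      have hinv : Real.exp ((σ ^ 2 - μ) * v) * Real.exp (-((σ ^ 2 - μ) * v)) = 1 := by
        rw [← Real.exp_add, add_neg_cancel, Real.exp_zero]
      linear_combination hinv
    rw [integral_eulerInvStep, hfactor, abs_neg, abs_mul, Real.abs_exp]
    calc _ ≤ Real.exp w * (((σ ^ 2 - μ) * v) ^ 2 * Real.exp w) := by
          gcongr
          · exact (le_abs_self _).trans hw
          · refine (abs_exp_sub_one_sub_le_sq_mul_exp_abs _).trans ?_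
            rw [neg_sq, abs_neg]
            gcongr
      _ = Real.exp w * (w ^ 2 * Real.exp w) * v ^ 2 := by
          rw [mul_pow, ← sq_abs (σ ^ 2 - μ)]
          ring
      _ ≤ _ := by
          gcongr
          exact le_add_of_nonneg_left (by positivity)
  · calc _ = A ^ 2 * J * v ^ 2 := by ring
      _ ≤ _ := by
          gcongr
          exact le_add_of_nonneg_right (by positivity)

end GaussianStep

section Partition

/-- `p 0 ≤ p 1 ≤ ⋯ ≤ p n` is a partition of `[s, t]` of mesh less than `δ`. As in
`IsItoIntegral`, it is recorded as a monotone sequence whose values beyond `n` are irrelevant. -/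
structure IsPartition (n : ℕ) (p : ℕ → ℝ≥0) (s t : ℝ≥0) (δ : ℝ) : Prop where
  monotone : Monotone p
  left_eq : p 0 = s
  right_eq : p n = t
  mesh_lt : ∀ i < n, (p (i + 1) : ℝ) - p i < δ

/-- The `k`-th point of the uniform partition of `[0, t]` into `n` intervals. -/
noncomputable def gridTime (t : ℝ≥0) (n k : ℕ) : ℝ≥0 := k / n * t

theorem gridTime_zero (t : ℝ≥0) (n : ℕ) : gridTime t n 0 = 0 := by simp [gridTime]

theorem gridTime_self (t : ℝ≥0) {n : ℕ} (hn : n ≠ 0) : gridTime t n n = t := by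
  rw [gridTime, div_self (Nat.cast_ne_zero.2 hn), one_mul]

theorem monotone_gridTime (t : ℝ≥0) (n : ℕ) : Monotone (gridTime t n) := fun i j hij => by
  unfold gridTime
  gcongr

theorem gridTime_le (t : ℝ≥0) {n k : ℕ} (hk : k ≤ n) : gridTime t n k ≤ t :=
  mul_le_of_le_one_left zero_le (div_le_one_of_le₀ (Nat.cast_le.2 hk) zero_le)

theorem gridTime_succ (t : ℝ≥0) (n k : ℕ) : gridTime t n (k + 1) = gridTime t n k + t / n := by
  simp only [gridTime, Nat.cast_add_one]
  ring

theorem coe_gridTime_succ_sub (t : ℝ≥0) (n k : ℕ) :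
    (gridTime t n (k + 1) : ℝ) - gridTime t n k = (t / n : ℝ≥0) := by
  rw [gridTime_succ, NNReal.coe_add, add_sub_cancel_left]

theorem eventually_div_lt (t : ℝ≥0) {δ : ℝ} (hδ : 0 < δ) :
    ∀ᶠ n : ℕ in Filter.atTop, ((t / n : ℝ≥0) : ℝ) < δ := by
  simpa using (tendsto_const_div_atTop_nhds_zero_nat (t : ℝ)).eventually_lt_const hδ

theorem isPartition_gridTime {t : ℝ≥0} {n : ℕ} {δ : ℝ} (hn : ((t / n : ℝ≥0) : ℝ) < δ) (k : ℕ) :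
    IsPartition k (gridTime t n) 0 (gridTime t n k) δ where
  monotone := monotone_gridTime t n
  left_eq := gridTime_zero t n
  right_eq := rfl
  mesh_lt i _ := (coe_gridTime_succ_sub t n i).trans_lt hn

theorem exists_isPartition {s t : ℝ≥0} (hst : s ≤ t) {δ : ℝ} (hδ : 0 < δ) :
    ∃ n p, IsPartition n p s t δ := by
  obtain ⟨n, hn, hn0⟩ :=
    ((eventually_div_lt (t - s) hδ).and (Filter.eventually_ne_atTop 0)).exists
  refine ⟨n, fun i => s + gridTime (t - s) n i, fun i j hij => ?_, ?_, ?_, fun i _ => ?_⟩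
  · exact add_le_add_right (monotone_gridTime _ n hij) s
  · rw [gridTime_zero, add_zero]
  · rw [gridTime_self _ hn0, add_tsub_cancel_of_le hst]
  · rw [NNReal.coe_add, NNReal.coe_add, add_sub_add_left_eq_sub, coe_gridTime_succ_sub]
    exact hn

theorem IsPartition.mono {n : ℕ} {p : ℕ → ℝ≥0} {s t : ℝ≥0} {δ δ' : ℝ}
    (h : IsPartition n p s t δ) (hδ : δ ≤ δ') : IsPartition n p s t δ' where
  __ := h
  mesh_lt i hi := (h.mesh_lt i hi).trans_le hδ

/-- The partition that follows `p` for `n` steps and then `q`. -/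
def joinPartition (n : ℕ) (p q : ℕ → ℝ≥0) (i : ℕ) : ℝ≥0 := if i < n then p i else q (i - n)

theorem joinPartition_of_le {n i : ℕ} {p q : ℕ → ℝ≥0} (h : p n = q 0) (hi : i ≤ n) :
    joinPartition n p q i = p i := by
  rcases hi.lt_or_eq with hi | rfl
  · exact if_pos hi
  · rw [joinPartition, if_neg (lt_irrefl i), Nat.sub_self, h]

theorem joinPartition_add (n j : ℕ) (p q : ℕ → ℝ≥0) : joinPartition n p q (n + j) = q j := by
  simp [joinPartition]

theorem IsPartition.join {n m : ℕ} {p q : ℕ → ℝ≥0} {r s t : ℝ≥0} {δ : ℝ}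
    (hp : IsPartition n p r s δ) (hq : IsPartition m q s t δ) :
    IsPartition (n + m) (joinPartition n p q) r t δ := by
  have hjoin : p n = q 0 := hp.right_eq.trans hq.left_eq.symm
  refine ⟨fun i j hij => ?_, ?_, ?_, fun i hi => ?_⟩
  · unfold joinPartition
    split_ifs with hi hj hj
    · exact hp.monotone hij
    · exact (hp.monotone hi.le).trans (hjoin.le.trans (hq.monotone zero_le))
    · omega
    · exact hq.monotone (by omega)
  · rw [joinPartition_of_le hjoin zero_le, hp.left_eq]
  · rw [joinPartition_add, hq.right_eq]
  · rcases lt_or_ge i n with hin | hin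
    · rw [joinPartition_of_le hjoin hin.le, joinPartition_of_le hjoin hin]
      exact hp.mesh_lt i hin
    · obtain ⟨j, rfl⟩ := Nat.exists_eq_add_of_le hin
      rw [add_assoc, joinPartition_add, joinPartition_add]
      exact hq.mesh_lt j (by omega)

variable {Ω : Type*}

theorem itoSum_joinPartition (H W : ℝ≥0 → Ω → ℝ) {n : ℕ} (m : ℕ) {p q : ℕ → ℝ≥0}
    (h : p n = q 0) (ω : Ω) :
    itoSum H W (n + m) (joinPartition n p q) ω = itoSum H W n p ω + itoSum H W m q ω := by
  rw [itoSum, Finset.sum_range_add]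
  congr 1
  · refine Finset.sum_congr rfl fun i hi => ?_
    have hin := Finset.mem_range.1 hi
    rw [joinPartition_of_le h hin.le, joinPartition_of_le h hin]
  · refine Finset.sum_congr rfl fun j _ => ?_
    rw [add_assoc, joinPartition_add, joinPartition_add]

/-- `δ` is fine enough for the sums of `IsItoIntegral P H W t Z` to be within `ε` of `Z`, with
probability at least `1 - ε`. -/
def IsItoMesh {_ : MeasurableSpace Ω} (P : Measure Ω) (H W : ℝ≥0 → Ω → ℝ) (t : ℝ≥0)
    (Z : Ω → ℝ) (ε δ : ℝ) : Prop :=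
  ∀ n p, IsPartition n p 0 t δ → P {ω | ε ≤ |itoSum H W n p ω - Z ω|} ≤ ENNReal.ofReal ε

variable {mΩ : MeasurableSpace Ω} {P : Measure Ω} {H W : ℝ≥0 → Ω → ℝ}

theorem IsItoIntegral.exists_isItoMesh {t : ℝ≥0} {Z : Ω → ℝ} (h : IsItoIntegral P H W t Z)
    {ε : ℝ} (hε : 0 < ε) : ∃ δ, 0 < δ ∧ IsItoMesh P H W t Z ε δ := by
  obtain ⟨δ, hδ, hmesh⟩ := h ε hε
  exact ⟨δ, hδ, fun n p hp => hmesh n p hp.monotone hp.left_eq hp.right_eq hp.mesh_lt⟩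

/-- Two partitions of `[0, s]` are compared by continuing both along the same partition of
`[s, t]`; one of them is taken so fine that its sum is close to the integral over `[0, s]`. -/
theorem IsItoMesh.of_le {s t : ℝ≥0} {Zs Zt : Ω → ℝ} {ε δ : ℝ} (ht : IsItoMesh P H W t Zt ε δ)
    (hst : s ≤ t) (hs : IsItoIntegral P H W s Zs) (hε : 0 < ε) (hδ : 0 < δ) :
    IsItoMesh P H W s Zs (3 * ε) δ := by
  intro n p hp
  obtain ⟨δ', hδ', hfine⟩ := hs.exists_isItoMesh hε
  obtain ⟨l, p', hp'⟩ := exists_isPartition (zero_le (a := s)) (lt_min hδ hδ')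
  obtain ⟨m, q, hq⟩ := exists_isPartition hst hδ
  have hp'δ := hp'.mono (min_le_left δ δ')
  have hpq := ht _ _ (hp.join hq)
  have hp'q := ht _ _ (hp'δ.join hq)
  have hp's := hfine l p' (hp'.mono (min_le_right δ δ'))
  simp only [itoSum_joinPartition H W m (hp.right_eq.trans hq.left_eq.symm)] at hpq
  simp only [itoSum_joinPartition H W m (hp'.right_eq.trans hq.left_eq.symm)] at hp'q
  calc _ ≤ P ({ω | ε ≤ |itoSum H W n p ω + itoSum H W m q ω - Zt ω|} ∪
        {ω | ε ≤ |itoSum H W l p' ω + itoSum H W m q ω - Zt ω|} ∪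
        {ω | ε ≤ |itoSum H W l p' ω - Zs ω|}) := by
        refine measure_mono fun ω (hω : 3 * ε ≤ |itoSum H W n p ω - Zs ω|) => ?_
        simp only [Set.mem_union, Set.mem_ofPred_eq]
        contrapose! hω
        obtain ⟨⟨h₁, h₂⟩, h₃⟩ := hω
        rw [abs_lt] at h₁ h₂ h₃ ⊢
        constructor <;> linarith
    _ ≤ ENNReal.ofReal ε + ENNReal.ofReal ε + ENNReal.ofReal ε :=
        (measure_union_le _ _).trans <|
          add_le_add ((measure_union_le _ _).trans (add_le_add hpq hp'q)) hp's
    _ = ENNReal.ofReal (3 * ε) := by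
        rw [← ENNReal.ofReal_add hε.le hε.le, ← ENNReal.ofReal_add (by positivity) hε.le]
        ring_nf

end Partition

section RiemannSum

/-- The error of the left-endpoint Riemann sum of `x` over the first `k` intervals of the uniform
partition of `[0, t]` into `n` intervals. -/
noncomputable def riemannError (x : ℝ≥0 → ℝ) (t : ℝ≥0) (n k : ℕ) : ℝ :=
  (∫ s in (0 : ℝ)..gridTime t n k, x s.toNNReal) -
    ∑ i ∈ Finset.range k, x (gridTime t n i) * (t / n)

theorem abs_integral_sub_left_le {f : ℝ → ℝ} (hf : Continuous f) {a b η : ℝ} (hab : a ≤ b)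
    (hη : ∀ s ∈ Set.Ioc a b, |f s - f a| ≤ η) :
    |(∫ s in a..b, f s) - f a * (b - a)| ≤ η * (b - a) := by
  have hconst : f a * (b - a) = ∫ _ in a..b, f a := by
    rw [intervalIntegral.integral_const, smul_eq_mul, mul_comm]
  rw [hconst, ← intervalIntegral.integral_sub (hf.intervalIntegrable _ _)
    (continuous_const.intervalIntegrable _ _), ← abs_of_nonneg (sub_nonneg.2 hab)]
  change ‖∫ s in a..b, (f s - f a)‖ ≤ η * |b - a|
  refine intervalIntegral.norm_integral_le_of_norm_le_const fun s hs => ?_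
  exact hη s (Set.uIoc_of_le hab ▸ hs)

theorem abs_riemannError_le {x : ℝ≥0 → ℝ} (hx : Continuous x) {t : ℝ≥0} {n k : ℕ} {η : ℝ}
    (hη : ∀ i < k, ∀ s : ℝ≥0, gridTime t n i ≤ s → s ≤ gridTime t n (i + 1) →
      |x s - x (gridTime t n i)| ≤ η) :
    |riemannError x t n k| ≤ η * gridTime t n k := by
  have hf : Continuous fun s : ℝ => x s.toNNReal := hx.comp continuous_real_toNNReal
  have hsplit := intervalIntegral.sum_integral_adjacent_intervals
    (a := fun i => (gridTime t n i : ℝ)) (n := k) (μ := volume)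
    fun i _ => hf.intervalIntegrable _ _
  rw [gridTime_zero, NNReal.coe_zero] at hsplit
  rw [riemannError, ← hsplit, ← Finset.sum_sub_distrib]
  calc _ ≤ ∑ i ∈ Finset.range k, η * ((gridTime t n (i + 1) : ℝ) - gridTime t n i) := by
        refine (Finset.abs_sum_le_sum_abs _ _).trans (Finset.sum_le_sum fun i hi => ?_)
        have hle : (gridTime t n i : ℝ) ≤ gridTime t n (i + 1) := monotone_gridTime t n i.le_succ
        have hstep := abs_integral_sub_left_le hf (η := η) hle fun s hs => by
          rw [Real.toNNReal_coe]
          exact hη i (Finset.mem_range.1 hi) s.toNNReal (NNReal.le_toNNReal_of_coe_le hs.1.le)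
            (Real.toNNReal_le_iff_le_coe.2 hs.2)
        simpa only [Real.toNNReal_coe, coe_gridTime_succ_sub, NNReal.coe_div,
          NNReal.coe_natCast] using hstep
    _ = η * gridTime t n k := by
        rw [← Finset.mul_sum, Finset.sum_range_sub fun i => (gridTime t n i : ℝ), gridTime_zero,
          NNReal.coe_zero, sub_zero]

theorem eventually_abs_riemannError_le {x : ℝ≥0 → ℝ} (hx : Continuous x) (t : ℝ≥0) {η : ℝ}
    (hη : 0 < η) : ∀ᶠ n in Filter.atTop, ∀ k ≤ n, |riemannError x t n k| ≤ η := by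
  have hunif := (isCompact_Icc (a := (0 : ℝ≥0)) (b := t)).uniformContinuousOn_of_continuous
    hx.continuousOn
  have ht : (0 : ℝ) < t + 1 := by positivity
  obtain ⟨δ, hδ, hclose⟩ := Metric.uniformContinuousOn_iff.1 hunif (η / (t + 1)) (by positivity)
  filter_upwards [eventually_div_lt t hδ] with n hn k hk
  calc _ ≤ η / (t + 1) * gridTime t n k := abs_riemannError_le hx fun i hi s hs hs' => by
        have hst : s ≤ t := hs'.trans (gridTime_le t (by omega))
        refine (hclose s ⟨zero_le, hst⟩ _ ⟨zero_le, hs.trans hst⟩ ?_).le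
        rw [NNReal.dist_eq, abs_of_nonneg (sub_nonneg.2 (NNReal.coe_le_coe.2 hs))]
        refine lt_of_le_of_lt ?_ hn
        rw [← coe_gridTime_succ_sub t n i]
        exact sub_le_sub_right (NNReal.coe_le_coe.2 hs') _
    _ ≤ η / (t + 1) * (t + 1) := by
        gcongr
        exact (NNReal.coe_le_coe.2 (gridTime_le t hk)).trans (le_add_of_nonneg_right zero_le_one)
    _ = η := div_mul_cancel₀ η ht.ne'

variable {Ω : Type*} {mΩ : MeasurableSpace Ω} {P : Measure Ω} {X : ℝ≥0 → Ω → ℝ}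

theorem exists_continuous_modification (hX : ∀ t, Measurable (X t))
    (hc : ∀ᵐ ω ∂P, Continuous fun t => X t ω) :
    ∃ X' : ℝ≥0 → Ω → ℝ, (∀ t, Measurable (X' t)) ∧ (∀ ω, Continuous fun t => X' t ω) ∧
      ∀ᵐ ω ∂P, ∀ t, X t ω = X' t ω := by
  obtain ⟨G, hG, hGm, hGc⟩ := hc.exists_measurable_mem
  refine ⟨fun t => G.indicator (X t), fun t => (hX t).indicator hGm, fun ω => ?_, ?_⟩
  · by_cases hω : ω ∈ G
    · simpa [hω] using hGc ω hω
    · simpa [hω] using continuous_const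
  · filter_upwards [hG] with ω hω t
    simp [hω]

theorem measurable_riemannError (hX : ∀ t, Measurable (X t))
    (hc : ∀ ω, Continuous fun t => X t ω) (t : ℝ≥0) (n k : ℕ) :
    Measurable fun ω => riemannError (fun s => X s ω) t n k := by
  have hjoint : Measurable (Function.uncurry fun (ω : Ω) (s : ℝ) => X s.toNNReal ω) :=
    (measurable_uncurry_of_continuous_of_measurable hc hX).comp
      ((measurable_real_toNNReal.comp measurable_snd).prodMk measurable_fst)
  refine Measurable.sub ?_ (Finset.measurable_fun_sum _ fun i _ => (hX _).mul_const _)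
  simp_rw [intervalIntegral.integral_of_le (NNReal.coe_nonneg _)]
  exact hjoint.stronglyMeasurable.integral_prod_right'.measurable

theorem eventually_measure_le_riemannError_le [IsFiniteMeasure P] (hX : ∀ t, Measurable (X t))
    (hc : ∀ᵐ ω ∂P, Continuous fun t => X t ω) (t : ℝ≥0) {η ε : ℝ} (hη : 0 < η) (hε : 0 < ε) :
    ∀ᶠ n in Filter.atTop, ∀ k ≤ n,
      P {ω | η ≤ |riemannError (fun s => X s ω) t n k|} ≤ ENNReal.ofReal ε := by
  obtain ⟨X', hX'm, hX'c, hXX'⟩ := exists_continuous_modification hX hc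
  set maxError : ℕ → Ω → ℝ := fun n ω => (Finset.range (n + 1)).sup'
    Finset.nonempty_range_add_one fun k => |riemannError (fun s => X' s ω) t n k|
  have hle (n : ℕ) (ω : Ω) (k : ℕ) (hk : k ≤ n) :
      |riemannError (fun s => X' s ω) t n k| ≤ maxError n ω :=
    Finset.le_sup' (fun k => |riemannError (fun s => X' s ω) t n k|)
      (Finset.mem_range.2 (Nat.lt_succ_of_le hk))
  have hmeas (n : ℕ) : Measurable (maxError n) := Finset.measurable_range_sup'' fun k _ =>
    measurable_norm.comp (measurable_riemannError hX'm hX'c t n k)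
  have hlim : TendstoInMeasure P maxError Filter.atTop 0 := by
    refine tendstoInMeasure_of_tendsto_ae (fun n => (hmeas n).aestronglyMeasurable)
      (ae_of_all _ fun ω => Metric.tendsto_nhds.2 fun ζ hζ => ?_)
    filter_upwards [eventually_abs_riemannError_le (hX'c ω) t (half_pos hζ)] with n hn
    rw [Pi.zero_apply, Real.dist_eq, sub_zero,
      abs_of_nonneg ((abs_nonneg _).trans (hle n ω 0 zero_le))]
    exact (Finset.sup'_le _ _ fun k hk =>
      hn k (Nat.lt_succ_iff.1 (Finset.mem_range.1 hk))).trans_lt (half_lt_self hζ)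
  filter_upwards [(tendstoInMeasure_iff_norm.1 hlim η hη).eventually_le_const
    (ENNReal.ofReal_pos.2 hε)] with n hn k hk
  refine (measure_mono_ae ?_).trans hn
  filter_upwards [hXX'] with ω hω (hωη : η ≤ _)
  simp_rw [hω] at hωη
  change η ≤ ‖maxError n ω - 0‖
  rw [sub_zero]
  exact (hωη.trans (hle n ω k hk)).trans (le_abs_self _)

theorem measurableSet_exists_lt (hX : ∀ t, Measurable (X t))
    (hc : ∀ ω, Continuous fun t => X t ω) (t : ℝ≥0) (a : ℝ) :
    MeasurableSet {ω | ∃ s ≤ t, a < X s ω} := by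
  have hne : Nonempty (Set.Icc (0 : ℝ≥0) t) := ⟨⟨0, by simp⟩⟩
  set d := TopologicalSpace.denseSeq (Set.Icc (0 : ℝ≥0) t)
  have hunion : {ω | ∃ s ≤ t, a < X s ω} = ⋃ m, {ω | a < X (d m) ω} := by
    ext ω
    simp only [Set.mem_ofPred_eq, Set.mem_iUnion]
    refine ⟨fun ⟨s, hst, hs⟩ => ?_, fun ⟨m, hm⟩ => ⟨d m, (d m).2.2, hm⟩⟩
    have hopen : IsOpen {u : Set.Icc (0 : ℝ≥0) t | a < X u ω} :=
      isOpen_lt continuous_const ((hc ω).comp continuous_subtype_val)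
    exact (TopologicalSpace.denseRange_denseSeq _).exists_mem_open hopen
      ⟨⟨s, zero_le, hst⟩, hs⟩
  rw [hunion]
  exact MeasurableSet.iUnion fun m => measurableSet_lt measurable_const (hX _)

theorem exists_forall_measureReal_exists_lt_abs_le [IsFiniteMeasure P]
    (hX : ∀ t, Measurable (X t)) (hc : ∀ᵐ ω ∂P, Continuous fun t => X t ω) (t : ℝ≥0)
    {ε : ℝ} (hε : 0 < ε) :
    ∃ N₀ : ℕ, ∀ N : ℝ, N₀ ≤ N → P.real {ω | ∃ s ≤ t, N < |X s ω|} ≤ ε := by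
  obtain ⟨X', hX'm, hX'c, hXX'⟩ := exists_continuous_modification hX hc
  set R : ℕ → Set Ω := fun N => {ω | ∃ s ≤ t, (N : ℝ) < |X' s ω|}
  have hmeas (N : ℕ) : MeasurableSet (R N) :=
    measurableSet_exists_lt (fun s => measurable_norm.comp (hX'm s)) (fun ω => (hX'c ω).abs) t N
  have hanti : Antitone R := fun i j hij ω ⟨s, hs, hlt⟩ =>
    ⟨s, hs, (Nat.cast_le.2 hij).trans_lt hlt⟩
  have hempty : ⋂ N, R N = ∅ := by
    refine Set.eq_empty_of_forall_notMem fun ω hω => ?_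
    obtain ⟨b, hb⟩ := (isCompact_Icc (a := (0 : ℝ≥0)) (b := t)).exists_bound_of_continuousOn
      (hX'c ω).continuousOn
    obtain ⟨N, hN⟩ := exists_nat_ge b
    obtain ⟨s, hs, hlt⟩ := Set.mem_iInter.1 hω N
    exact hlt.not_ge ((hb s ⟨zero_le, hs⟩).trans hN)
  have hlim := tendsto_measure_iInter_atTop (μ := P) (fun N => (hmeas N).nullMeasurableSet) hanti
    ⟨0, measure_ne_top _ _⟩
  rw [hempty, measure_empty] at hlim
  obtain ⟨N₀, hN₀⟩ := (hlim.eventually_le_const (ENNReal.ofReal_pos.2 hε)).exists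
  refine ⟨N₀, fun N hN => ENNReal.toReal_le_of_le_ofReal hε.le (le_trans (measure_mono_ae ?_) hN₀)⟩
  filter_upwards [hXX'] with ω hω
  rintro ⟨s, hs, hlt⟩
  exact ⟨s, hs, hω s ▸ hN.trans_lt hlt⟩

end RiemannSum

/-- The increment of `W` over the `k`-th interval of the uniform partition of `[0, t]` into `n`
intervals. -/
noncomputable def gridStep {Ω : Type*} (W : ℝ≥0 → Ω → ℝ) (t : ℝ≥0) (n k : ℕ) (ω : Ω) : ℝ :=
  W (gridTime t n (k + 1)) ω - W (gridTime t n k) ω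

/-- The filtration `F` observed along the uniform partition of `[0, t]` into `n` intervals. -/
noncomputable def gridFiltration {Ω : Type*} {mΩ : MeasurableSpace Ω} (F : Filtration ℝ≥0 mΩ)
    (t : ℝ≥0) (n : ℕ) : Filtration ℕ mΩ where
  seq k := F (gridTime t n k)
  mono' _ _ hij := F.mono (monotone_gridTime t n hij)
  le' _ := F.le _

namespace IsBrownianWithFiltration

variable {Ω : Type*} {mΩ : MeasurableSpace Ω} {P : Measure Ω} {F : Filtration ℝ≥0 mΩ}
  {W : ℝ≥0 → Ω → ℝ}

theorem measurable (hW : IsBrownianWithFiltration F W P) (t : ℝ≥0) : Measurable (W t) :=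
  (hW.adapted t).mono (F.le t) le_rfl

theorem measurable_gridStep (hW : IsBrownianWithFiltration F W P) (t : ℝ≥0) (n k : ℕ) :
    Measurable[gridFiltration F t n (k + 1)] (gridStep W t n k) :=
  (hW.adapted _).sub ((hW.adapted _).mono (F.mono (monotone_gridTime t n k.le_succ)) le_rfl)

theorem hasLaw_gridStep (hW : IsBrownianWithFiltration F W P) (t : ℝ≥0) (n k : ℕ) :
    HasLaw (gridStep W t n k) (gaussianReal 0 (t / n)) P := by
  have hlaw := hW.isBrownian.hasLaw_sub (gridTime t n (k + 1)) (gridTime t n k)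
  have hvar : nndist (gridTime t n (k + 1)).1 (gridTime t n k).1 = t / n := by
    ext
    rw [coe_nndist, Real.dist_eq, NNReal.val_eq_coe, NNReal.val_eq_coe, coe_gridTime_succ_sub,
      NNReal.abs_eq]
  rwa [hvar] at hlaw

theorem integral_comp_gridStep (hW : IsBrownianWithFiltration F W P) (t : ℝ≥0) (n k : ℕ)
    {φ : ℝ → ℝ} (hφ : Measurable φ) :
    ∫ ω, φ (gridStep W t n k ω) ∂P = ∫ x, φ x ∂gaussianReal 0 (t / n) :=
  (hW.hasLaw_gridStep t n k).integral_comp hφ.aestronglyMeasurable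

theorem isMartingaleTransform (hW : IsBrownianWithFiltration F W P) {t : ℝ≥0} {n : ℕ}
    {G : ℕ → Ω → ℝ} (hG : ∀ k, Measurable[gridFiltration F t n k] (G k))
    (hG2 : ∀ k, MemLp (G k) 2 P) {φ : ℝ → ℝ} (hφ : Measurable φ)
    (hφ2 : MemLp φ 2 (gaussianReal 0 (t / n))) :
    IsMartingaleTransform P (gridFiltration F t n) G fun k ω => φ (gridStep W t n k ω) where
  measurable_coeff := hG
  memLp_coeff := hG2
  measurable_noise k := hφ.comp (hW.measurable_gridStep t n k)
  memLp_noise k := by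
    have hlaw := hW.hasLaw_gridStep t n k
    rw [← hlaw.map_eq] at hφ2
    exact hφ2.comp_of_map hlaw.aemeasurable
  indep_noise k := by
    refine indep_of_indep_of_le_left (hW.indep_increments _ _
      (monotone_gridTime t n k.le_succ)) ?_
    rw [← Function.comp_def, ← MeasurableSpace.comap_comp]
    exact MeasurableSpace.comap_mono hφ.comap_le

end IsBrownianWithFiltration

section EulerDefect

variable {Ω : Type*} (X W : ℝ≥0 → Ω → ℝ) (μ σ : ℝ) (t : ℝ≥0) (n : ℕ)

/-- The defect of `X` in the Euler scheme of `dX = μ X dt + σ X dW` along the uniform partition of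
`[0, t]` into `n` intervals. -/
noncomputable def eulerDefect (k : ℕ) (ω : Ω) : ℝ :=
  X (gridTime t n k) ω - X 0 ω - ∑ i ∈ Finset.range k,
    X (gridTime t n i) ω * (μ * (t / n : ℝ≥0) + σ * gridStep W t n i ω)

/-- The inverse `exp (-σ W_s - (μ - σ² / 2) s)` of the geometric Brownian motion started at `1`. -/
noncomputable def invGBM (s : ℝ≥0) (ω : Ω) : ℝ := Real.exp (-logReturn μ σ s (W s ω))

theorem eulerDefect_zero (ω : Ω) : eulerDefect X W μ σ t n 0 ω = 0 := by
  simp [eulerDefect, gridTime_zero]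

theorem sub_eulerDefect_succ (k : ℕ) (ω : Ω) :
    X (gridTime t n (k + 1)) ω - eulerDefect X W μ σ t n (k + 1) ω =
      X (gridTime t n k) ω - eulerDefect X W μ σ t n k ω +
        X (gridTime t n k) ω * (μ * (t / n : ℝ≥0) + σ * gridStep W t n k ω) := by
  rw [eulerDefect, eulerDefect, Finset.sum_range_succ]
  ring

theorem invGBM_gridTime_succ (k : ℕ) (ω : Ω) :
    invGBM W μ σ (gridTime t n (k + 1)) ω = invGBM W μ σ (gridTime t n k) ω *
      Real.exp (-logReturn μ σ (t / n : ℝ≥0) (gridStep W t n k ω)) := by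
  rw [invGBM, invGBM, ← Real.exp_add, gridTime_succ, logReturn, logReturn, logReturn, gridStep,
    gridTime_succ, NNReal.coe_add]
  ring_nf

theorem eulerDefect_telescope (ω : Ω) :
    (X (gridTime t n n) ω - eulerDefect X W μ σ t n n ω) * invGBM W μ σ (gridTime t n n) ω =
      X 0 ω * invGBM W μ σ 0 ω +
        ∑ k ∈ Finset.range n, X (gridTime t n k) ω * invGBM W μ σ (gridTime t n k) ω *
          eulerInvStep μ σ (t / n : ℝ≥0) (gridStep W t n k ω) -
        ∑ k ∈ Finset.range n, eulerDefect X W μ σ t n k ω * invGBM W μ σ (gridTime t n k) ω *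
          invStep μ σ (t / n : ℝ≥0) (gridStep W t n k ω) := by
  have htel := Finset.sum_range_sub (fun k => (X (gridTime t n k) ω -
    eulerDefect X W μ σ t n k ω) * invGBM W μ σ (gridTime t n k) ω) n
  rw [eulerDefect_zero, gridTime_zero, sub_zero] at htel
  rw [← sub_add_cancel (_ * _) (X 0 ω * invGBM W μ σ 0 ω), ← htel, add_comm, add_sub_assoc,
    ← Finset.sum_sub_distrib]
  congr 1
  refine Finset.sum_congr rfl fun k _ => ?_
  rw [sub_eulerDefect_succ, invGBM_gridTime_succ, eulerInvStep, invStep]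
  ring

theorem eulerDefect_eq (k : ℕ) {ω : Ω} {I : ℝ}
    (hX : X (gridTime t n k) ω =
      X 0 ω + (∫ s in (0 : ℝ)..gridTime t n k, μ * X s.toNNReal ω) + I) :
    eulerDefect X W μ σ t n k ω = μ * riemannError (fun s => X s ω) t n k -
      (itoSum (fun s ω => σ * X s ω) W k (gridTime t n) ω - I) := by
  have hsum : ∑ i ∈ Finset.range k,
      X (gridTime t n i) ω * (μ * (t / n : ℝ≥0) + σ * gridStep W t n i ω) =
      μ * ∑ i ∈ Finset.range k, X (gridTime t n i) ω * (t / n) +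
        itoSum (fun s ω => σ * X s ω) W k (gridTime t n) ω := by
    rw [itoSum, Finset.mul_sum, ← Finset.sum_add_distrib]
    refine Finset.sum_congr rfl fun i _ => ?_
    rw [gridStep, NNReal.coe_div, NNReal.coe_natCast]
    ring
  rw [eulerDefect, hsum, hX, riemannError, intervalIntegral.integral_const_mul]
  ring

variable {X W μ σ t n}

theorem measurable_eulerDefect {mΩ : MeasurableSpace Ω} {F : Filtration ℝ≥0 mΩ}
    (hX : ∀ t, Measurable[F t] (X t)) (hW : ∀ t, Measurable[F t] (W t)) (k : ℕ) :
    Measurable[gridFiltration F t n k] (eulerDefect X W μ σ t n k) := by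
  have hpast {Z : ℝ≥0 → Ω → ℝ} (hZ : ∀ t, Measurable[F t] (Z t)) (i : ℕ) (hi : i ≤ k) :
      Measurable[gridFiltration F t n k] (Z (gridTime t n i)) :=
    (hZ _).mono (F.mono (monotone_gridTime t n hi)) le_rfl
  have hX0 : Measurable[gridFiltration F t n k] (X 0) := (hX 0).mono (F.mono zero_le) le_rfl
  refine ((hpast hX k le_rfl).sub hX0).sub (Finset.measurable_fun_sum _ fun i hi => ?_)
  have hik := Finset.mem_range.1 hi
  exact (hpast hX i hik.le).mul
    ((((hpast hW _ hik).sub (hpast hW i hik.le)).const_mul σ).const_add _)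

theorem measurable_invGBM {m : MeasurableSpace Ω} {s : ℝ≥0} (hW : Measurable[m] (W s)) :
    Measurable[m] (invGBM W μ σ s) :=
  ((measurable_logReturn μ σ s).neg.exp).comp hW

theorem invGBM_le {s : ℝ≥0} (hst : s ≤ t) {N : ℝ} {ω : Ω} (hN : |W s ω| ≤ N) :
    invGBM W μ σ s ω ≤ Real.exp (|σ| * N + |μ - σ ^ 2 / 2| * t) := by
  refine Real.exp_le_exp.2 ((neg_le_abs _).trans ((abs_add_le _ _).trans ?_))
  rw [abs_mul, abs_mul, NNReal.abs_eq]
  gcongr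

theorem abs_eulerDefect_le {N K : ℝ} {k : ℕ} (hkn : k ≤ n) {ω : Ω}
    (hX : ∀ i ≤ k, |X (gridTime t n i) ω| ≤ N)
    (hsum : |∑ i ∈ Finset.range k, σ * X (gridTime t n i) ω * gridStep W t n i ω| ≤ K) :
    |eulerDefect X W μ σ t n k ω| ≤ 2 * N + |μ| * N * t + K := by
  have hdrift : |∑ i ∈ Finset.range k, X (gridTime t n i) ω * (μ * (t / n : ℝ≥0))| ≤
      |μ| * N * t := by
    have hN : 0 ≤ N := (abs_nonneg _).trans (hX 0 zero_le)
    calc _ ≤ ∑ _i ∈ Finset.range k, N * (|μ| * (t / n : ℝ≥0)) := by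
          refine (Finset.abs_sum_le_sum_abs _ _).trans (Finset.sum_le_sum fun i hi => ?_)
          rw [abs_mul, abs_mul, NNReal.abs_eq]
          gcongr
          exact hX i (Finset.mem_range.1 hi).le
      _ = |μ| * N * gridTime t n k := by
          rw [Finset.sum_const, Finset.card_range, nsmul_eq_mul, gridTime]
          push_cast
          ring
      _ ≤ |μ| * N * t := by
          gcongr
          exact NNReal.coe_le_coe.2 (gridTime_le t hkn)
  have hexpand : eulerDefect X W μ σ t n k ω = X (gridTime t n k) ω - X (gridTime t n 0) ω -
      (∑ i ∈ Finset.range k, X (gridTime t n i) ω * (μ * (t / n : ℝ≥0)) +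
        ∑ i ∈ Finset.range k, σ * X (gridTime t n i) ω * gridStep W t n i ω) := by
    rw [eulerDefect, gridTime_zero, ← Finset.sum_add_distrib]
    congr 1
    exact Finset.sum_congr rfl fun i _ => by ring
  rw [hexpand]
  have hX0 := hX 0 zero_le
  have hXk := hX k le_rfl
  rw [abs_le] at *
  constructor <;> linarith

end EulerDefect

theorem IsGBMSolution.measurable {Ω : Type*} {mΩ : MeasurableSpace Ω} {P : Measure Ω}
    {F : Filtration ℝ≥0 mΩ} {W X : ℝ≥0 → Ω → ℝ} {μ σ S : ℝ} (h : IsGBMSolution P F W μ σ S X)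
    (t : ℝ≥0) : Measurable (X t) :=
  (h.adapted t).mono (F.le t) le_rfl

theorem IsGBMSolution.eventually_measure_le_eulerDefect_le {Ω : Type*} {mΩ : MeasurableSpace Ω}
    {P : Measure Ω} [IsFiniteMeasure P] {F : Filtration ℝ≥0 mΩ} {W X : ℝ≥0 → Ω → ℝ} {μ σ S : ℝ}
    (h : IsGBMSolution P F W μ σ S X) (t : ℝ≥0) {ε : ℝ} (hε : 0 < ε) :
    ∀ᶠ n in Filter.atTop, ∀ k ≤ n,
      P.real {ω | ε ≤ |eulerDefect X W μ σ t n k ω|} ≤ ε := by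
  obtain ⟨I, hI, hsde⟩ := h.sde
  obtain ⟨δ, hδ, hmesh⟩ := (hI t).exists_isItoMesh (ε := ε / 6) (by positivity)
  have hμ : 0 < 2 * (|μ| + 1) := by positivity
  filter_upwards [eventually_div_lt t hδ, eventually_measure_le_riemannError_le h.measurable h.cont
    t (div_pos hε hμ) (half_pos hε)] with n hn hriemann k hk
  set s := gridTime t n k
  have hito := hmesh.of_le (gridTime_le t hk) (hI s) (by positivity) hδ k _
    (isPartition_gridTime hn k)
  refine ENNReal.toReal_le_of_le_ofReal hε.le ?_
  calc _ ≤ P ({ω | 3 * (ε / 6) ≤ |itoSum (fun s ω => σ * X s ω) W k (gridTime t n) ω - I s ω|} ∪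
        {ω | ε / (2 * (|μ| + 1)) ≤ |riemannError (fun s => X s ω) t n k|}) := by
        refine measure_mono_ae ?_
        filter_upwards [hsde s] with ω hω (hdefect : ε ≤ |eulerDefect X W μ σ t n k ω|)
        change _ ∨ _
        contrapose! hdefect
        obtain ⟨hito, hriemann⟩ := hdefect
        simp only [Set.mem_ofPred_eq, not_le] at hito hriemann
        have hdrift : |μ * riemannError (fun s => X s ω) t n k| ≤ ε / 2 := by
          rw [abs_mul]
          rw [lt_div_iff₀ hμ] at hriemann
          nlinarith [abs_nonneg μ, abs_nonneg (riemannError (fun s => X s ω) t n k)]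
        rw [eulerDefect_eq X W μ σ t n k hω]
        refine (abs_sub _ _).trans_lt ?_
        linarith
    _ ≤ ENNReal.ofReal (3 * (ε / 6)) + ENNReal.ofReal (ε / 2) :=
        (measure_union_le _ _).trans (add_le_add hito (hriemann k hk))
    _ = ENNReal.ofReal ε := by
        rw [← ENNReal.ofReal_add (by positivity) (by positivity)]
        ring_nf

theorem ae_eq_zero_of_forall_measureReal_le {Ω : Type*} {mΩ : MeasurableSpace Ω} {P : Measure Ω}
    [IsFiniteMeasure P] {f : Ω → ℝ}
    (h : ∀ η > 0, ∀ ε > 0, P.real {ω | η ≤ |f ω|} ≤ ε) : ∀ᵐ ω ∂P, f ω = 0 := by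
  have hsmall (m : ℕ) : ∀ᵐ ω ∂P, |f ω| < 1 / ((m : ℝ) + 1) := by
    rw [ae_iff]
    simp only [not_lt]
    refine (measureReal_eq_zero_iff).1 (le_antisymm ?_ measureReal_nonneg)
    exact le_of_forall_pos_le_add fun ε hε => (h _ (by positivity) ε hε).trans (zero_add ε).ge
  filter_upwards [ae_all_iff.2 hsmall] with ω hω
  exact abs_nonpos_iff.1 (ge_of_tendsto' tendsto_one_div_add_atTop_nhds_zero_nat
    fun m => (hω m).le)

section Localization

variable {Ω : Type*} (X W : ℝ≥0 → Ω → ℝ) (μ σ : ℝ) (t : ℝ≥0) (n : ℕ) (N K : ℝ)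

/-- The event that along the first `k` grid points the processes `X` and `W` have stayed below `N`
and the Euler defect below `K` in absolute value. -/
def moderateEvent (k : ℕ) : Set Ω :=
  {ω | ∀ i ≤ k, |X (gridTime t n i) ω| ≤ N ∧ |W (gridTime t n i) ω| ≤ N ∧
    |eulerDefect X W μ σ t n i ω| ≤ K}

/-- The coefficient `Z_k / exp (σ W_s + (μ - σ² / 2) s)`, with `s` the `k`-th grid point, cut off
outside the moderate event. -/
noncomputable def localizedCoeff (Z : ℕ → Ω → ℝ) (k : ℕ) : Ω → ℝ :=
  (moderateEvent X W μ σ t n N K k).indicator fun ω => Z k ω * invGBM W μ σ (gridTime t n k) ω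

variable {X W μ σ t n N K}

theorem moderateEvent_anti {j k : ℕ} (hjk : j ≤ k) :
    moderateEvent X W μ σ t n N K k ⊆ moderateEvent X W μ σ t n N K j :=
  fun _ hω i hi => hω i (hi.trans hjk)

theorem invGBM_le_of_mem_moderateEvent {s : ℝ≥0} {k : ℕ} (hs : gridTime t n k ≤ s) {ω : Ω}
    (hω : ω ∈ moderateEvent X W μ σ t n N K k) :
    invGBM W μ σ (gridTime t n k) ω ≤ Real.exp (|σ| * N + |μ - σ ^ 2 / 2| * s) :=
  invGBM_le hs (hω k le_rfl).2.1

theorem localizedCoeff_sq_le {s : ℝ≥0} {k : ℕ} (hs : gridTime t n k ≤ s) (Z : ℕ → Ω → ℝ) (ω : Ω) :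
    localizedCoeff X W μ σ t n N K Z k ω ^ 2 ≤
      Real.exp (|σ| * N + |μ - σ ^ 2 / 2| * s) ^ 2 *
        (moderateEvent X W μ σ t n N K k).indicator (fun ω => Z k ω ^ 2) ω := by
  by_cases hω : ω ∈ moderateEvent X W μ σ t n N K k
  · rw [localizedCoeff, Set.indicator_of_mem hω, Set.indicator_of_mem hω, mul_pow, mul_comm]
    exact mul_le_mul_of_nonneg_right (pow_le_pow_left₀ (Real.exp_nonneg _)
      (invGBM_le_of_mem_moderateEvent hs hω) 2) (sq_nonneg _)
  · simp [localizedCoeff, hω]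

theorem measurableSet_moderateEvent {mΩ : MeasurableSpace Ω} {F : Filtration ℝ≥0 mΩ}
    (hX : ∀ t, Measurable[F t] (X t)) (hW : ∀ t, Measurable[F t] (W t)) (k : ℕ) :
    MeasurableSet[gridFiltration F t n k] (moderateEvent X W μ σ t n N K k) := by
  have habs {f : Ω → ℝ} {i : ℕ} (hf : Measurable[gridFiltration F t n i] f) (hi : i ≤ k) (a : ℝ) :
      MeasurableSet[gridFiltration F t n k] {ω | |f ω| ≤ a} :=
    (gridFiltration F t n).mono hi _ ((measurable_norm.comp hf) measurableSet_Iic)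
  simp only [moderateEvent, Set.ofPred_forall]
  exact MeasurableSet.iInter fun i => MeasurableSet.iInter fun hi =>
    (habs (hX _) hi N).inter ((habs (hW _) hi N).inter (habs (measurable_eulerDefect hX hW i) hi K))

end Localization

namespace IsGBMSolution

variable {Ω : Type*} {mΩ : MeasurableSpace Ω} {P : Measure Ω} [IsProbabilityMeasure P]
  {F : Filtration ℝ≥0 mΩ} {W X : ℝ≥0 → Ω → ℝ} {μ σ S : ℝ}

section SecondMoment

variable {t : ℝ≥0} {n : ℕ} {N K C : ℝ} {Z : ℕ → Ω → ℝ} {φ : ℝ → ℝ}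

theorem isMartingaleTransform_localizedCoeff (h : IsGBMSolution P F W μ σ S X)
    (hZ : ∀ k, Measurable[gridFiltration F t n k] (Z k))
    (hC : ∀ k, ∀ ω ∈ moderateEvent X W μ σ t n N K k, |Z k ω| ≤ C)
    (hφ : Measurable φ) (hφ2 : MemLp φ 2 (gaussianReal 0 (t / n))) :
    IsMartingaleTransform P (gridFiltration F t n) (localizedCoeff X W μ σ t n N K Z)
      fun k ω => φ (gridStep W t n k ω) := by
  have hmeas (k : ℕ) :
      Measurable[gridFiltration F t n k] (localizedCoeff X W μ σ t n N K Z k) :=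
    ((hZ k).mul (measurable_invGBM (h.brownian.adapted _))).indicator
      (measurableSet_moderateEvent h.adapted h.brownian.adapted k)
  refine h.brownian.isMartingaleTransform hmeas (fun k => ?_) hφ hφ2
  refine MemLp.of_bound ((hmeas k).mono ((gridFiltration F t n).le k) le_rfl).aestronglyMeasurable
    (|C| * Real.exp (|σ| * N + |μ - σ ^ 2 / 2| * gridTime t n k)) (ae_of_all _ fun ω => ?_)
  by_cases hω : ω ∈ moderateEvent X W μ σ t n N K k
  · rw [localizedCoeff, Set.indicator_of_mem hω, Real.norm_eq_abs, abs_mul,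
      abs_of_pos (a := invGBM W μ σ _ ω) (Real.exp_pos _)]
    exact mul_le_mul ((hC k ω hω).trans (le_abs_self C)) (invGBM_le_of_mem_moderateEvent le_rfl hω)
      (Real.exp_nonneg _) (abs_nonneg C)
  · rw [localizedCoeff, Set.indicator_of_notMem hω, norm_zero]
    positivity

theorem integral_localizedCoeff_sq_le (h : IsGBMSolution P F W μ σ S X)
    (hZ : ∀ k, Measurable[gridFiltration F t n k] (Z k))
    (hC : ∀ k, ∀ ω ∈ moderateEvent X W μ σ t n N K k, |Z k ω| ≤ C) {k : ℕ} (hk : k ≤ n) :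
    ∫ ω, localizedCoeff X W μ σ t n N K Z k ω ^ 2 ∂P ≤
      Real.exp (|σ| * N + |μ - σ ^ 2 / 2| * t) ^ 2 *
        ∫ ω, (moderateEvent X W μ σ t n N K k).indicator (fun ω => Z k ω ^ 2) ω ∂P := by
  have hmeas : Measurable[gridFiltration F t n k]
      ((moderateEvent X W μ σ t n N K k).indicator fun ω => Z k ω ^ 2) :=
    ((hZ k).pow_const 2).indicator
      (measurableSet_moderateEvent h.adapted h.brownian.adapted k)
  have hinteg : Integrable ((moderateEvent X W μ σ t n N K k).indicator fun ω => Z k ω ^ 2) P := by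
    refine Integrable.of_bound
      (hmeas.mono ((gridFiltration F t n).le k) le_rfl).aestronglyMeasurable (C ^ 2)
      (ae_of_all _ fun ω => ?_)
    by_cases hω : ω ∈ moderateEvent X W μ σ t n N K k
    · rw [Set.indicator_of_mem hω, norm_pow]
      exact pow_le_pow_left₀ (norm_nonneg _) (hC k ω hω) 2
    · rw [Set.indicator_of_notMem hω, norm_zero]
      exact sq_nonneg C
  rw [← integral_const_mul]
  exact integral_mono_of_nonneg (ae_of_all _ fun ω => sq_nonneg _) (hinteg.const_mul _)
    (ae_of_all _ (localizedCoeff_sq_le (gridTime_le t hk) Z))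

theorem measureReal_le_abs_localizedSum_le (h : IsGBMSolution P F W μ σ S X)
    (hZ : ∀ k, Measurable[gridFiltration F t n k] (Z k))
    (hC : ∀ k, ∀ ω ∈ moderateEvent X W μ σ t n N K k, |Z k ω| ≤ C) {γ : ℝ}
    (hγ : ∀ k < n, ∫ ω, (moderateEvent X W μ σ t n N K k).indicator (fun ω => Z k ω ^ 2) ω ∂P ≤ γ)
    (hφ : Measurable φ) {b : ℝ} (hb : HasMomentsLE (gaussianReal 0 (t / n)) φ b)
    {η : ℝ} (hη : 0 < η) :
    P.real {ω | η ≤ |∑ k ∈ Finset.range n,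
        localizedCoeff X W μ σ t n N K Z k ω * φ (gridStep W t n k ω)|} ≤
      2 * (Real.exp (|σ| * N + |μ - σ ^ 2 / 2| * t) ^ 2 * γ) * (n * b + (n * b) ^ 2) /
        η ^ 2 := by
  have htransform := h.isMartingaleTransform_localizedCoeff hZ hC hφ hb.memLp
  refine (measureReal_le_abs_le (htransform.memLp_sum n) hη).trans
    (div_le_div_of_nonneg_right ?_ (sq_nonneg η))
  rw [mul_pow]
  refine htransform.integral_sum_sq_le (fun k hk => ?_) (fun k _ => ?_) fun k _ => ?_
  · exact (h.integral_localizedCoeff_sq_le hZ hC hk.le).trans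
      (mul_le_mul_of_nonneg_left (hγ k hk) (sq_nonneg _))
  · rw [h.brownian.integral_comp_gridStep t n k hφ]
    exact hb.abs_integral_le
  · rw [h.brownian.integral_comp_gridStep t n k (hφ.pow_const 2)]
    exact hb.integral_sq_le

end SecondMoment

variable (t : ℝ≥0) (N K : ℝ)

theorem eventually_measureReal_le_abs_solutionSum_le (h : IsGBMSolution P F W μ σ S X) {η ε : ℝ}
    (hη : 0 < η) (hε : 0 < ε) :
    ∀ᶠ n in Filter.atTop, P.real {ω | η ≤ |∑ k ∈ Finset.range n,
      localizedCoeff X W μ σ t n N K (fun k => X (gridTime t n k)) k ω *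
        eulerInvStep μ σ (t / n : ℝ≥0) (gridStep W t n k ω)|} ≤ ε := by
  obtain ⟨c, -, hc⟩ := exists_eulerInvStep_hasMomentsLE μ σ
  have hlim : Filter.Tendsto (fun n : ℕ => 2 * (Real.exp (|σ| * N + |μ - σ ^ 2 / 2| * t) ^ 2 *
      N ^ 2) * (c * t ^ 2 / n + (c * t ^ 2 / n) ^ 2) / η ^ 2)
      Filter.atTop (nhds 0) := by
    have hdiv := tendsto_const_div_atTop_nhds_zero_nat (c * (t : ℝ) ^ 2)
    simpa using ((hdiv.add (hdiv.pow 2)).const_mul _).div_const (η ^ 2)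
  filter_upwards [hlim.eventually_le_const hε, eventually_div_lt t one_pos,
    Filter.eventually_ne_atTop 0] with n hn hn1 hn0
  refine le_trans ?_ hn
  have hnb : c * (t : ℝ) ^ 2 / n = n * (c * ((t / n : ℝ≥0) : ℝ) ^ 2) := by
    push_cast
    field_simp
  rw [hnb]
  refine h.measureReal_le_abs_localizedSum_le (fun k => h.adapted _) (fun k ω hω => (hω k le_rfl).1)
    (fun k _ => ?_) (measurable_eulerInvStep μ σ _) (hc _ hn1.le) hη
  refine (integral_mono_of_nonneg (ae_of_all _ fun ω => Set.indicator_nonneg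
    (fun _ _ => sq_nonneg _) ω) (integrable_const (N ^ 2)) (ae_of_all _ fun ω =>
      Set.indicator_le' (fun ω hω => ?_) (fun _ _ => sq_nonneg N) ω)).trans (by simp)
  exact sq_le_sq' (abs_le.1 (hω k le_rfl).1).1 (abs_le.1 (hω k le_rfl).1).2

theorem integral_indicator_eulerDefect_sq_le (h : IsGBMSolution P F W μ σ S X) {n k : ℕ} {e : ℝ}
    (hsmall : P.real {ω | e ≤ |eulerDefect X W μ σ t n k ω|} ≤ e) :
    ∫ ω, (moderateEvent X W μ σ t n N K k).indicator
      (fun ω => eulerDefect X W μ σ t n k ω ^ 2) ω ∂P ≤ e ^ 2 + K ^ 2 * e := by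
  have hmeas : MeasurableSet {ω | e ≤ |eulerDefect X W μ σ t n k ω|} :=
    (gridFiltration F t n).le k _ ((measurable_norm.comp
      (measurable_eulerDefect h.adapted h.brownian.adapted k)) measurableSet_Ici)
  have hlarge := (integrable_const (μ := P) (K ^ 2)).indicator hmeas
  calc _ ≤ ∫ ω, (e ^ 2 + {ω | e ≤ |eulerDefect X W μ σ t n k ω|}.indicator
        (fun _ => K ^ 2) ω) ∂P := by
        refine integral_mono_of_nonneg (ae_of_all _ fun ω => Set.indicator_nonneg
          (fun _ _ => sq_nonneg _) ω) ((integrable_const _).add hlarge) (ae_of_all _ fun ω => ?_)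
        refine Set.indicator_le' (fun ω hω => ?_) (fun ω _ => add_nonneg (sq_nonneg e)
          (Set.indicator_nonneg (fun _ _ => sq_nonneg K) ω)) ω
        rcases le_or_gt e |eulerDefect X W μ σ t n k ω| with hle | hlt
        · rw [Set.indicator_of_mem (by exact hle)]
          have := sq_le_sq' (abs_le.1 (hω k le_rfl).2.2).1 (abs_le.1 (hω k le_rfl).2.2).2
          linarith [sq_nonneg e]
        · rw [Set.indicator_of_notMem (by exact hlt.not_ge), add_zero]
          exact sq_le_sq' (abs_lt.1 hlt).1.le (abs_lt.1 hlt).2.le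
    _ = e ^ 2 + K ^ 2 * P.real {ω | e ≤ |eulerDefect X W μ σ t n k ω|} := by
        rw [integral_add (integrable_const _) hlarge, integral_indicator_const _ hmeas,
          integral_const, probReal_univ, one_smul, smul_eq_mul, mul_comm]
    _ ≤ _ := by gcongr

theorem eventually_measureReal_le_abs_defectSum_le (h : IsGBMSolution P F W μ σ S X) {η ε : ℝ}
    (hη : 0 < η) (hε : 0 < ε) :
    ∀ᶠ n in Filter.atTop, P.real {ω | η ≤ |∑ k ∈ Finset.range n,
      localizedCoeff X W μ σ t n N K (eulerDefect X W μ σ t n) k ω *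
        invStep μ σ (t / n : ℝ≥0) (gridStep W t n k ω)|} ≤ ε := by
  obtain ⟨c, -, hc⟩ := exists_invStep_hasMomentsLE μ σ
  have hlim : Filter.Tendsto (fun e : ℝ => 2 * (Real.exp (|σ| * N + |μ - σ ^ 2 / 2| * t) ^ 2 *
      (e ^ 2 + K ^ 2 * e)) * (c * t + (c * t) ^ 2) / η ^ 2)
      (nhdsWithin 0 (Set.Ioi 0)) (nhds 0) := by
    have hcont : Continuous fun e : ℝ => 2 * (Real.exp (|σ| * N + |μ - σ ^ 2 / 2| * t) ^ 2 *
      (e ^ 2 + K ^ 2 * e)) * (c * t + (c * t) ^ 2) / η ^ 2 := by fun_prop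
    simpa using (hcont.tendsto 0).mono_left nhdsWithin_le_nhds
  obtain ⟨e, hle, he : 0 < e⟩ :=
    ((hlim.eventually_le_const hε).and self_mem_nhdsWithin).exists
  filter_upwards [h.eventually_measure_le_eulerDefect_le t he, eventually_div_lt t one_pos,
    Filter.eventually_ne_atTop 0] with n hsmall hn1 hn0
  refine le_trans ?_ hle
  have hnb : c * (t : ℝ) = n * (c * ((t / n : ℝ≥0) : ℝ)) := by
    push_cast
    field_simp
  rw [hnb]
  exact h.measureReal_le_abs_localizedSum_le (measurable_eulerDefect h.adapted h.brownian.adapted)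
    (fun k ω hω => (hω k le_rfl).2.2)
    (fun k hk => h.integral_indicator_eulerDefect_sq_le t N K (hsmall k hk.le))
    (measurable_invStep μ σ _) (hc _ hn1.le) hη

variable {t}

/-- Kolmogorov's inequality needs square integrable coefficients, so the stochastic part of the
Euler scheme is first cut off where `X` exceeds `N`. -/
theorem measureReal_exists_lt_abs_cutoffSum_le (h : IsGBMSolution P F W μ σ S X) {K : ℝ}
    (hK : 0 < K) (n : ℕ) :
    P.real {ω | ∃ i ≤ n, K < |∑ j ∈ Finset.range i,
      {ω | |X (gridTime t n j) ω| ≤ N}.indicator (fun ω => σ * X (gridTime t n j) ω) ω *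
        gridStep W t n j ω|} ≤ (σ * N) ^ 2 * t / K ^ 2 := by
  have hbound (j : ℕ) (ω : Ω) : |{ω | |X (gridTime t n j) ω| ≤ N}.indicator
      (fun ω => σ * X (gridTime t n j) ω) ω| ≤ |σ * N| := by
    by_cases hω : |X (gridTime t n j) ω| ≤ N
    · rw [Set.indicator_of_mem (by exact hω), abs_mul, abs_mul]
      exact mul_le_mul_of_nonneg_left (hω.trans (le_abs_self N)) (abs_nonneg σ)
    · rw [Set.indicator_of_notMem (by exact hω), abs_zero]
      positivity
  have hmeas (j : ℕ) : Measurable[gridFiltration F t n j]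
      ({ω | |X (gridTime t n j) ω| ≤ N}.indicator fun ω => σ * X (gridTime t n j) ω) :=
    ((h.adapted _).const_mul σ).indicator ((measurable_norm.comp (h.adapted _)) measurableSet_Iic)
  have htransform := h.brownian.isMartingaleTransform hmeas (fun j => MemLp.of_bound
    ((hmeas j).mono ((gridFiltration F t n).le j) le_rfl).aestronglyMeasurable |σ * N|
    (ae_of_all _ (hbound j))) measurable_id (memLp_id_gaussianReal 2)
  have hmean (j : ℕ) : ∫ ω, id (gridStep W t n j ω) ∂P = 0 := by
    rw [h.brownian.integral_comp_gridStep t n j measurable_id]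
    exact integral_id_gaussianReal
  have hvar (j : ℕ) : ∫ ω, id (gridStep W t n j ω) ^ 2 ∂P = (t / n : ℝ≥0) := by
    rw [h.brownian.integral_comp_gridStep t n j (φ := fun x => id x ^ 2) (by fun_prop)]
    have hgauss := variance_id_gaussianReal (μ := 0) (v := t / n)
    rwa [variance_of_integral_eq_zero (by fun_prop) (by exact integral_id_gaussianReal)] at hgauss
  refine (htransform.measureReal_exists_lt_abs_sum_le hmean hK n).trans ?_
  gcongr
  calc _ ≤ ∑ _j ∈ Finset.range n, (σ * N) ^ 2 * ((t / n : ℝ≥0) : ℝ) := by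
        refine Finset.sum_le_sum fun j _ => ?_
        rw [hvar]
        refine mul_le_mul_of_nonneg_right ?_ NNReal.zero_le_coe
        refine (integral_mono (htransform.memLp_coeff j).integrable_sq
          (integrable_const ((σ * N) ^ 2)) fun ω => sq_le_sq.2 (hbound j ω)).trans (by simp)
    _ = (σ * N) ^ 2 * gridTime t n n := by
        rw [Finset.sum_const, Finset.card_range, nsmul_eq_mul, gridTime]
        push_cast
        ring
    _ ≤ _ := by
        gcongr
        exact gridTime_le t le_rfl

variable (t)

theorem exists_forall_measureReal_compl_moderateEvent_le (h : IsGBMSolution P F W μ σ S X) {ε : ℝ}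
    (hε : 0 < ε) :
    ∃ N K : ℝ, ∀ n, P.real (moderateEvent X W μ σ t n N K n)ᶜ ≤ 3 * ε := by
  obtain ⟨N₁, hN₁⟩ := exists_forall_measureReal_exists_lt_abs_le h.measurable h.cont t hε
  obtain ⟨N₂, hN₂⟩ := exists_forall_measureReal_exists_lt_abs_le h.brownian.measurable
    h.brownian.isBrownian.cont t hε
  set N : ℝ := max N₁ N₂
  obtain ⟨K, hK, hKε⟩ : ∃ K : ℝ, 0 < K ∧ (σ * N) ^ 2 * t / K ^ 2 ≤ ε := by
    have hlim : Filter.Tendsto (fun K : ℝ => (σ * N) ^ 2 * t / K ^ 2) Filter.atTop (nhds 0) :=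
      tendsto_const_nhds.div_atTop (Filter.tendsto_pow_atTop two_ne_zero)
    exact ((Filter.eventually_gt_atTop 0).and (hlim.eventually_le_const hε)).exists
  refine ⟨N, 2 * N + |μ| * N * t + K, fun n => ?_⟩
  calc _ ≤ P.real ({ω | ∃ s ≤ t, N < |X s ω|} ∪ {ω | ∃ s ≤ t, N < |W s ω|} ∪
        {ω | ∃ i ≤ n, K < |∑ j ∈ Finset.range i,
          {ω | |X (gridTime t n j) ω| ≤ N}.indicator (fun ω => σ * X (gridTime t n j) ω) ω *
            gridStep W t n j ω|}) := by
        refine measureReal_mono (Set.compl_subset_comm.1 fun ω hω => ?_)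
        simp only [Set.mem_compl_iff, Set.mem_union, Set.mem_ofPred_eq, not_or, not_exists,
          not_and, not_lt] at hω
        obtain ⟨⟨hX, hW⟩, hsum⟩ := hω
        have hXgrid (i : ℕ) (hi : i ≤ n) := hX _ (gridTime_le t hi)
        refine fun i hi => ⟨hXgrid i hi, hW _ (gridTime_le t hi),
          abs_eulerDefect_le hi (fun j hj => hXgrid j (hj.trans hi)) ?_⟩
        refine le_of_eq_of_le (congrArg _ (Finset.sum_congr rfl fun j hj => ?_)) (hsum i hi)
        rw [Set.indicator_of_mem
          (by exact hXgrid j ((Finset.mem_range.1 hj).le.trans hi))]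
    _ ≤ ε + ε + ε := (measureReal_union_le _ _).trans <| add_le_add
        ((measureReal_union_le _ _).trans
          (add_le_add (hN₁ N (le_max_left _ _)) (hN₂ N (le_max_right _ _))))
        ((h.measureReal_exists_lt_abs_cutoffSum_le N hK n).trans hKε)
    _ = _ := by ring

variable {t N K}

theorem abs_mul_invGBM_sub_le {n : ℕ} (hn : n ≠ 0) {ω : Ω} (hX0 : X 0 ω = S) (hW0 : W 0 ω = 0)
    (hω : ω ∈ moderateEvent X W μ σ t n N K n) :
    |X t ω * invGBM W μ σ t ω - S| ≤
      Real.exp (|σ| * N + |μ - σ ^ 2 / 2| * t) * |eulerDefect X W μ σ t n n ω| +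
      |∑ k ∈ Finset.range n, localizedCoeff X W μ σ t n N K (fun k => X (gridTime t n k)) k ω *
        eulerInvStep μ σ (t / n : ℝ≥0) (gridStep W t n k ω)| +
      |∑ k ∈ Finset.range n, localizedCoeff X W μ σ t n N K (eulerDefect X W μ σ t n) k ω *
        invStep μ σ (t / n : ℝ≥0) (gridStep W t n k ω)| := by
  have hsum (Z : ℕ → Ω → ℝ) (φ : ℝ → ℝ) :
      ∑ k ∈ Finset.range n, localizedCoeff X W μ σ t n N K Z k ω * φ (gridStep W t n k ω) =
      ∑ k ∈ Finset.range n, Z k ω * invGBM W μ σ (gridTime t n k) ω * φ (gridStep W t n k ω) :=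
    Finset.sum_congr rfl fun k hk => by
      rw [localizedCoeff, Set.indicator_of_mem (moderateEvent_anti (Finset.mem_range.1 hk).le hω)]
  have htel := eulerDefect_telescope X W μ σ t n ω
  rw [gridTime_self t hn, ← hsum (fun k => X (gridTime t n k)), ← hsum, hX0,
    show invGBM W μ σ 0 ω = 1 by simp [invGBM, logReturn, hW0], mul_one] at htel
  have hinv := invGBM_le_of_mem_moderateEvent (gridTime_le t le_rfl) hω
  rw [gridTime_self t hn] at hinv
  have hdefect : |eulerDefect X W μ σ t n n ω * invGBM W μ σ t ω| ≤
      Real.exp (|σ| * N + |μ - σ ^ 2 / 2| * t) * |eulerDefect X W μ σ t n n ω| := by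
    rw [abs_mul, abs_of_pos (a := invGBM W μ σ t ω) (Real.exp_pos _), mul_comm]
    gcongr
  refine le_trans ?_ (add_le_add_left (add_le_add_left hdefect _) _)
  refine le_of_eq_of_le (congrArg abs ?_) ((abs_sub _ _).trans
    (add_le_add_left (abs_add_le _ _) _))
  linear_combination htel

theorem measureReal_le_abs_mul_invGBM_sub_le (h : IsGBMSolution P F W μ σ S X) (t : ℝ≥0) {η ε : ℝ}
    (hη : 0 < η) (hε : 0 < ε) :
    P.real {ω | η ≤ |X t ω * invGBM W μ σ t ω - S|} ≤ 6 * ε := by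
  obtain ⟨N, K, hmod⟩ := h.exists_forall_measureReal_compl_moderateEvent_le t hε
  set M := Real.exp (|σ| * N + |μ - σ ^ 2 / 2| * t)
  have hM : 0 < M := Real.exp_pos _
  have hη3 : 0 < η / 3 := by positivity
  have he : 0 < min ε (η / 3 / M) := lt_min hε (by positivity)
  obtain ⟨n, ⟨⟨hdefect, hsum₁⟩, hsum₂⟩, hn⟩ := (((h.eventually_measure_le_eulerDefect_le t he).and
    (h.eventually_measureReal_le_abs_solutionSum_le t N K hη3 hε)).and
      (h.eventually_measureReal_le_abs_defectSum_le t N K hη3 hε)).and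
        (Filter.eventually_ne_atTop 0) |>.exists
  set A₁ : Ω → ℝ := fun ω => ∑ k ∈ Finset.range n,
    localizedCoeff X W μ σ t n N K (fun k => X (gridTime t n k)) k ω *
      eulerInvStep μ σ (t / n : ℝ≥0) (gridStep W t n k ω)
  set A₂ : Ω → ℝ := fun ω => ∑ k ∈ Finset.range n,
    localizedCoeff X W μ σ t n N K (eulerDefect X W μ σ t n) k ω *
      invStep μ σ (t / n : ℝ≥0) (gridStep W t n k ω)
  calc _ ≤ P.real ((moderateEvent X W μ σ t n N K n)ᶜ ∪
        {ω | min ε (η / 3 / M) ≤ |eulerDefect X W μ σ t n n ω|} ∪ {ω | η / 3 ≤ |A₁ ω|} ∪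
        {ω | η / 3 ≤ |A₂ ω|}) := by
        refine ENNReal.toReal_mono (measure_ne_top _ _) (measure_mono_ae ?_)
        filter_upwards [IsGBMSolution.init h, h.brownian.isBrownian.eval_zero_ae_eq_zero]
          with ω hX0 hW0 (hω : η ≤ _)
        change ω ∈ (_ ∪ _ : Set Ω)
        by_contra hnot
        simp only [Set.mem_union, Set.mem_compl_iff, Set.mem_ofPred_eq, not_or, not_not, not_le]
          at hnot
        obtain ⟨⟨⟨hmod, hdefect⟩, hA₁⟩, hA₂⟩ := hnot
        have hbound := abs_mul_invGBM_sub_le hn hX0 hW0 hmod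
        have hM' := (lt_div_iff₀' hM).1 (hdefect.trans_le (min_le_right _ _))
        linarith
    _ ≤ 3 * ε + ε + ε + ε := by
        refine (measureReal_union_le _ _).trans (add_le_add ?_ hsum₂)
        refine (measureReal_union_le _ _).trans (add_le_add ?_ hsum₁)
        exact (measureReal_union_le _ _).trans
          (add_le_add (hmod n) ((hdefect n le_rfl).trans (min_le_left _ _)))
    _ = _ := by ring

/-- `X_t / exp (σ W_t + (μ - σ² / 2) t)` does not move, because the Euler scheme for `X` telescopes
against the exponential. -/
theorem ae_eq_exp (h : IsGBMSolution P F W μ σ S X) (t : ℝ≥0) :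
    ∀ᵐ ω ∂P, X t ω = S * Real.exp (σ * W t ω + (μ - σ ^ 2 / 2) * t) := by
  have hzero := ae_eq_zero_of_forall_measureReal_le fun η hη ε hε =>
    (h.measureReal_le_abs_mul_invGBM_sub_le t hη (ε := ε / 6) (by positivity)).trans
      (by linarith)
  filter_upwards [hzero] with ω hω
  rw [← sub_eq_zero.1 hω, mul_assoc, invGBM, ← Real.exp_add, logReturn, neg_add_cancel,
    Real.exp_zero, mul_one]

theorem ae_forall_eq_exp (h : IsGBMSolution P F W μ σ S X) :
    ∀ᵐ ω ∂P, ∀ t, X t ω = S * Real.exp (σ * W t ω + (μ - σ ^ 2 / 2) * t) := by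
  filter_upwards [ae_all_iff.2 fun m => h.ae_eq_exp (TopologicalSpace.denseSeq ℝ≥0 m), h.cont,
    h.brownian.isBrownian.cont] with ω hdense hX hW
  refine congrFun (Continuous.ext_on (TopologicalSpace.denseRange_denseSeq ℝ≥0) hX
    (g := fun t => S * Real.exp (σ * W t ω + (μ - σ ^ 2 / 2) * t)) (by fun_prop) ?_)
  rintro _ ⟨m, rfl⟩
  exact hdense m

end IsGBMSolution

section Reflection

variable {Ω : Type*}

theorem measurable_partialSups {E : Type*} [SemilatticeSup E] [MeasurableSpace E]
    [MeasurableSup₂ E] {m : MeasurableSpace Ω} {n : ℕ} {x : ℕ → Ω → E}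
    (hx : ∀ k ≤ n, Measurable (x k)) : Measurable fun ω => partialSups (fun k => x k ω) n := by
  induction n with
  | zero => simpa only [partialSups_zero] using hx 0 le_rfl
  | succ n ih =>
    simp only [partialSups_add_one]
    exact (ih fun k hk => hx k (hk.trans n.le_succ)).sup (hx _ le_rfl)

theorem preimage_partialSups {E : Type*} [LinearOrder E] {U : Set E} (hU : IsUpperSet U)
    (x : ℕ → Ω → E) (n : ℕ) :
    (fun ω => partialSups (fun k => x k ω) n) ⁻¹' U = partialSups (fun k => x k ⁻¹' U) n := by
  ext ω
  simp only [partialSups_eq_biUnion_range, Set.mem_preimage, Set.mem_iUnion, Finset.mem_range,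
    Nat.lt_succ_iff, exists_prop]
  constructor
  · obtain ⟨k, hk, h⟩ := exists_partialSups_eq (fun k => x k ω) n
    exact fun hω => ⟨k, hk, h ▸ hω⟩
  · rintro ⟨k, hk, hω⟩
    exact hU (le_partialSups_of_le (fun k => x k ω) hk) hω

theorem measurableSet_disjointed {m : MeasurableSpace Ω} {A : ℕ → Set Ω} {k : ℕ}
    (hA : ∀ j ≤ k, MeasurableSet (A j)) : MeasurableSet (disjointed A k) := by
  rw [disjointed_eq_inter_compl]
  exact (hA k le_rfl).inter (.iInter fun j => .iInter fun hj => (hA j hj.le).compl)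

theorem setLIntegral_partialSups {mΩ : MeasurableSpace Ω} (P : Measure Ω) {A : ℕ → Set Ω}
    (hA : ∀ k, MeasurableSet (A k)) (f : Ω → ℝ≥0∞) (n : ℕ) :
    ∫⁻ ω in partialSups A n, f ω ∂P =
      ∑ k ∈ Finset.range (n + 1), ∫⁻ ω in disjointed A k, f ω ∂P := by
  rw [← biUnion_range_succ_disjointed, lintegral_biUnion_finset
    (fun i _ j _ hij => disjoint_disjointed A hij) fun k _ => .disjointed hA k]

variable {m₁ m₂ mΩ : MeasurableSpace Ω} {P : Measure Ω}

theorem setLIntegral_mul_of_indep (hm₁ : m₁ ≤ mΩ) (hm₂ : m₂ ≤ mΩ)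
    (hind : Indep m₁ m₂ P) {E : Set Ω} (hE : MeasurableSet[m₁] E) {f g : Ω → ℝ≥0∞}
    (hf : Measurable[m₁] f) (hg : Measurable[m₂] g) :
    ∫⁻ ω in E, f ω * g ω ∂P = (∫⁻ ω in E, f ω ∂P) * ∫⁻ ω, g ω ∂P := by
  rw [← lintegral_indicator (hm₁ _ hE), ← lintegral_indicator (hm₁ _ hE),
    ← lintegral_mul_eq_lintegral_mul_lintegral_of_independent_measurableSpace hm₁ hm₂ hind
      (hf.indicator hE) hg]
  simp only [Set.indicator_mul_left]

theorem setLIntegral_inter_of_indep (hm₁ : m₁ ≤ mΩ) (hm₂ : m₂ ≤ mΩ)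
    (hind : Indep m₁ m₂ P) {E H : Set Ω} (hE : MeasurableSet[m₁] E) (hH : MeasurableSet[m₂] H)
    {f : Ω → ℝ≥0∞} (hf : Measurable[m₁] f) :
    ∫⁻ ω in E ∩ H, f ω ∂P = P H * ∫⁻ ω in E, f ω ∂P := by
  have hg : Measurable[m₂] (H.indicator fun _ => (1 : ℝ≥0∞)) := measurable_const.indicator hH
  have hH' : MeasurableSet H := hm₂ _ hH
  have hprod := setLIntegral_mul_of_indep hm₁ hm₂ hind hE hf hg
  rw [lintegral_indicator_const hH', one_mul, mul_comm] at hprod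
  rw [← hprod, Set.inter_comm, ← setLIntegral_indicator hH']
  refine lintegral_congr fun ω => ?_
  by_cases hω : ω ∈ H <;> simp [hω]

/-- André's reflection argument: whatever happened before the first `k` with `A k`, the event
`H k` of the independent future leads to `A n` with probability at least `c`. -/
theorem sum_setLIntegral_disjointed_le {𝓟 𝓠 : ℕ → MeasurableSpace Ω} (h𝓟 : ∀ k, 𝓟 k ≤ mΩ)
    (h𝓟_mono : Monotone 𝓟) (h𝓠 : ∀ k, 𝓠 k ≤ mΩ) (hind : ∀ k, Indep (𝓟 k) (𝓠 k) P)
    {A H : ℕ → Set Ω} (hA : ∀ k, MeasurableSet[𝓟 k] (A k)) {f : ℕ → Ω → ℝ≥0∞}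
    (hf : ∀ k, Measurable[𝓟 k] (f k)) {n : ℕ} (hf_le : ∀ k ≤ n, f k ≤ f n)
    (hH : ∀ k ≤ n, MeasurableSet[𝓠 k] (H k)) {c : ℝ≥0∞} (hc : ∀ k ≤ n, c ≤ P (H k))
    (hAH : ∀ k ≤ n, A k ∩ H k ⊆ A n) :
    c * ∑ k ∈ Finset.range (n + 1), ∫⁻ ω in disjointed A k, f k ω ∂P ≤
      ∫⁻ ω in A n, f n ω ∂P := by
  have hA' : ∀ k, MeasurableSet (A k) := fun k => h𝓟 k _ (hA k)
  have hsub : ∀ k ≤ n, disjointed A k ∩ H k ⊆ A n ∩ disjointed A k := fun k hk _ hω =>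
    ⟨hAH k hk ⟨disjointed_subset A k hω.1, hω.2⟩, hω.1⟩
  have hfirst : ∀ k ≤ n, c * ∫⁻ ω in disjointed A k, f k ω ∂P ≤
      ∫⁻ ω in disjointed A k, (A n).indicator (f n) ω ∂P := fun k hk =>
    calc c * ∫⁻ ω in disjointed A k, f k ω ∂P
        ≤ P (H k) * ∫⁻ ω in disjointed A k, f k ω ∂P := mul_le_mul_left (hc k hk) _
      _ = ∫⁻ ω in disjointed A k ∩ H k, f k ω ∂P :=
        (setLIntegral_inter_of_indep (h𝓟 k) (h𝓠 k) (hind k)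
          (measurableSet_disjointed fun j hj => h𝓟_mono hj _ (hA j)) (hH k hk) (hf k)).symm
      _ ≤ ∫⁻ ω in A n ∩ disjointed A k, f n ω ∂P :=
        lintegral_mono' (Measure.restrict_mono (hsub k hk) le_rfl) (hf_le k hk)
      _ = ∫⁻ ω in disjointed A k, (A n).indicator (f n) ω ∂P :=
        (setLIntegral_indicator (hA' n) _).symm
  calc c * ∑ k ∈ Finset.range (n + 1), ∫⁻ ω in disjointed A k, f k ω ∂P
      ≤ ∑ k ∈ Finset.range (n + 1), ∫⁻ ω in disjointed A k, (A n).indicator (f n) ω ∂P := by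
        rw [Finset.mul_sum]
        exact Finset.sum_le_sum fun k hk => hfirst k (Finset.mem_range_succ_iff.1 hk)
    _ = ∫⁻ ω in partialSups A n, (A n).indicator (f n) ω ∂P :=
        (setLIntegral_partialSups P hA' _ n).symm
    _ ≤ ∫⁻ ω, (A n).indicator (f n) ω ∂P := setLIntegral_le_lintegral _ _
    _ = ∫⁻ ω in A n, f n ω ∂P := lintegral_indicator (hA' n) _

theorem mul_lintegral_le_of_measure_upperSet {c : ℝ≥0∞} (hc : c ≠ ∞) {f g : Ω → ℝ}
    (hf : Measurable f) (hg : Measurable g)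
    (h : ∀ U : Set ℝ, IsUpperSet U → c * P (f ⁻¹' U) ≤ P (g ⁻¹' U)) {φ : ℝ → ℝ}
    (hφ : Monotone φ) (hφ_nonneg : 0 ≤ φ) :
    c * ∫⁻ ω, ENNReal.ofReal (φ (f ω)) ∂P ≤ ∫⁻ ω, ENNReal.ofReal (φ (g ω)) ∂P := by
  rw [lintegral_eq_lintegral_meas_le P (ae_of_all _ fun ω => hφ_nonneg (f ω))
      (hφ.measurable.comp hf).aemeasurable,
    lintegral_eq_lintegral_meas_le P (ae_of_all _ fun ω => hφ_nonneg (g ω))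
      (hφ.measurable.comp hg).aemeasurable, ← lintegral_const_mul' _ _ hc]
  exact lintegral_mono fun t => h {x | t ≤ φ x} fun x y hxy hx => hx.trans (hφ hxy)

end Reflection

section GaussianTail

theorem gaussianPDFReal_two_mul_mul_exp_le {u K a r : ℝ} (hu : u ≤ K) (hr : 0 ≤ r) :
    gaussianPDFReal u 1 (2 * r) * Real.exp (a * (2 * r)) ≤
      Real.exp ((2 * a + K) ^ 2 / 6) * gaussianPDFReal u 1 r := by
  simp only [gaussianPDFReal]
  rw [mul_assoc, ← Real.exp_add, mul_left_comm (Real.exp _), ← Real.exp_add]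
  refine mul_le_mul_of_nonneg_left (Real.exp_le_exp.2 ?_) (by positivity)
  have hur : u * r ≤ K * r := by gcongr
  simp only [NNReal.coe_one, mul_one]
  nlinarith [sq_nonneg (3 * r - (2 * a + K))]

theorem lintegral_eq_two_mul_lintegral_two_mul {f : ℝ → ℝ≥0∞} (hf : Measurable f) :
    ∫⁻ x, f x = 2 * ∫⁻ r, f (2 * r) := by
  have hscale := Real.smul_map_volume_mul_left (a := 2) two_ne_zero
  rw [abs_of_pos two_pos, ENNReal.ofReal_ofNat] at hscale
  conv_lhs => rw [← hscale]
  rw [lintegral_smul_measure, lintegral_map hf (by fun_prop), smul_eq_mul]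

theorem setLIntegral_Ici_exp_gaussianReal_le {u K : ℝ} (hu : u ≤ K) (a : ℝ) :
    ∫⁻ x in Set.Ici 0, ENNReal.ofReal (Real.exp (a * x)) ∂gaussianReal u 1 ≤
      ENNReal.ofReal (2 * Real.exp ((2 * a + K) ^ 2 / 6)) * gaussianReal u 1 (Set.Ici 0) := by
  have hdensity : gaussianReal u 1 = volume.withDensity (gaussianPDF u 1) :=
    gaussianReal_of_var_ne_zero u one_ne_zero
  have hexp : Measurable fun x : ℝ => ENNReal.ofReal (Real.exp (a * x)) := by fun_prop
  have hpdf := measurable_gaussianPDF u 1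
  have hdouble : ∀ r : ℝ, 2 * r ∈ Set.Ici (0 : ℝ) ↔ r ∈ Set.Ici (0 : ℝ) := fun r => by simp
  rw [hdensity, setLIntegral_withDensity_eq_setLIntegral_mul _ hpdf hexp measurableSet_Ici,
    withDensity_apply _ measurableSet_Ici, ← lintegral_indicator measurableSet_Ici,
    ← lintegral_indicator measurableSet_Ici,
    lintegral_eq_two_mul_lintegral_two_mul ((hpdf.mul hexp).indicator measurableSet_Ici),
    ENNReal.ofReal_mul two_pos.le, ENNReal.ofReal_ofNat, mul_assoc,
    ← lintegral_const_mul _ (hpdf.indicator measurableSet_Ici)]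
  refine mul_le_mul_right (lintegral_mono fun r => ?_) _
  by_cases hr : r ∈ Set.Ici (0 : ℝ)
  · rw [Set.indicator_of_mem ((hdouble r).2 hr), Set.indicator_of_mem hr, Pi.mul_apply,
      gaussianPDF, gaussianPDF, ← ENNReal.ofReal_mul (gaussianPDFReal_nonneg _ _ _),
      ← ENNReal.ofReal_mul (Real.exp_pos _).le]
    exact ENNReal.ofReal_le_ofReal (gaussianPDFReal_two_mul_mul_exp_le hu hr)
  · rw [Set.indicator_of_notMem ((hdouble r).not.2 hr)]
    exact zero_le

theorem gaussianReal_Ici_ne_zero (K : ℝ) : gaussianReal 0 1 (Set.Ici K) ≠ 0 := fun h => by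
  simpa using gaussianReal_absolutelyContinuous' 0 one_ne_zero h

theorem gaussianReal_Ici_le_gaussianReal_Ici_neg_mul {K θ : ℝ} (hθ : |θ| ≤ K) {v : ℝ≥0}
    (hv : v ≤ 1) :
    gaussianReal 0 1 (Set.Ici K) ≤ gaussianReal 0 v (Set.Ici (-(θ * v))) := by
  rw [gaussianReal_zero_eq_map_sqrt v, Measure.map_apply (by fun_prop) measurableSet_Ici]
  refine measure_mono fun z (hz : K ≤ z) => ?_
  change -(θ * v) ≤ √(v : ℝ) * z
  have hv' : √(v : ℝ) ≤ 1 := Real.sqrt_le_one.2 (by exact_mod_cast hv)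
  calc -(θ * v) = -θ * v := by ring
    _ ≤ K * v := mul_le_mul_of_nonneg_right ((neg_le_abs θ).trans hθ) v.coe_nonneg
    _ = √(v : ℝ) * (√(v : ℝ) * K) := by rw [← mul_assoc, Real.mul_self_sqrt v.coe_nonneg, mul_comm]
    _ ≤ √(v : ℝ) * K := mul_le_mul_of_nonneg_left
        (mul_le_of_le_one_left ((abs_nonneg θ).trans hθ) hv') (Real.sqrt_nonneg _)
    _ ≤ √(v : ℝ) * z := mul_le_mul_of_nonneg_left hz (Real.sqrt_nonneg _)

end GaussianTail

section ExponentialMaximum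

/-- The exponential maximum `max_{k ≤ n} exp (a |x k|)`, with values in `ℝ≥0∞` to suit the lower
Lebesgue integral. -/
noncomputable def maxExpAbs (a : ℝ) (x : ℕ → ℝ) (n : ℕ) : ℝ≥0∞ :=
  partialSups (fun k => ENNReal.ofReal (Real.exp (a * |x k|))) n

variable {a : ℝ} {x y : ℕ → ℝ} {m n : ℕ}

theorem le_maxExpAbs (a : ℝ) (x : ℕ → ℝ) {k : ℕ} (hk : k ≤ n) :
    ENNReal.ofReal (Real.exp (a * |x k|)) ≤ maxExpAbs a x n :=
  le_partialSups_of_le (fun k => ENNReal.ofReal (Real.exp (a * |x k|))) hk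

theorem maxExpAbs_le {b : ℝ≥0∞} (h : ∀ k ≤ n, ENNReal.ofReal (Real.exp (a * |x k|)) ≤ b) :
    maxExpAbs a x n ≤ b :=
  partialSups_le _ _ _ h

theorem maxExpAbs_mono (a : ℝ) (x : ℕ → ℝ) (hmn : m ≤ n) : maxExpAbs a x m ≤ maxExpAbs a x n :=
  (partialSups _).mono hmn

theorem one_le_maxExpAbs (ha : 0 ≤ a) (x : ℕ → ℝ) (n : ℕ) : 1 ≤ maxExpAbs a x n :=
  (ENNReal.one_le_ofReal.2 (Real.one_le_exp (by positivity))).trans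
    (le_maxExpAbs a x (zero_le : 0 ≤ n))

theorem measurable_maxExpAbs {Ω : Type*} {_ : MeasurableSpace Ω} {Y : ℕ → Ω → ℝ}
    (hY : ∀ k ≤ n, Measurable (Y k)) (a : ℝ) :
    Measurable fun ω => maxExpAbs a (fun k => Y k ω) n :=
  measurable_partialSups (x := fun k ω => ENNReal.ofReal (Real.exp (a * |Y k ω|))) fun k hk =>
    (by fun_prop : Measurable fun t : ℝ => ENNReal.ofReal (Real.exp (a * |t|))).comp (hY k hk)

theorem ofReal_exp_mul_abs_le_mul (ha : 0 ≤ a) {u v w : ℝ} (h : |u| ≤ |v| + |w|) :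
    ENNReal.ofReal (Real.exp (a * |u|)) ≤
      ENNReal.ofReal (Real.exp (a * |v|)) * ENNReal.ofReal (Real.exp (a * |w|)) := by
  rw [← ENNReal.ofReal_mul (Real.exp_pos _).le, ← Real.exp_add, ← mul_add]
  gcongr

theorem maxExpAbs_le_maxExpAbs_two_mul (ha : 0 ≤ a)
    (h : ∀ k ≤ m, ∃ i ≤ n, ∃ j ≤ n, |x k| ≤ |y i| + |y j|) :
    maxExpAbs a x m ≤ maxExpAbs (2 * a) y n := by
  refine maxExpAbs_le fun k hk => ?_
  obtain ⟨i, hi, j, hj, hij⟩ := h k hk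
  have hdouble : ∀ l ≤ n, |x k| ≤ 2 * |y l| →
      ENNReal.ofReal (Real.exp (a * |x k|)) ≤ maxExpAbs (2 * a) y n := fun l hl hxy => by
    refine le_trans (ENNReal.ofReal_le_ofReal (Real.exp_le_exp.2 ?_)) (le_maxExpAbs _ y hl)
    calc a * |x k| ≤ a * (2 * |y l|) := mul_le_mul_of_nonneg_left hxy ha
      _ = 2 * a * |y l| := by ring
  rcases le_total |y i| |y j| with hle | hle
  · exact hdouble j hj (by linarith)
  · exact hdouble i hi (by linarith)

end ExponentialMaximum

section DriftedBrownianMotion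

variable {Ω : Type*} {V : ℝ≥0 → Ω → ℝ} {θ K : ℝ} {s t : ℝ≥0}

/-- The process `V` with the drift `θ t` added. The deviation of `drifted V θ` from the line of
slope `y` is `drifted V (θ - y)`. -/
def drifted (V : ℝ≥0 → Ω → ℝ) (θ : ℝ) (t : ℝ≥0) (ω : Ω) : ℝ := V t ω + θ * t

/-- The `σ`-algebra generated by the process `V` up to time `t`. -/
abbrev pastAlgebra (V : ℝ≥0 → Ω → ℝ) (t : ℝ≥0) : MeasurableSpace Ω :=
  MeasurableSpace.comap (fun ω (s : Set.Iic t) => V s ω) inferInstance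

/-- The `σ`-algebra generated by the increments of the process `V` after time `t`. -/
abbrev futureAlgebra (V : ℝ≥0 → Ω → ℝ) (t : ℝ≥0) : MeasurableSpace Ω :=
  MeasurableSpace.comap (fun ω (s : ℝ≥0) => V (t + s) ω - V t ω) inferInstance

theorem drifted_neg (V : ℝ≥0 → Ω → ℝ) (θ : ℝ) (t : ℝ≥0) (ω : Ω) :
    drifted (-V) (-θ) t ω = -drifted V θ t ω := by
  simp only [drifted, Pi.neg_apply]
  ring

theorem drifted_sub_mul (V : ℝ≥0 → Ω → ℝ) (θ y : ℝ) (t : ℝ≥0) (ω : Ω) :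
    drifted V θ t ω - y * t = drifted V (θ - y) t ω := by
  simp only [drifted]
  ring

theorem measurable_eval_pastAlgebra (V : ℝ≥0 → Ω → ℝ) (hst : s ≤ t) :
    Measurable[pastAlgebra V t] (V s) :=
  (measurable_pi_apply (⟨s, hst⟩ : Set.Iic t)).comp
    (comap_measurable fun ω (s : Set.Iic t) => V s ω)

theorem measurable_drifted_pastAlgebra (V : ℝ≥0 → Ω → ℝ) (θ : ℝ) (hst : s ≤ t) :
    Measurable[pastAlgebra V t] (drifted V θ s) :=
  (measurable_eval_pastAlgebra V hst).add_const _

theorem measurable_drifted_sub_futureAlgebra (V : ℝ≥0 → Ω → ℝ) (θ : ℝ) (hst : s ≤ t) :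
    Measurable[futureAlgebra V s] fun ω => drifted V θ t ω - drifted V θ s ω := by
  obtain ⟨r, rfl⟩ := exists_add_of_le hst
  have hincr : Measurable[futureAlgebra V s] fun ω => V (s + r) ω - V s ω + θ * r :=
    ((measurable_pi_apply r).comp
      (comap_measurable fun ω (r : ℝ≥0) => V (s + r) ω - V s ω)).add_const _
  convert! hincr using 2 with ω
  simp only [drifted, NNReal.coe_add]
  ring

theorem pastAlgebra_mono (V : ℝ≥0 → Ω → ℝ) : Monotone (pastAlgebra V) := fun _ t hst =>
  Measurable.comap_le <| @measurable_pi_lambda _ _ _ (pastAlgebra V t) _ _ fun r =>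
    measurable_eval_pastAlgebra V (r.2.trans hst)

variable {mΩ : MeasurableSpace Ω} {P : Measure Ω}

theorem pastAlgebra_le (hVm : ∀ t, Measurable (V t)) (t : ℝ≥0) : pastAlgebra V t ≤ mΩ :=
  (measurable_pi_lambda _ fun s : Set.Iic t => hVm s).comap_le

theorem futureAlgebra_le (hVm : ∀ t, Measurable (V t)) (t : ℝ≥0) : futureAlgebra V t ≤ mΩ :=
  (measurable_pi_lambda _ fun s => (hVm (t + s)).sub (hVm t)).comap_le

theorem indep_pastAlgebra_futureAlgebra (hV : IsPreBrownianReal V P) (t : ℝ≥0) :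
    Indep (pastAlgebra V t) (futureAlgebra V t) P :=
  ((IndepFun_iff_Indep _ _ _).1 (hV.indepFun_shift t)).symm

theorem measurable_drifted (hVm : ∀ t, Measurable (V t)) (θ : ℝ) (t : ℝ≥0) :
    Measurable (drifted V θ t) := (hVm t).add_const _

theorem le_measure_drifted_le_drifted (hθ : |θ| ≤ K) (hV : IsPreBrownianReal V P) (hst : s ≤ t)
    (ht : t ≤ 1) :
    gaussianReal 0 1 (Set.Ici K) ≤ P {ω | drifted V θ s ω ≤ drifted V θ t ω} := by
  have hlaw := hV.hasLaw_sub t s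
  set v := nndist t.1 s.1
  have hv : (v : ℝ) = t - s := by
    rw [coe_nndist, Real.dist_eq]
    exact abs_of_nonneg (sub_nonneg.2 hst)
  have hv_le : v ≤ 1 := by
    rw [← NNReal.coe_le_coe, hv, NNReal.coe_one]
    linarith [s.coe_nonneg, (by exact_mod_cast ht : (t : ℝ) ≤ 1)]
  refine (gaussianReal_Ici_le_gaussianReal_Ici_neg_mul hθ hv_le).trans (le_of_eq ?_)
  rw [← hlaw.map_eq, Measure.map_apply_of_aemeasurable hlaw.aemeasurable measurableSet_Ici]
  congr 1
  ext ω
  simp only [Set.mem_preimage, Set.mem_Ici, Pi.sub_apply, Set.mem_ofPred_eq, drifted, hv]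
  constructor <;> intro h <;> linarith

theorem sum_setLIntegral_disjointed_drifted_le (hθ : |θ| ≤ K) (hV : IsPreBrownianReal V P)
    (hVm : ∀ t, Measurable (V t)) {p : ℕ → ℝ≥0} (hp : Monotone p) {n : ℕ} (hpn : p n ≤ 1)
    {f : ℕ → Ω → ℝ≥0∞} (hf : ∀ k, Measurable[pastAlgebra V (p k)] (f k))
    (hf_le : ∀ k ≤ n, f k ≤ f n) {U : Set ℝ} (hU : IsUpperSet U) :
    gaussianReal 0 1 (Set.Ici K) * ∑ k ∈ Finset.range (n + 1),
        ∫⁻ ω in disjointed (fun k => drifted V θ (p k) ⁻¹' U) k, f k ω ∂P ≤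
      ∫⁻ ω in drifted V θ (p n) ⁻¹' U, f n ω ∂P :=
  sum_setLIntegral_disjointed_le (fun k => pastAlgebra_le hVm (p k))
    ((pastAlgebra_mono V).comp hp) (fun k => futureAlgebra_le hVm (p k))
    (fun k => indep_pastAlgebra_futureAlgebra hV (p k))
    (fun _ => measurable_drifted_pastAlgebra V θ le_rfl hU.ordConnected.measurableSet) hf hf_le
    (fun k hk => by
      simp_rw [← sub_nonneg (a := drifted V θ (p n) _)]
      exact measurable_drifted_sub_futureAlgebra V θ (hp hk) measurableSet_Ici)
    (fun k hk => le_measure_drifted_le_drifted hθ hV (hp hk) hpn)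
    fun _ _ _ hω => hU hω.2 hω.1

theorem lintegral_exp_drifted (hV : IsPreBrownianReal V P) (θ a : ℝ) (t : ℝ≥0) :
    ∫⁻ ω, ENNReal.ofReal (Real.exp (a * drifted V θ t ω)) ∂P =
      ENNReal.ofReal (Real.exp (t * (a * θ + a ^ 2 / 2))) := by
  simp_rw [drifted]
  rw [(hV.hasLaw_eval t).lintegral_comp
    (f := fun x => ENNReal.ofReal (Real.exp (a * (x + θ * t)))) (by fun_prop),
    ← ofReal_integral_eq_lintegral_ofReal _ (ae_of_all _ fun x => (Real.exp_pos _).le)]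
  · simp_rw [mul_add, Real.exp_add]
    rw [integral_mul_const, integral_exp_mul_gaussianReal, ← Real.exp_add, ← Real.exp_add]
    ring_nf
  · simp_rw [mul_add, Real.exp_add]
    exact (integrable_exp_mul_gaussianReal a).mul_const _

theorem mul_lintegral_exp_partialSups_drifted_le (hθ : |θ| ≤ K) (hV : IsPreBrownianReal V P)
    (hVm : ∀ t, Measurable (V t)) {p : ℕ → ℝ≥0} (hp : Monotone p) {n : ℕ} (hpn : p n ≤ 1)
    {a : ℝ} (ha : 0 ≤ a) :
    gaussianReal 0 1 (Set.Ici K) * ∫⁻ ω, ENNReal.ofReal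
        (Real.exp (a * partialSups (fun k => drifted V θ (p k) ω) n)) ∂P ≤
      ENNReal.ofReal (Real.exp (a * K + a ^ 2 / 2)) := by
  have hK : θ ≤ K := (le_abs_self θ).trans hθ
  have hK0 : 0 ≤ K := (abs_nonneg θ).trans hθ
  have hmono : Monotone fun x => Real.exp (a * x) := fun x y hxy =>
    Real.exp_le_exp.2 (mul_le_mul_of_nonneg_left hxy ha)
  have hreflect : ∀ U : Set ℝ, IsUpperSet U → gaussianReal 0 1 (Set.Ici K) *
      P ((fun ω => partialSups (fun k => drifted V θ (p k) ω) n) ⁻¹' U) ≤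
        P (drifted V θ (p n) ⁻¹' U) := fun U hU => by
    rw [preimage_partialSups hU, ← setLIntegral_one (μ := P), ← setLIntegral_one (μ := P),
      setLIntegral_partialSups P fun k =>
        measurable_drifted hVm θ (p k) hU.ordConnected.measurableSet]
    exact sum_setLIntegral_disjointed_drifted_le hθ hV hVm hp hpn (f := fun _ _ => 1)
      (fun _ => measurable_const) (fun _ _ => le_rfl) hU
  refine (mul_lintegral_le_of_measure_upperSet (measure_ne_top _ _)
    (measurable_partialSups fun k _ => measurable_drifted hVm θ (p k))
    (measurable_drifted hVm θ (p n)) hreflect hmono fun x => (Real.exp_pos _).le).trans ?_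
  rw [lintegral_exp_drifted hV]
  refine ENNReal.ofReal_le_ofReal (Real.exp_le_exp.2 ?_)
  calc p n * (a * θ + a ^ 2 / 2) ≤ p n * (a * K + a ^ 2 / 2) := by gcongr
    _ ≤ a * K + a ^ 2 / 2 := mul_le_of_le_one_left (by positivity) (by exact_mod_cast hpn)

/-- The bound for `𝔼 max_k exp (a |Y (p k)|)`, where `Y` is a Brownian motion on `[0, 1]` with
drift at most `K` in absolute value. -/
noncomputable def maxExpConst (a K : ℝ) : ℝ≥0∞ :=
  (gaussianReal 0 1 (Set.Ici K))⁻¹ * (2 * ENNReal.ofReal (Real.exp (a * K + a ^ 2 / 2)))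

theorem maxExpConst_ne_top (a K : ℝ) : maxExpConst a K ≠ ∞ :=
  ENNReal.mul_ne_top (ENNReal.inv_ne_top.2 (gaussianReal_Ici_ne_zero K))
    (ENNReal.mul_ne_top ENNReal.ofNat_ne_top ENNReal.ofReal_ne_top)

theorem lintegral_maxExpAbs_drifted_le (hθ : |θ| ≤ K) (hV : IsPreBrownianReal V P)
    (hVm : ∀ t, Measurable (V t)) {p : ℕ → ℝ≥0} (hp : Monotone p) {n : ℕ} (hpn : p n ≤ 1)
    {a : ℝ} (ha : 0 ≤ a) :
    ∫⁻ ω, maxExpAbs a (fun k => drifted V θ (p k) ω) n ∂P ≤ maxExpConst a K := by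
  have hup := mul_lintegral_exp_partialSups_drifted_le hθ hV hVm hp hpn ha
  have hdown := mul_lintegral_exp_partialSups_drifted_le ((abs_neg θ).trans_le hθ) hV.neg
    (fun t => (hVm t).neg) hp hpn ha
  have hmeas : Measurable fun ω => ENNReal.ofReal
      (Real.exp (a * partialSups (fun k => drifted V θ (p k) ω) n)) :=
    ENNReal.measurable_ofReal.comp (Real.measurable_exp.comp
      ((measurable_partialSups fun k _ => measurable_drifted hVm θ (p k)).const_mul a))
  rw [maxExpConst, ← ENNReal.mul_le_iff_le_inv (gaussianReal_Ici_ne_zero K) (measure_ne_top _ _),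
    two_mul]
  refine le_trans (mul_le_mul_right ?_ _) ((mul_add _ _ _).trans_le (add_le_add hup hdown))
  rw [← lintegral_add_left hmeas]
  refine lintegral_mono fun ω => maxExpAbs_le fun k hk => ?_
  rcases abs_choice (drifted V θ (p k) ω) with h | h <;> rw [h]
  · refine le_add_right (ENNReal.ofReal_le_ofReal (Real.exp_le_exp.2 ?_))
    exact mul_le_mul_of_nonneg_left
      (le_partialSups_of_le (fun k => drifted V θ (p k) ω) hk) ha
  · refine le_add_left (ENNReal.ofReal_le_ofReal (Real.exp_le_exp.2 ?_))
    rw [← drifted_neg]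
    exact mul_le_mul_of_nonneg_left
      (le_partialSups_of_le (fun k => drifted (-V) (-θ) (p k) ω) hk) ha

end DriftedBrownianMotion

section BarrierWalk

variable {Ω : Type*} {V : ℝ≥0 → Ω → ℝ} {θ K a y : ℝ} {s t : ℝ≥0}

/-- The bridge on `[0, 1]` of the process `V`: its deviation from the chord from `0` to `V 1`. -/
def bridge (V : ℝ≥0 → Ω → ℝ) (t : ℝ≥0) (ω : Ω) : ℝ := V t ω - t * V 1 ω

theorem abs_bridge_le (V : ℝ≥0 → Ω → ℝ) (ht : t ≤ 1) (ω : Ω) :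
    |bridge V t ω| ≤ |V t ω| + |V 1 ω| := by
  refine (abs_sub _ _).trans (add_le_add_right ?_ _)
  rw [abs_mul, NNReal.abs_eq]
  exact mul_le_of_le_one_left (abs_nonneg _) (by exact_mod_cast ht)

theorem abs_drifted_le_abs_bridge_add (V : ℝ≥0 → Ω → ℝ) (θ : ℝ) (ht : t ≤ 1) (ω : Ω) :
    |drifted V θ t ω| ≤ |bridge V t ω| + |drifted V θ 1 ω| := by
  have hchord : drifted V θ t ω = bridge V t ω + t * drifted V θ 1 ω := by
    simp only [drifted, bridge, NNReal.coe_one]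
    ring
  rw [hchord]
  refine (abs_add_le _ _).trans (add_le_add_right ?_ _)
  rw [abs_mul, NNReal.abs_eq]
  exact mul_le_of_le_one_left (abs_nonneg _) (by exact_mod_cast ht)

theorem abs_sub_mul_le_of_le {u v s t : ℝ} (hy : 0 ≤ y) (hst : s ≤ t) (ht : t ≤ 1) (hyu : y ≤ u) :
    |v - y * t| ≤ |u - y * s| + |v - u| := by
  have hys : y * s ≤ y * t := mul_le_mul_of_nonneg_left hst hy
  have hyt : y * t ≤ y := mul_le_of_le_one_right hy ht
  rw [abs_of_nonneg (by linarith : 0 ≤ u - y * s), abs_le]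
  constructor <;> linarith [le_abs_self (v - u), neg_abs_le (v - u)]

variable {p : ℕ → ℝ≥0} {n k : ℕ}

/-- Once the level `y` has been reached at time `p k`, a later point of the line of slope `y` lies
between its point at time `p k` and the walk at that time. -/
theorem maxExpAbs_drifted_le_mul (V : ℝ≥0 → Ω → ℝ) (θ : ℝ) (hp : Monotone p) (hpn : p n ≤ 1)
    (ha : 0 ≤ a) (hy : 0 ≤ y) {ω : Ω} (hω : y ≤ drifted V θ (p k) ω) :
    maxExpAbs a (fun i => drifted V (θ - y) (p i) ω) n ≤
      maxExpAbs a (fun i => drifted V (θ - y) (p i) ω) k *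
        maxExpAbs a (fun j => drifted V θ (p (k + j)) ω - drifted V θ (p k) ω) (n - k) := by
  refine maxExpAbs_le fun i hi => ?_
  rcases le_total i k with hik | hik
  · exact (le_maxExpAbs a _ hik).trans (le_mul_of_one_le_right' (one_le_maxExpAbs ha _ _))
  · obtain ⟨j, rfl⟩ := Nat.exists_eq_add_of_le hik
    refine (ofReal_exp_mul_abs_le_mul ha ?_).trans
      (mul_le_mul' (le_maxExpAbs a _ le_rfl) (le_maxExpAbs a _ (Nat.le_sub_of_add_le' hi)))
    simp only [← drifted_sub_mul]
    exact abs_sub_mul_le_of_le hy (hp hik) (by exact_mod_cast (hp hi).trans hpn) hω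

variable {mΩ : MeasurableSpace Ω} {P : Measure Ω}

theorem indepFun_bridge (hV : IsPreBrownianReal V P) :
    IndepFun (fun ω (s : Set.Iic (1 : ℝ≥0)) => bridge V s ω) (fun ω (_ : Unit) => V 1 ω) P := by
  apply IsGaussianProcess.indepFun_of_covariance_eq_zero
  · apply hV.isGaussianProcess.of_isGaussianProcess
    rintro (⟨s, hs⟩ | u)
    · exact ⟨{s, 1},
        { toFun x := x ⟨s, by simp⟩ - (s : ℝ) * x ⟨1, by simp⟩
          map_add' x y := by simp; ring
          map_smul' c x := by simp; ring }, by simp [bridge]⟩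
    · exact ⟨{1},
        { toFun x := x ⟨1, by simp⟩
          map_add' x y := by simp
          map_smul' c x := by simp }, by simp⟩
  · exact fun s => (hV.aemeasurable s).sub ((hV.aemeasurable 1).const_mul _)
  · exact fun _ => hV.aemeasurable 1
  · rintro ⟨s, hs : s ≤ 1⟩ _
    have := hV.isGaussianProcess.isProbabilityMeasure
    have hL2 : ∀ t, MemLp (V t) 2 P := fun t =>
      (hV.isGaussianProcess.hasGaussianLaw_eval t).memLp_two
    change cov[fun ω => V s ω - s * V 1 ω, V 1; P] = 0
    rw [covariance_fun_sub_left (hL2 _) ((hL2 1).const_mul _) (hL2 1), covariance_const_mul_left,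
      hV.covariance_eval, hV.covariance_eval, min_eq_left hs, min_self, NNReal.coe_one, mul_one,
      sub_self]

theorem lintegral_maxExpAbs_bridge_le (hV : IsPreBrownianReal V P) (hVm : ∀ t, Measurable (V t))
    (hp : Monotone p) (hpn : p n = 1) (ha : 0 ≤ a) :
    ∫⁻ ω, maxExpAbs a (fun k => bridge V (p k) ω) n ∂P ≤ maxExpConst (2 * a) 0 := by
  refine le_trans (lintegral_mono fun ω => ?_) (lintegral_maxExpAbs_drifted_le
    (abs_zero.le) hV hVm hp hpn.le (mul_nonneg two_pos.le ha))
  refine maxExpAbs_le_maxExpAbs_two_mul ha fun k hk => ⟨k, hk, n, le_rfl, ?_⟩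
  simpa only [drifted, zero_mul, add_zero, hpn] using abs_bridge_le V (hpn ▸ hp hk) ω

theorem setLIntegral_exp_abs_drifted_one_le (hθ : θ ≤ K) (hV : IsPreBrownianReal V P)
    (hVm : ∀ t, Measurable (V t)) (a : ℝ) :
    ∫⁻ ω in {ω | 0 ≤ drifted V θ 1 ω}, ENNReal.ofReal (Real.exp (a * |drifted V θ 1 ω|)) ∂P ≤
      ENNReal.ofReal (2 * Real.exp ((2 * a + K) ^ 2 / 6)) * P {ω | 0 ≤ drifted V θ 1 ω} := by
  have hadd : drifted V θ 1 = fun ω => V 1 ω + θ := by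
    ext ω
    simp [drifted]
  have hlaw : HasLaw (drifted V θ 1) (gaussianReal θ 1) P := by
    rw [hadd]
    simpa using gaussianReal_add_const (hV.hasLaw_eval 1) θ
  have hset : {ω | 0 ≤ drifted V θ 1 ω} = drifted V θ 1 ⁻¹' Set.Ici 0 := rfl
  have hmap := setLIntegral_map (μ := P) (f := fun x => ENNReal.ofReal (Real.exp (a * x)))
    measurableSet_Ici (by fun_prop) (measurable_drifted hVm θ 1) (s := Set.Ici 0)
  rw [hlaw.map_eq] at hmap
  rw [hset, ← Measure.map_apply (measurable_drifted hVm θ 1) measurableSet_Ici, hlaw.map_eq]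
  refine le_trans (le_of_eq ?_) (setLIntegral_Ici_exp_gaussianReal_le hθ a)
  rw [hmap]
  refine setLIntegral_congr_fun (measurable_drifted hVm θ 1 measurableSet_Ici) fun ω hω => ?_
  rw [abs_of_nonneg (by exact hω)]

/-- On the event that the walk ends above the line, its deviation is a bridge, independent of the
final value, plus a multiple of the overshoot. -/
theorem setLIntegral_maxExpAbs_drifted_final_le (hθ : θ ≤ K) (hV : IsPreBrownianReal V P)
    (hVm : ∀ t, Measurable (V t)) (hp : Monotone p) (hpn : p n = 1) (ha : 0 ≤ a) :
    ∫⁻ ω in {ω | 0 ≤ drifted V θ 1 ω}, maxExpAbs a (fun k => drifted V θ (p k) ω) n ∂P ≤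
      ENNReal.ofReal (2 * Real.exp ((2 * a + K) ^ 2 / 6)) * P {ω | 0 ≤ drifted V θ 1 ω} *
        maxExpConst (2 * a) 0 := by
  have hfinal : Measurable[MeasurableSpace.comap (fun ω (_ : Unit) => V 1 ω) inferInstance]
      (drifted V θ 1) :=
    ((measurable_pi_apply ()).comp (comap_measurable fun ω (_ : Unit) => V 1 ω)).add_const _
  have hbridge : ∀ k ≤ n, Measurable[MeasurableSpace.comap
      (fun ω (s : Set.Iic (1 : ℝ≥0)) => bridge V s ω) inferInstance] (bridge V (p k)) := fun k hk =>
    (measurable_pi_apply (⟨p k, hpn ▸ hp hk⟩ : Set.Iic (1 : ℝ≥0))).comp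
      (comap_measurable fun ω (s : Set.Iic (1 : ℝ≥0)) => bridge V s ω)
  have hexp : Measurable fun x : ℝ => ENNReal.ofReal (Real.exp (a * |x|)) := by fun_prop
  calc ∫⁻ ω in {ω | 0 ≤ drifted V θ 1 ω}, maxExpAbs a (fun k => drifted V θ (p k) ω) n ∂P
      ≤ ∫⁻ ω in {ω | 0 ≤ drifted V θ 1 ω}, ENNReal.ofReal (Real.exp (a * |drifted V θ 1 ω|)) *
          maxExpAbs a (fun k => bridge V (p k) ω) n ∂P := by
        refine lintegral_mono fun ω => maxExpAbs_le fun k hk => ?_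
        exact (ofReal_exp_mul_abs_le_mul ha
          (abs_drifted_le_abs_bridge_add V θ (hpn ▸ hp hk) ω)).trans ((mul_le_mul_left
            (le_maxExpAbs a (fun k => bridge V (p k) ω) hk) _).trans_eq (mul_comm _ _))
    _ = (∫⁻ ω in {ω | 0 ≤ drifted V θ 1 ω}, ENNReal.ofReal (Real.exp (a * |drifted V θ 1 ω|)) ∂P) *
          ∫⁻ ω, maxExpAbs a (fun k => bridge V (p k) ω) n ∂P :=
        setLIntegral_mul_of_indep (measurable_pi_lambda _ fun _ => hVm 1).comap_le
          (measurable_pi_lambda _ fun s : Set.Iic (1 : ℝ≥0) =>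
            (hVm s).sub ((hVm 1).const_mul _)).comap_le
          ((IndepFun_iff_Indep _ _ _).1 (indepFun_bridge hV)).symm (hfinal measurableSet_Ici)
          (hexp.comp hfinal) (measurable_maxExpAbs hbridge a)
    _ ≤ _ := mul_le_mul' (setLIntegral_exp_abs_drifted_one_le hθ hV hVm a)
        (lintegral_maxExpAbs_bridge_le hV hVm hp hpn ha)

theorem lintegral_maxExpAbs_drifted_sub_le (hθ : |θ| ≤ K) (hV : IsPreBrownianReal V P)
    (hVm : ∀ t, Measurable (V t)) (hp : Monotone p) (hpn : p n ≤ 1) (ha : 0 ≤ a) (hk : k ≤ n) :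
    ∫⁻ ω, maxExpAbs a (fun j => drifted V θ (p (k + j)) ω - drifted V θ (p k) ω) (n - k) ∂P ≤
      maxExpConst (2 * a) K := by
  refine le_trans (lintegral_mono fun ω => ?_) (lintegral_maxExpAbs_drifted_le
    hθ hV hVm hp hpn (mul_nonneg two_pos.le ha))
  exact maxExpAbs_le_maxExpAbs_two_mul ha fun j hj =>
    ⟨k + j, Nat.add_le_of_le_sub' hk hj, k, hk, abs_sub _ _⟩

theorem setLIntegral_maxExpAbs_drifted_le_mul (hθ : |θ| ≤ K) (hV : IsPreBrownianReal V P)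
    (hVm : ∀ t, Measurable (V t)) (hp : Monotone p) (hpn : p n ≤ 1) (ha : 0 ≤ a) (hy : 0 ≤ y)
    (hk : k ≤ n) {E : Set Ω} (hE : MeasurableSet[pastAlgebra V (p k)] E)
    (hE_le : ∀ ω ∈ E, y ≤ drifted V θ (p k) ω) :
    ∫⁻ ω in E, maxExpAbs a (fun i => drifted V (θ - y) (p i) ω) n ∂P ≤
      maxExpConst (2 * a) K *
        ∫⁻ ω in E, maxExpAbs a (fun i => drifted V (θ - y) (p i) ω) k ∂P := by
  calc ∫⁻ ω in E, maxExpAbs a (fun i => drifted V (θ - y) (p i) ω) n ∂P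
      ≤ ∫⁻ ω in E, maxExpAbs a (fun i => drifted V (θ - y) (p i) ω) k *
          maxExpAbs a (fun j => drifted V θ (p (k + j)) ω - drifted V θ (p k) ω) (n - k) ∂P :=
        setLIntegral_mono' (pastAlgebra_le hVm _ _ hE) fun ω hω =>
          maxExpAbs_drifted_le_mul V θ hp hpn ha hy (hE_le ω hω)
    _ = (∫⁻ ω in E, maxExpAbs a (fun i => drifted V (θ - y) (p i) ω) k ∂P) *
          ∫⁻ ω, maxExpAbs a (fun j => drifted V θ (p (k + j)) ω - drifted V θ (p k) ω) (n - k) ∂P :=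
        setLIntegral_mul_of_indep (pastAlgebra_le hVm _) (futureAlgebra_le hVm _)
          (indep_pastAlgebra_futureAlgebra hV _) hE
          (measurable_maxExpAbs (fun i hi => measurable_drifted_pastAlgebra V _ (hp hi)) a)
          (measurable_maxExpAbs (fun j _ =>
            measurable_drifted_sub_futureAlgebra V θ (hp (Nat.le_add_right k j))) a)
    _ ≤ _ := by
        rw [mul_comm]
        exact mul_le_mul_left (lintegral_maxExpAbs_drifted_sub_le hθ hV hVm hp hpn ha hk) _

/-- The bound for the conditional expectation of `max_k exp (a |Y (p k) - y p k|)` given that `Y`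
reaches `y`, where `Y` is a Brownian motion on `[0, 1]` with drift at most `K` in absolute value.
The factors account for the walk after the passage, the reflection, and the overshoot and the
bridge of a walk that ends above `y`. -/
noncomputable def barrierConst (a K : ℝ) : ℝ≥0∞ :=
  maxExpConst (2 * a) K * ((gaussianReal 0 1 (Set.Ici K))⁻¹ *
    (ENNReal.ofReal (2 * Real.exp ((2 * a + K) ^ 2 / 6)) * maxExpConst (2 * a) 0))

theorem barrierConst_ne_top (a K : ℝ) : barrierConst a K ≠ ∞ :=
  ENNReal.mul_ne_top (maxExpConst_ne_top _ _) (ENNReal.mul_ne_top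
    (ENNReal.inv_ne_top.2 (gaussianReal_Ici_ne_zero K))
    (ENNReal.mul_ne_top ENNReal.ofReal_ne_top (maxExpConst_ne_top _ _)))

theorem setLIntegral_maxExpAbs_drifted_le (hθ : |θ| ≤ K) (hV : IsPreBrownianReal V P)
    (hVm : ∀ t, Measurable (V t)) (hp : Monotone p) (hpn : p n = 1) (ha : 0 ≤ a) (hy : 0 ≤ y) :
    ∫⁻ ω in {ω | ∃ k ≤ n, y ≤ drifted V θ (p k) ω},
        maxExpAbs a (fun k => drifted V (θ - y) (p k) ω) n ∂P ≤
      barrierConst a K * P {ω | ∃ k ≤ n, y ≤ drifted V θ (p k) ω} := by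
  set A : ℕ → Set Ω := fun k => drifted V θ (p k) ⁻¹' Set.Ici y
  set D : ℕ → Ω → ℝ≥0∞ := fun k ω => maxExpAbs a (fun i => drifted V (θ - y) (p i) ω) k
  set E := {ω | ∃ k ≤ n, y ≤ drifted V θ (p k) ω}
  have hA : ∀ j k, j ≤ k → MeasurableSet[pastAlgebra V (p k)] (A j) := fun j k hjk =>
    measurable_drifted_pastAlgebra V θ (hp hjk) measurableSet_Ici
  have hE : E = partialSups A n := by
    ext ω
    simp [E, A, partialSups_eq_biUnion_range]
  have hreflect : gaussianReal 0 1 (Set.Ici K) * ∑ k ∈ Finset.range (n + 1),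
      ∫⁻ ω in disjointed A k, D k ω ∂P ≤ ∫⁻ ω in A n, D n ω ∂P :=
    sum_setLIntegral_disjointed_drifted_le hθ hV hVm hp hpn.le
      (fun k => measurable_maxExpAbs (fun i hi => measurable_drifted_pastAlgebra V _ (hp hi)) a)
      (fun k hk ω => maxExpAbs_mono a _ hk) (isUpperSet_Ici y)
  have hAn : A n = {ω | 0 ≤ drifted V (θ - y) 1 ω} := by
    ext ω
    simp [A, hpn, ← drifted_sub_mul]
  have hfinal : ∫⁻ ω in A n, D n ω ∂P ≤
      ENNReal.ofReal (2 * Real.exp ((2 * a + K) ^ 2 / 6)) * P E * maxExpConst (2 * a) 0 := by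
    refine (hAn ▸ setLIntegral_maxExpAbs_drifted_final_le (by linarith [le_abs_self θ]) hV hVm hp
      hpn ha).trans (mul_le_mul_left (mul_le_mul_right (measure_mono ?_) _) _)
    exact fun ω hω => ⟨n, le_rfl, hω⟩
  calc ∫⁻ ω in E, D n ω ∂P = ∑ k ∈ Finset.range (n + 1), ∫⁻ ω in disjointed A k, D n ω ∂P := by
        rw [hE, setLIntegral_partialSups P fun k => pastAlgebra_le hVm _ _ (hA k k le_rfl)]
    _ ≤ ∑ k ∈ Finset.range (n + 1), maxExpConst (2 * a) K * ∫⁻ ω in disjointed A k, D k ω ∂P :=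
        Finset.sum_le_sum fun k hk => setLIntegral_maxExpAbs_drifted_le_mul hθ hV hVm hp hpn.le ha
          hy (Finset.mem_range_succ_iff.1 hk) (measurableSet_disjointed fun j hj => hA j k hj)
          (disjointed_subset A k)
    _ ≤ maxExpConst (2 * a) K * ((gaussianReal 0 1 (Set.Ici K))⁻¹ *
          (ENNReal.ofReal (2 * Real.exp ((2 * a + K) ^ 2 / 6)) * P E * maxExpConst (2 * a) 0)) := by
        rw [← Finset.mul_sum]
        exact mul_le_mul_right ((ENNReal.mul_le_iff_le_inv (gaussianReal_Ici_ne_zero K)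
          (measure_ne_top _ _)).1 (hreflect.trans hfinal)) _
    _ = barrierConst a K * P E := by
        rw [barrierConst]
        ring

end BarrierWalk

section GridApproximation

variable {x x' : ℝ≥0 → ℝ} {t : ℝ≥0} {a c : ℝ}

theorem exists_le_of_forall_exists_le (hx : Continuous x) (t : ℝ≥0) {b : ℕ → ℝ}
    (hb : Filter.Tendsto b Filter.atTop (nhds c)) (h : ∀ m, ∃ s ≤ t, b m ≤ x s) :
    ∃ s ≤ t, c ≤ x s := by
  obtain ⟨s, hs, hmax⟩ := (isCompact_Icc (a := (0 : ℝ≥0)) (b := t)).exists_isMaxOn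
    ⟨0, by simp⟩ hx.continuousOn
  refine ⟨s, hs.2, le_of_tendsto' hb fun m => ?_⟩
  obtain ⟨u, hu, hle⟩ := h m
  exact hle.trans (hmax ⟨zero_le, hu⟩)

theorem floor_mul_natCast_le (ht : t ≤ 1) (n : ℕ) : ⌊t * n⌋₊ ≤ n :=
  Nat.floor_le_of_le (mul_le_of_le_one_left zero_le ht)

theorem tendsto_gridTime_floor (t : ℝ≥0) :
    Filter.Tendsto (fun n : ℕ => gridTime 1 n ⌊t * n⌋₊) Filter.atTop (nhds t) := by
  have h := (tendsto_nat_floor_mul_div_atTop (R := ℝ) t.coe_nonneg).comp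
    tendsto_natCast_atTop_atTop
  rw [← NNReal.tendsto_coe]
  refine h.congr fun n => ?_
  simp only [gridTime, mul_one, Function.comp_apply, NNReal.coe_div, NNReal.coe_natCast]
  rfl

theorem eventually_exists_le_gridTime (hx : Continuous x) (h : ∃ t ≤ 1, c < x t) :
    ∀ᶠ n : ℕ in Filter.atTop, ∃ k ≤ n, c ≤ x (gridTime 1 n k) := by
  obtain ⟨t, ht, hlt⟩ := h
  filter_upwards [((hx.tendsto t).comp (tendsto_gridTime_floor t)).eventually_const_lt hlt]
    with n hn using ⟨_, floor_mul_natCast_le ht n, hn.le⟩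

/-- The exponential maximum `sup_{t ≤ 1} exp (a |x t|)` of a path on `[0, 1]`, the continuous
counterpart of `maxExpAbs`. -/
noncomputable def supExpAbs (a : ℝ) (x : ℝ≥0 → ℝ) : ℝ≥0∞ :=
  ⨆ t : Set.Iic (1 : ℝ≥0), ENNReal.ofReal (Real.exp (a * |x t|))

theorem le_supExpAbs (a : ℝ) (x : ℝ≥0 → ℝ) (ht : t ≤ 1) :
    ENNReal.ofReal (Real.exp (a * |x t|)) ≤ supExpAbs a x :=
  le_iSup (fun t : Set.Iic (1 : ℝ≥0) => ENNReal.ofReal (Real.exp (a * |x t|))) ⟨t, ht⟩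

theorem supExpAbs_le_mul (ha : 0 ≤ a) (h : ∀ t ≤ 1, |x t| ≤ |c| + |x' t|) :
    supExpAbs a x ≤ ENNReal.ofReal (Real.exp (a * |c|)) * supExpAbs a x' :=
  iSup_le fun t => (ofReal_exp_mul_abs_le_mul ha (h t t.2)).trans
    (mul_le_mul_right (le_supExpAbs a x' t.2) _)

theorem supExpAbs_le_liminf_maxExpAbs (hx : Continuous x) (a : ℝ) :
    supExpAbs a x ≤
      Filter.liminf (fun n => maxExpAbs a (fun k => x (gridTime 1 n k)) n) Filter.atTop := by
  refine iSup_le fun t => ?_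
  have hcont : Continuous fun s => ENNReal.ofReal (Real.exp (a * |x s|)) :=
    ENNReal.continuous_ofReal.comp (by fun_prop)
  have hlim := (hcont.tendsto t).comp (tendsto_gridTime_floor t)
  refine hlim.liminf_eq.symm.trans_le (Filter.liminf_le_liminf (.of_forall fun n => ?_))
  exact le_maxExpAbs a (fun k => x (gridTime 1 n k)) (floor_mul_natCast_le t.2 n)

end GridApproximation

section Passage

variable {Ω : Type*} {mΩ : MeasurableSpace Ω} {P : Measure Ω} {X V : ℝ≥0 → Ω → ℝ}

/-- The event that the process `X` reaches the level `y` during `[0, t]`. -/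
def passageEvent (X : ℝ≥0 → Ω → ℝ) (y : ℝ) (t : ℝ≥0) : Set Ω := {ω | ∃ s ≤ t, y ≤ X s ω}

theorem passageEvent_eq_iInter (hc : ∀ ω, Continuous fun t => X t ω) (t : ℝ≥0) {y : ℝ} {u : ℕ → ℝ}
    (hu_le : ∀ m, u m ≤ y) (hu : Filter.Tendsto u Filter.atTop (nhds y)) :
    passageEvent X y t = ⋂ m, passageEvent X (u m) t := by
  refine Set.Subset.antisymm (Set.subset_iInter fun m ω ⟨s, hs, hle⟩ =>
    ⟨s, hs, (hu_le m).trans hle⟩) fun ω hω => ?_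
  exact exists_le_of_forall_exists_le (hc ω) t hu (Set.mem_iInter.1 hω)

theorem measurableSet_passageEvent (hX : ∀ t, Measurable (X t))
    (hc : ∀ ω, Continuous fun t => X t ω) (y : ℝ) (t : ℝ≥0) :
    MeasurableSet (passageEvent X y t) := by
  obtain ⟨u, -, hu_lt, hu⟩ := exists_seq_strictMono_tendsto y
  have hinter : passageEvent X y t = ⋂ m, {ω | ∃ s ≤ t, u m < X s ω} := by
    refine Set.Subset.antisymm (Set.subset_iInter fun m ω ⟨s, hs, hle⟩ =>
      ⟨s, hs, (hu_lt m).trans_le hle⟩) ?_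
    rw [passageEvent_eq_iInter hc t (fun m => (hu_lt m).le) hu]
    exact Set.iInter_mono fun m ω ⟨s, hs, hlt⟩ => ⟨s, hs, hlt.le⟩
  rw [hinter]
  exact MeasurableSet.iInter fun m => measurableSet_exists_lt hX hc t (u m)

theorem tendsto_measure_passageEvent [IsFiniteMeasure P] (hX : ∀ t, Measurable (X t))
    (hc : ∀ ω, Continuous fun t => X t ω) (t : ℝ≥0) {y : ℝ} {u : ℕ → ℝ} (hu_mono : Monotone u)
    (hu : Filter.Tendsto u Filter.atTop (nhds y)) :
    Filter.Tendsto (fun m => P (passageEvent X (u m) t)) Filter.atTop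
      (nhds (P (passageEvent X y t))) := by
  rw [passageEvent_eq_iInter hc t (hu_mono.ge_of_tendsto hu) hu]
  exact tendsto_measure_iInter_atTop
    (fun m => (measurableSet_passageEvent hX hc (u m) t).nullMeasurableSet)
    (fun i j hij ω ⟨s, hs, hle⟩ => ⟨s, hs, (hu_mono hij).trans hle⟩) ⟨0, measure_ne_top _ _⟩

theorem setLIntegral_le_liminf_setLIntegral {A : Set Ω} {A' : ℕ → Set Ω} {f : Ω → ℝ≥0∞}
    {g : ℕ → Ω → ℝ≥0∞} (hA : MeasurableSet A) (hA' : ∀ n, MeasurableSet (A' n))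
    (hg : ∀ n, Measurable (g n)) (hAA' : ∀ ω ∈ A, ∀ᶠ n in Filter.atTop, ω ∈ A' n)
    (hfg : ∀ ω ∈ A, f ω ≤ Filter.liminf (fun n => g n ω) Filter.atTop) :
    ∫⁻ ω in A, f ω ∂P ≤ Filter.liminf (fun n => ∫⁻ ω in A' n, g n ω ∂P) Filter.atTop := by
  simp_rw [← lintegral_indicator (hA' _)]
  rw [← lintegral_indicator hA]
  refine le_trans ?_ (lintegral_liminf_le fun n => (hg n).indicator (hA' n))
  refine lintegral_mono (Set.indicator_le fun ω hω => ?_)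
  refine (hfg ω hω).trans (Filter.liminf_le_liminf ?_)
  filter_upwards [hAA' ω hω] with n hn
  rw [Set.indicator_of_mem hn]

variable {θ K a y z : ℝ}

theorem continuous_drifted {ω : Ω} (hω : Continuous fun t => V t ω) (θ : ℝ) :
    Continuous fun t => drifted V θ t ω :=
  hω.add (by fun_prop)

theorem setLIntegral_supExpAbs_le_of_lt (hθ : |θ| ≤ K) (hV : IsPreBrownianReal V P)
    (hVm : ∀ t, Measurable (V t)) (hVc : ∀ ω, Continuous fun t => V t ω) (ha : 0 ≤ a)
    (hz : 0 ≤ z) (hzy : z < y) :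
    ∫⁻ ω in passageEvent (drifted V θ) y 1, supExpAbs a (fun t => drifted V (θ - z) t ω) ∂P ≤
      barrierConst a K * P (passageEvent (drifted V θ) z 1) := by
  have hYm : ∀ θ t, Measurable (drifted V θ t) := measurable_drifted hVm
  have hYc : ∀ θ ω, Continuous fun t => drifted V θ t ω := fun θ ω => continuous_drifted (hVc ω) θ
  refine le_trans (setLIntegral_le_liminf_setLIntegral
    (A' := fun n => {ω | ∃ k ≤ n, z ≤ drifted V θ (gridTime 1 n k) ω})
    (measurableSet_passageEvent (hYm θ) (hYc θ) y 1) (fun n => ?_)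
    (fun n => measurable_maxExpAbs (fun k _ => hYm (θ - z) (gridTime 1 n k)) a) ?_
    fun ω _ => supExpAbs_le_liminf_maxExpAbs (hYc (θ - z) ω) a) ?_
  · simp only [Set.ofPred_exists, Set.ofPred_and]
    exact MeasurableSet.iUnion fun k => (MeasurableSet.const _).inter
      (measurableSet_le measurable_const (hYm θ _))
  · rintro ω ⟨t, ht, hle⟩
    exact eventually_exists_le_gridTime (hYc θ ω) ⟨t, ht, hzy.trans_le hle⟩
  · refine Filter.liminf_le_of_frequently_le' (Filter.Eventually.frequently ?_)
    filter_upwards [Filter.eventually_ne_atTop 0] with n hn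
    refine (setLIntegral_maxExpAbs_drifted_le hθ hV hVm (monotone_gridTime 1 n)
      (gridTime_self 1 hn) ha hz).trans (mul_le_mul_right (measure_mono ?_) _)
    exact fun ω ⟨k, hk, hle⟩ => ⟨gridTime 1 n k, gridTime_le 1 hk, hle⟩

/-- The level is approached from below, since a path that only touches it may stay below it on every
grid. -/
theorem setLIntegral_supExpAbs_le (hθ : |θ| ≤ K) (hV : IsPreBrownianReal V P)
    (hVm : ∀ t, Measurable (V t)) (hVc : ∀ ω, Continuous fun t => V t ω) (ha : 0 ≤ a)
    (hy : 0 < y) :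
    ∫⁻ ω in passageEvent (drifted V θ) y 1, supExpAbs a (fun t => drifted V (θ - y) t ω) ∂P ≤
      barrierConst a K * P (passageEvent (drifted V θ) y 1) := by
  have hprob : IsProbabilityMeasure P := hV.isGaussianProcess.isProbabilityMeasure
  obtain ⟨u, hu_mono, hu_mem, hu⟩ := exists_seq_strictMono_tendsto' hy
  have hexp : Filter.Tendsto (fun m => ENNReal.ofReal (Real.exp (a * |y - u m|))) Filter.atTop
      (nhds 1) := by
    have hcont : Continuous fun z => ENNReal.ofReal (Real.exp (a * |y - z|)) :=
      ENNReal.continuous_ofReal.comp (by fun_prop)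
    simpa [Function.comp_def] using (hcont.tendsto y).comp hu
  have hmeasure := tendsto_measure_passageEvent (P := P) (measurable_drifted hVm θ)
    (fun ω => continuous_drifted (hVc ω) θ) 1 hu_mono.monotone hu
  have hlim := ENNReal.Tendsto.mul hexp (.inl one_ne_zero)
    (ENNReal.Tendsto.const_mul hmeasure (.inr (barrierConst_ne_top a K))) (.inr ENNReal.one_ne_top)
  rw [one_mul] at hlim
  refine ge_of_tendsto' hlim fun m => ?_
  have hdev : ∀ ω, ∀ t ≤ (1 : ℝ≥0),
      |drifted V (θ - y) t ω| ≤ |y - u m| + |drifted V (θ - u m) t ω| := fun ω t ht => by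
    have hsub : drifted V (θ - y) t ω = drifted V (θ - u m) t ω - (y - u m) * t := by
      rw [drifted_sub_mul, sub_sub_sub_cancel_right]
    rw [hsub, add_comm]
    refine (abs_sub _ _).trans (add_le_add_right ?_ _)
    rw [abs_mul, NNReal.abs_eq]
    exact mul_le_of_le_one_right (abs_nonneg _) (by exact_mod_cast ht)
  calc _ ≤ ∫⁻ ω in passageEvent (drifted V θ) y 1, ENNReal.ofReal (Real.exp (a * |y - u m|)) *
          supExpAbs a (fun t => drifted V (θ - u m) t ω) ∂P :=
        lintegral_mono fun ω => supExpAbs_le_mul ha (hdev ω)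
    _ = ENNReal.ofReal (Real.exp (a * |y - u m|)) * ∫⁻ ω in passageEvent (drifted V θ) y 1,
          supExpAbs a (fun t => drifted V (θ - u m) t ω) ∂P :=
        lintegral_const_mul' _ _ ENNReal.ofReal_ne_top
    _ ≤ _ := mul_le_mul_right (setLIntegral_supExpAbs_le_of_lt hθ hV hVm hVc ha
        (hu_mem m).1.le (hu_mem m).2) _

end Passage

section PathFunctionals

variable {Ω K Z : Type*} {mΩ : MeasurableSpace Ω}

theorem measurable_dist_of_measurable_eval [TopologicalSpace K] [CompactSpace K]
    [TopologicalSpace.SeparableSpace K] [PseudoMetricSpace Z] [MeasurableSpace Z]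
    [OpensMeasurableSpace Z] {p : Ω → C(K, Z)} (hp : ∀ k, Measurable fun ω => p ω k) (f : C(K, Z)) :
    Measurable fun ω => dist (p ω) f := by
  obtain ⟨D, hD, hdense⟩ := TopologicalSpace.exists_countable_dense K
  have hcountable : Countable D := hD
  have hsup : (fun ω => edist (p ω) f) = fun ω => ⨆ k : D, edist (p ω k) (f k) := by
    ext ω
    rw [ContinuousMap.edist_eq_iSup, hdense.ciSup' (f := fun k => edist (p ω k) (f k))]
    fun_prop
  have hmeas : Measurable fun ω => edist (p ω) f := by
    rw [hsup]
    exact Measurable.iSup fun k => measurable_edist_left.comp (hp k)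
  exact hmeas.ennreal_toReal

theorem measurable_lipschitz_comp_of_measurable_dist [PseudoMetricSpace Z]
    [TopologicalSpace.SeparableSpace Z] {L : ℝ≥0} {Ψ : Z → ℝ} (hΨ : LipschitzWith L Ψ) {p : Ω → Z}
    (hp : ∀ z, Measurable fun ω => dist (p ω) z) : Measurable fun ω => Ψ (p ω) := by
  obtain ⟨D, hD, hdense⟩ := TopologicalSpace.exists_countable_dense Z
  have hcountable : Countable D := hD
  have hle : ∀ w z, Ψ w ≤ Ψ z + L * dist w z := fun w z => hΨ.le_add_mul w z
  have hinf : (fun ω => Ψ (p ω)) = fun ω => ⨅ z : D, (Ψ z + L * dist (p ω) z) := by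
    ext ω
    rw [hdense.ciInf' (f := fun z => Ψ z + L * dist (p ω) z)
      (hΨ.continuous.add (by fun_prop))]
    have : Nonempty Z := ⟨p ω⟩
    refine le_antisymm (le_ciInf (hle (p ω))) ((ciInf_le ⟨Ψ (p ω), ?_⟩ (p ω)).trans ?_)
    · rintro _ ⟨z, rfl⟩
      exact hle (p ω) z
    · simp
  rw [hinf]
  exact Measurable.iInf fun z => ((hp z).const_mul _).const_add _

theorem exists_integral_indicator_eq_mul_add {P : Measure Ω} [IsFiniteMeasure P] {E : Set Ω}
    (hE : NullMeasurableSet E P) {g : Ω → ℝ} (hg : AEStronglyMeasurable g P) {ψ : ℝ} {κ : ℝ≥0}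
    (hgψ : ∫⁻ ω in E, ‖g ω - ψ‖ₑ ∂P ≤ κ * P E) :
    Integrable (E.indicator g) P ∧
      ∃ r : ℝ, |r| ≤ κ ∧ ∫ ω, E.indicator g ω ∂P = P.real E * (ψ + r) := by
  have hfin : κ * P E ≠ ∞ := ENNReal.mul_ne_top ENNReal.coe_ne_top (measure_ne_top _ _)
  have hdiff : IntegrableOn (fun ω => g ω - ψ) E P :=
    ⟨(hg.sub aestronglyMeasurable_const).restrict, hgψ.trans_lt hfin.lt_top⟩
  have hconst : IntegrableOn (fun _ => ψ) E P := integrableOn_const (measure_ne_top _ _)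
  have hsum : IntegrableOn g E P := (hdiff.add hconst).congr (.of_forall fun ω => by simp)
  refine ⟨hsum.integrable_indicator₀ hE, ⨍ ω in E, (g ω - ψ) ∂P, ?_, ?_⟩
  · have hnorm : |∫ ω in E, (g ω - ψ) ∂P| ≤ κ * P.real E := by
      have := ENNReal.toReal_mono hfin ((enorm_integral_le_lintegral_enorm _).trans hgψ)
      rwa [toReal_enorm, Real.norm_eq_abs, ENNReal.toReal_mul, ENNReal.coe_toReal] at this
    rw [setAverage_eq, smul_eq_mul, inv_mul_eq_div, abs_div, abs_of_nonneg measureReal_nonneg]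
    exact div_le_of_le_mul₀ measureReal_nonneg κ.coe_nonneg hnorm
  · rw [mul_add, ← smul_eq_mul (P.real E) (⨍ _ in _, _ ∂_),
      measure_smul_setAverage _ (measure_ne_top _ _), integral_sub hsum hconst,
      setIntegral_const, smul_eq_mul, integral_indicator₀ hE]
    ring

end PathFunctionals

section Paths

variable {x v : ℝ≥0 → ℝ} {T : ℝ≥0} {S B c y : ℝ}

theorem pathOn_apply (hx : Continuous x) (t : Set.Icc (0 : ℝ≥0) T) : pathOn T x t = x t := by
  have h : Continuous fun t : Set.Icc (0 : ℝ≥0) T => x t := hx.comp continuous_subtype_val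
  simp [pathOn, h]

theorem mem_barrierEvent_iff {Ω : Type*} {X : ℝ≥0 → Ω → ℝ} {ω : Ω}
    (hc : Continuous fun t => X t ω) : ω ∈ barrierEvent X B T ↔ ω ∈ passageEvent X B T := by
  have hne : Nonempty (Set.Icc (0 : ℝ≥0) T) := ⟨⟨0, by simp⟩⟩
  have hcompact : IsCompact (Set.range fun t : Set.Icc (0 : ℝ≥0) T => X t ω) :=
    isCompact_range (hc.comp continuous_subtype_val)
  constructor
  · intro h
    obtain ⟨t, ht⟩ := hcompact.sSup_mem (Set.range_nonempty _)
    exact ⟨t, t.2.2, le_of_le_of_eq h ht.symm⟩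
  · rintro ⟨t, ht, hB⟩
    exact hB.trans (le_ciSup hcompact.bddAbove (⟨t, zero_le, ht⟩ : Set.Icc (0 : ℝ≥0) T))

/-- The level `y` with `S * exp (c * y) = B`. -/
noncomputable def logLevel (S B c : ℝ) : ℝ := Real.log (B / S) / c

theorem logLevel_pos (hS : 0 < S) (hSB : S < B) (hc : 0 < c) : 0 < logLevel S B c :=
  div_pos (Real.log_pos ((one_lt_div hS).2 hSB)) hc

theorem mul_exp_logLevel (hS : 0 < S) (hB : 0 < B) (hc : c ≠ 0) :
    S * Real.exp (c * logLevel S B c) = B := by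
  rw [logLevel, mul_div_cancel₀ _ hc, Real.exp_log (div_pos hB hS), mul_div_cancel₀ _ hS.ne']

theorem le_mul_exp_iff_logLevel_le (hS : 0 < S) (hB : 0 < B) (hc : 0 < c) {u : ℝ} :
    B ≤ S * Real.exp (c * u) ↔ logLevel S B c ≤ u := by
  nth_rw 1 [← mul_exp_logLevel hS hB hc.ne']
  rw [mul_le_mul_iff_right₀ hS, Real.exp_le_exp, mul_le_mul_iff_right₀ hc]

theorem exponentialCurve_apply_eq_mul_exp (hS : 0 < S) (hB : 0 < B) (hc : c ≠ 0)
    (t : Set.Icc (0 : ℝ≥0) T) :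
    exponentialCurve S B hS hB T t =
      S * Real.exp (c * (logLevel S B c * ((t : ℝ≥0) / T : ℝ≥0))) := by
  change S * (B / S) ^ (((t : ℝ≥0) : ℝ) / (T : ℝ)) = _
  rw [Real.rpow_def_of_pos (div_pos hB hS), logLevel, NNReal.coe_div, ← mul_assoc,
    mul_div_cancel₀ _ hc]

theorem exists_le_iff_exists_logLevel_le (hS : 0 < S) (hB : 0 < B) (hc : 0 < c) (hT : T ≠ 0)
    (hx : ∀ s, x (T * s) = S * Real.exp (c * v s)) :
    (∃ t ≤ T, B ≤ x t) ↔ ∃ s ≤ 1, logLevel S B c ≤ v s := by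
  constructor
  · rintro ⟨t, ht, hle⟩
    refine ⟨t / T, div_le_one_of_le₀ ht zero_le, ?_⟩
    rwa [← le_mul_exp_iff_logLevel_le hS hB hc, ← hx, mul_div_cancel₀ t hT]
  · rintro ⟨s, hs, hle⟩
    refine ⟨T * s, mul_le_of_le_one_right zero_le hs, ?_⟩
    rwa [hx, le_mul_exp_iff_logLevel_le hS hB hc]

variable {σ τ : ℝ}

theorem abs_exp_mul_sub_one_le (hσ : 0 ≤ σ) (hτ0 : 0 ≤ τ) (hτ1 : τ ≤ 1) (u : ℝ) :
    |Real.exp (σ * τ * u) - 1| ≤ τ * Real.exp (2 * σ * |u|) := by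
  have hστ : |σ * τ * u| = τ * (σ * |u|) := by
    rw [abs_mul, abs_of_nonneg (mul_nonneg hσ hτ0)]
    ring
  calc |Real.exp (σ * τ * u) - 1| ≤ |σ * τ * u| * Real.exp |σ * τ * u| :=
        abs_exp_sub_one_le_abs_mul_exp_abs _
    _ = τ * ((σ * |u|) * Real.exp (τ * (σ * |u|))) := by
        rw [hστ]
        ring
    _ ≤ τ * (Real.exp (σ * |u|) * Real.exp (σ * |u|)) := by
        refine mul_le_mul_of_nonneg_left (mul_le_mul ?_ (Real.exp_le_exp.2 ?_) ?_ ?_) hτ0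
        · linarith [Real.add_one_le_exp (σ * |u|)]
        · exact mul_le_of_le_one_left (by positivity) hτ1
        all_goals positivity
    _ = τ * Real.exp (2 * σ * |u|) := by
        rw [← Real.exp_add]
        ring_nf

theorem abs_mul_exp_sub_mul_exp_le (hS : 0 ≤ S) (hσ : 0 ≤ σ) (hτ0 : 0 ≤ τ) (hτ1 : τ ≤ 1)
    {u w : ℝ} (hw : S * Real.exp (σ * τ * w) ≤ B) :
    |S * Real.exp (σ * τ * u) - S * Real.exp (σ * τ * w)| ≤
      B * τ * Real.exp (2 * σ * |u - w|) := by
  have hfactor : S * Real.exp (σ * τ * u) - S * Real.exp (σ * τ * w) =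
      S * Real.exp (σ * τ * w) * (Real.exp (σ * τ * (u - w)) - 1) := by
    rw [mul_sub_one, mul_assoc S, ← Real.exp_add, ← mul_add, add_sub_cancel]
  rw [hfactor, abs_mul, abs_of_nonneg (by positivity), mul_assoc B]
  exact mul_le_mul hw (abs_exp_mul_sub_one_le hσ hτ0 hτ1 _) (abs_nonneg _)
    (le_trans (by positivity) hw)

theorem enorm_pathOn_sub_exponentialCurve_le (hS : 0 < S) (hSB : S < B) (hσ : 0 < σ) (hτ0 : 0 < τ)
    (hτ1 : τ ≤ 1) (hT : T ≠ 0) (hxc : Continuous x)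
    (hx : ∀ s, x (T * s) = S * Real.exp (σ * τ * v s)) :
    ‖pathOn T x - exponentialCurve S B hS (hS.trans hSB) T‖ₑ ≤
      ENNReal.ofReal (B * τ) * supExpAbs (2 * σ) (fun s => v s - logLevel S B (σ * τ) * s) := by
  have hστ : 0 < σ * τ := mul_pos hσ hτ0
  have hB : 0 < B := hS.trans hSB
  rw [ContinuousMap.enorm_eq_iSup_enorm]
  refine iSup_le fun t => ?_
  set s : ℝ≥0 := (t : ℝ≥0) / T with hs
  have hs1 : s ≤ 1 := div_le_one_of_le₀ t.2.2 zero_le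
  have hxt : x t = S * Real.exp (σ * τ * v s) := by rw [← hx, hs, mul_div_cancel₀ _ hT]
  have hcurve : S * Real.exp (σ * τ * (logLevel S B (σ * τ) * s)) ≤ B := by
    refine le_of_le_of_eq ?_ (mul_exp_logLevel hS hB hστ.ne')
    gcongr
    exact mul_le_of_le_one_right (logLevel_pos hS hSB hστ).le (by exact_mod_cast hs1)
  rw [ContinuousMap.sub_apply, pathOn_apply hxc, hxt,
    exponentialCurve_apply_eq_mul_exp hS hB hστ.ne', ← ofReal_norm, Real.norm_eq_abs]
  refine (ENNReal.ofReal_le_ofReal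
    (abs_mul_exp_sub_mul_exp_le hS.le hσ.le hτ0.le hτ1 hcurve)).trans ?_
  rw [ENNReal.ofReal_mul (by positivity)]
  exact mul_le_mul_right (le_supExpAbs (2 * σ) (fun s => v s - logLevel S B (σ * τ) * s) hs1) _

end Paths

section GeometricBrownianMotion

variable {Ω : Type*} {mΩ : MeasurableSpace Ω} {P : Measure Ω} {F : Filtration ℝ≥0 mΩ}
  {W X : ℝ≥0 → Ω → ℝ} {μ σ S B : ℝ} {T : ℝ≥0}

theorem IsGBMSolution.nullMeasurableSet_barrierEvent (h : IsGBMSolution P F W μ σ S X) (B : ℝ)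
    (T : ℝ≥0) : NullMeasurableSet (barrierEvent X B T) P := by
  obtain ⟨X', hX'm, hX'c, hXX'⟩ := exists_continuous_modification h.measurable h.cont
  refine ⟨passageEvent X' B T, measurableSet_passageEvent hX'm hX'c B T, ?_⟩
  filter_upwards [hXX', h.cont] with ω hω hc
  refine propext ((mem_barrierEvent_iff hc).trans ?_)
  change (∃ t ≤ T, B ≤ X t ω) ↔ ∃ t ≤ T, B ≤ X' t ω
  simp only [hω]

theorem IsGBMSolution.aestronglyMeasurable_lipschitz_pathOn (h : IsGBMSolution P F W μ σ S X)
    {L : ℝ≥0} {Ψ : C(Set.Icc (0 : ℝ≥0) T, ℝ) → ℝ} (hΨ : LipschitzWith L Ψ) :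
    AEStronglyMeasurable (fun ω => Ψ (pathOn T (fun t => X t ω))) P := by
  obtain ⟨X', hX'm, hX'c, hXX'⟩ := exists_continuous_modification h.measurable h.cont
  have hmeas : Measurable fun ω => Ψ (pathOn T (fun t => X' t ω)) :=
    measurable_lipschitz_comp_of_measurable_dist hΨ <|
      measurable_dist_of_measurable_eval fun t => by
      simp_rw [pathOn_apply (hX'c _)]
      exact hX'm _
  refine ⟨_, hmeas.stronglyMeasurable, ?_⟩
  filter_upwards [hXX'] with ω hω
  simp_rw [hω]

theorem IsGBMSolution.exists_scaled_drifted [IsProbabilityMeasure P]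
    (h : IsGBMSolution P F W μ σ S X) (hσ : σ ≠ 0) (hT : T ≠ 0) :
    ∃ V : ℝ≥0 → Ω → ℝ, IsPreBrownianReal V P ∧ (∀ t, Measurable (V t)) ∧
      (∀ ω, Continuous fun t => V t ω) ∧ ∀ᵐ ω ∂P, ∀ s, X (T * s) ω =
        S * Real.exp (σ * √(T : ℝ) * drifted V ((μ - σ ^ 2 / 2) / σ * √(T : ℝ)) s ω) := by
  obtain ⟨W', hW'm, hW'c, hWW'⟩ := exists_continuous_modification h.brownian.measurable
    h.brownian.isBrownian.cont
  have hW' : IsPreBrownianReal W' P := h.brownian.isBrownian.toIsPreBrownianReal.congr fun t => by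
    filter_upwards [hWW'] with ω hω using hω t
  refine ⟨fun s ω => (√(T : ℝ))⁻¹ * W' (T * s) ω, hW'.smul hT, fun s => (hW'm _).const_mul _,
    fun ω => continuous_const.mul ((hW'c ω).comp (by fun_prop)), ?_⟩
  filter_upwards [h.ae_forall_eq_exp, hWW'] with ω hX hW s
  have hsqrt : √(T : ℝ) ≠ 0 := (Real.sqrt_pos.2 (by exact_mod_cast pos_of_ne_zero hT)).ne'
  have hsq : √(T : ℝ) * √(T : ℝ) = T := Real.mul_self_sqrt T.coe_nonneg
  rw [hX, hW, drifted, NNReal.coe_mul]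
  generalize √(T : ℝ) = τ at *
  rw [← hsq]
  field_simp

theorem IsGBMSolution.setLIntegral_enorm_pathOn_sub_exponentialCurve_le [IsProbabilityMeasure P]
    (h : IsGBMSolution P F W μ σ S X) (hσ : 0 < σ) (hS : 0 < S) (hSB : S < B) (hT : T ≠ 0)
    (hT1 : T ≤ 1) :
    ∫⁻ ω in barrierEvent X B T,
        ‖pathOn T (fun t => X t ω) - exponentialCurve S B hS (hS.trans hSB) T‖ₑ ∂P ≤
      ENNReal.ofReal (B * √(T : ℝ)) * (barrierConst (2 * σ) (|μ - σ ^ 2 / 2| / σ) *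
        P (barrierEvent X B T)) := by
  obtain ⟨V, hV, hVm, hVc, hX⟩ := h.exists_scaled_drifted hσ.ne' hT
  set τ := √(T : ℝ)
  set θ := (μ - σ ^ 2 / 2) / σ * τ with hθ_def
  set y := logLevel S B (σ * τ)
  have hτ0 : 0 < τ := Real.sqrt_pos.2 (by exact_mod_cast pos_of_ne_zero hT)
  have hτ1 : τ ≤ 1 := Real.sqrt_le_one.2 (by exact_mod_cast hT1)
  have hθ : |θ| ≤ |μ - σ ^ 2 / 2| / σ := by
    rw [hθ_def, abs_mul, abs_div, abs_of_pos hσ, abs_of_pos hτ0]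
    exact mul_le_of_le_one_right (by positivity) hτ1
  have hevent : barrierEvent X B T =ᵐ[P] passageEvent (drifted V θ) y 1 := by
    filter_upwards [hX, h.cont] with ω hω hc
    exact propext ((mem_barrierEvent_iff hc).trans
      (exists_le_iff_exists_logLevel_le hS (hS.trans hSB) (mul_pos hσ hτ0) hT hω))
  have hpath : ∀ᵐ ω ∂P, ‖pathOn T (fun t => X t ω) - exponentialCurve S B hS (hS.trans hSB) T‖ₑ ≤
      ENNReal.ofReal (B * τ) * supExpAbs (2 * σ) (fun s => drifted V (θ - y) s ω) := by
    filter_upwards [hX, h.cont] with ω hω hc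
    simp_rw [← drifted_sub_mul]
    exact enorm_pathOn_sub_exponentialCurve_le hS hSB hσ hτ0 hτ1 hT hc hω
  rw [setLIntegral_congr hevent, measure_congr hevent]
  calc _ ≤ ∫⁻ ω in passageEvent (drifted V θ) y 1,
          ENNReal.ofReal (B * τ) * supExpAbs (2 * σ) (fun s => drifted V (θ - y) s ω) ∂P :=
        lintegral_mono_ae (ae_restrict_of_ae hpath)
    _ = ENNReal.ofReal (B * τ) * ∫⁻ ω in passageEvent (drifted V θ) y 1,
          supExpAbs (2 * σ) (fun s => drifted V (θ - y) s ω) ∂P :=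
        lintegral_const_mul' _ _ ENNReal.ofReal_ne_top
    _ ≤ _ := mul_le_mul_right (setLIntegral_supExpAbs_le hθ hV hVm hVc (by positivity)
        (logLevel_pos hS hSB (mul_pos hσ hτ0))) _

theorem setLIntegral_enorm_lipschitz_sub_le {Z : Type*} [SeminormedAddCommGroup Z] {L : ℝ≥0}
    {Ψ : Z → ℝ} (hΨ : LipschitzWith L Ψ) (p : Ω → Z) (z : Z) (E : Set Ω) :
    ∫⁻ ω in E, ‖Ψ (p ω) - Ψ z‖ₑ ∂P ≤ L * ∫⁻ ω in E, ‖p ω - z‖ₑ ∂P := by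
  rw [← lintegral_const_mul' _ _ ENNReal.coe_ne_top]
  refine lintegral_mono fun ω => ?_
  simpa only [edist_eq_enorm_sub] using hΨ (p ω) z

end GeometricBrownianMotion

theorem theorem6 (μ σ B : ℝ) (hσ : 0 < σ) :
    ∃ (C : ℝ) (T₀ : ℝ≥0), 0 < C ∧ 0 < T₀ ∧
      ∀ (S : ℝ) (hS : 0 < S) (hSB : S < B)
        (Ω : Type*) (mΩ : MeasurableSpace Ω) (P : Measure Ω) (_ : IsProbabilityMeasure P)
        (F : Filtration ℝ≥0 mΩ) (W X : ℝ≥0 → Ω → ℝ),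
        IsGBMSolution P F W μ σ S X →
        ∀ (T : ℝ≥0), 0 < T → T ≤ T₀ →
          ∀ (L : ℝ≥0) (Ψ : C(Set.Icc (0 : ℝ≥0) T, ℝ) → ℝ), LipschitzWith L Ψ →
            Integrable (barrierPayoff X B T Ψ) P ∧
            ∃ r : ℝ, |r| ≤ C * L * √(T : ℝ) ∧
              ∫ ω, barrierPayoff X B T Ψ ω ∂P =
                P.real (barrierEvent X B T) *
                  (Ψ (exponentialCurve S B hS (hS.trans hSB) T) + r) := by
  lift barrierConst (2 * σ) (|μ - σ ^ 2 / 2| / σ) to ℝ≥0 using barrierConst_ne_top _ _ with κ hκ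
  refine ⟨|B| * κ + 1, 1, by positivity, one_pos, ?_⟩
  intro S hS hSB Ω mΩ P hP F W X h T hT hT1 L Ψ hΨ
  have hpath := h.setLIntegral_enorm_pathOn_sub_exponentialCurve_le hσ hS hSB hT.ne' hT1
  have hΨpath : ∫⁻ ω in barrierEvent X B T, ‖Ψ (pathOn T fun t => X t ω) -
      Ψ (exponentialCurve S B hS (hS.trans hSB) T)‖ₑ ∂P ≤
        (L * (Real.toNNReal (B * √(T : ℝ)) * κ) : ℝ≥0) * P (barrierEvent X B T) := by
    refine (setLIntegral_enorm_lipschitz_sub_le hΨ _ _ _).trans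
      ((mul_le_mul_right hpath _).trans_eq ?_)
    rw [← hκ, ENNReal.ofReal]
    push_cast
    ring
  obtain ⟨hinteg, r, hr, hmean⟩ := exists_integral_indicator_eq_mul_add
    (h.nullMeasurableSet_barrierEvent B T) (h.aestronglyMeasurable_lipschitz_pathOn hΨ) hΨpath
  refine ⟨hinteg, r, hr.trans ?_, hmean⟩
  have hB : 0 < B := hS.trans hSB
  rw [NNReal.coe_mul, NNReal.coe_mul, Real.coe_toNNReal _ (by positivity), abs_of_pos hB]
  nlinarith [mul_nonneg L.coe_nonneg (Real.sqrt_nonneg (T : ℝ))]
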